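/- **Setting.** Let $k$ be a field and $p\in k[x]$ a polynomial with $p(0)=0$. A ($\mathbb Z$-graded) matrix factorization over a commutative ring $S$ with potential $\varphi\in S$ is a $\mathbb Z$-graded $S$-module $M$ with $d=d_++d_-$, $\deg d_\pm=\pm1$, $d^2=\varphi$. For $x,y\in S$ let $\tilde Z_{x,y}$ be the factorization $S\rightleftarrows S$ with generators $1$ in degree $0$ and $e$ in degree $-1$, $d_+(e)=x$, $d_-(1)=y\,e$; for sequences, $\tilde{\mathcal Z}_{\mathbf x,\mathbf y}=\bigotimes_i\tilde Z_{x_i,y_i}$ (Koszul matrix factorization). If $x$ is homogeneous of polynomial degree $n$ (variables having degree $2$), then $e$ has polynomial degree $n-2$, so that $d_+$ has polynomial degree $2$. When $\varphi=0$, $H^t(M)=\ker d/\operatorname{im} d$ is the total homology, which is $\mathbb Z/2$-graded. If $M$ lies in degrees $\le 0$, $\mathfrak H(M)=H^0(M,d_+)$. Both $H^t$ and $\mathfrak H$ are applied termwise to complexes of matrix factorizations. **The Khovanov–Rozansky complex.** Let $T$ be an oriented tangle diagram, with graph $\mathcal G(T)$ whose vertices are the crossings and the end points and whose edges are the segments of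 the diagram between them (on a closed component without crossings one places a marked point, with a single variable, and a loop edge). Let $\tilde S_T$ be the polynomial ring over $k$ with one variable for each flag (vertex, adjacent edge). To an edge with variables $t_+$ at its head and $t_-$ at its tail assign $L_e=\tilde Z_{\,t_+-t_-,\ (p(t_+)-p(t_-))/(t_+-t_-)}$ (the quotient denotes the divided-difference polynomial, evaluated at $t_\pm$). At a crossing drawn with both strands upwards let $t_i,t_j,t_k,t_l$ be the variables at the upper left, upper right, lower right and lower left. Let $L'$ be the Koszul factorization of $(t_i+t_j-t_k-t_l,\ t_it_j-t_kt_l)$ and $(y_1,y_2)$, where $$y_1=\frac{g(t_i+t_j,t_it_j)-g(t_k+t_l,t_it_j)}{t_i+t_j-t_k-t_l},\qquad y_2=\frac{g(t_k+t_l,t_it_j)-g(t_k+t_l,t_kt_l)}{t_it_j-t_kt_l},\qquad g(a+b,ab)=p(a)+p(b),$$ and $L''$ the Koszul factorization of $(t_i-t_l,\ t_j-t_k)$ and $(y_1+t_ky_2,\ y_1+t_iy_2)$; both have potential $p(t_i)+p(t_j)-p(t_k)-p(t_l)$. Write $1,e_1,e_2,e_1e_2$ and $1,f_1,f_2,f_1f_2$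 for their bases. A positive crossing is assigned the complex $L_x=(\rho^+:L'\to L'')$ and a negative one $L_x=(\rho^-:L''\to L'\{-2\})$, with $L''$ in cohomological degree $0$, where $$\rho^+:\ 1\mapsto1,\ e_1\mapsto f_1+f_2,\ e_2\mapsto t_kf_1+t_if_2,\ e_1e_2\mapsto(t_i-t_k)f_1f_2,$$ $$\rho^-:\ 1\mapsto t_i-t_k,\ f_1\mapsto t_ie_1-e_2,\ f_2\mapsto -t_ke_1+e_2,\ f_1f_2\mapsto e_1e_2,$$ and $\{-2\}$ places the generators in polynomial degrees lower by $2$. The Khovanov–Rozansky complex of matrix factorizations of $T$ is $\mathcal R_p(T)=\bigotimes_eL_e\otimes\bigotimes_xL_x$ (over $\tilde S_T$), and the naive complex of $T$ is $\mathcal N(T)=\mathfrak H(\mathcal R_p(T))$. If $T$ is closed, $\mathcal R_p(T)$ has potential $0$, and $\mathcal K_p(T)=H^t(\mathcal R_p(T))$ is a complex of $k$-vector spaces. **Theorem.** Let $\sigma$ be a braid, given by a word in the generators $\sigma_1^{\pm1},\dots,\sigma_{d-1}^{\pm1}$ of the braid group on $d$ strands, drawn upwards, and let $\bar\sigma$ be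 the diagram of its closure. Regard $\mathcal N(\sigma)$ (Rouquier's complex of Soergel bimodules) as a complex of modules over $k[x_1\otimes1,\dots,x_d\otimes1,1\otimes x_1,\dots,1\otimes x_d]$, where $x_i\otimes1$ and $1\otimes x_i$ act by the variables of the $i$-th bottom and the $i$-th top end point, and let $\tilde{\mathcal Z}_p$ be the Koszul matrix factorization over this ring of the sequences $\{x_i\otimes1-1\otimes x_i\}_i$ and $\left\{\frac{p(x_i\otimes1)-p(1\otimes x_i)}{x_i\otimes1-1\otimes x_i}\right\}_i$ (that of the braid closure arc diagram). Then the complex of vector spaces $$H^t\bigl(\mathcal N(\sigma)\otimes\tilde{\mathcal Z}_p\bigr)$$ is isomorphic to the $\mathfrak{sl}_n$-type Khovanov–Rozansky complex $\mathcal K_p(\bar\sigma)$. The isomorphism can be chosen to preserve the $\mathbb Z/2$-grading of the total homology and, if $p=x^{N+1}$ with $N\ge0$, at the same time the $\mathbb Z$-grading induced by (polynomial degree) $+\,(N-1)\cdot$(matrix factorization degree), with respect to which $d$ is homogeneous of degree $N+1$. -/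

import Mathlib

open scoped Kronecker TensorProduct

universe u

noncomputable section

namespace KhovanovRozansky

/-! ### Graded matrix factorizations and complexes of them -/

/-- The diagonal matrix with entries `(-1) ^ f b`. -/
def signMatrix (S : Type u) [CommRing S] {B : Type} [DecidableEq B] (f : B → ℤ) :
    Matrix B B S :=
  Matrix.diagonal fun b => (((f b).negOnePow : ℤ) : S)

/-- A `ℤ`-graded matrix factorization over `S` on a free module with finite homogeneous basis `B`.
The basis vector `b` has matrix factorization degree `mf b` and polynomial degree `q b`; matrices
act on columns, so the entry `(b, a)` is the coefficient of `b` in the image of `a`.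
The two components `dp`, `dm` of the differential have degree `+1` and `-1`, and the square of
the differential is multiplication by the potential. -/
structure MatFac (S : Type u) [CommRing S] where
  B : Type
  [fin : Fintype B]
  [dec : DecidableEq B]
  mf : B → ℤ
  q : B → ℤ
  potential : S
  dp : Matrix B B S
  dm : Matrix B B S
  dp_deg : ∀ b a, mf b ≠ mf a + 1 → dp b a = 0
  dm_deg : ∀ b a, mf b ≠ mf a - 1 → dm b a = 0
  sq : (dp + dm) * (dp + dm) = potential • (1 : Matrix B B S)

attribute [instance] MatFac.fin MatFac.dec

/-- A bounded complex of (finite free) matrix factorizations with a common potential, written on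
its total module: `coh` is the cohomological degree of a basis vector and `dv` is the
cohomological differential, all of whose components are morphisms of matrix factorizations. -/
structure MFComplex (S : Type u) [CommRing S] extends MatFac S where
  coh : B → ℤ
  dv : Matrix B B S
  dp_coh : ∀ b a, coh b ≠ coh a → dp b a = 0
  dm_coh : ∀ b a, coh b ≠ coh a → dm b a = 0
  dv_mf : ∀ b a, mf b ≠ mf a → dv b a = 0
  dv_coh : ∀ b a, coh b ≠ coh a + 1 → dv b a = 0
  dv_sq : dv * dv = 0
  dv_dp : dv * dp = dp * dv
  dv_dm : dv * dm = dm * dv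

section Constructions

variable {S : Type u} [CommRing S]

theorem signMatrix_sq {B : Type} [Fintype B] [DecidableEq B] (f : B → ℤ) :
    signMatrix S f * signMatrix S f = 1 := by
  rw [signMatrix, Matrix.diagonal_mul_diagonal, ← Matrix.diagonal_one]
  congr 1
  funext b
  rw [← Int.cast_mul, ← Units.val_mul, Int.units_mul_self]
  simp

theorem signMatrix_comm {B : Type} [Fintype B] [DecidableEq B] (f : B → ℤ) (A : Matrix B B S)
    (h : ∀ b a, f b ≠ f a → A b a = 0) :
    signMatrix S f * A = A * signMatrix S f := by
  ext b a
  simp only [signMatrix, Matrix.diagonal_mul, Matrix.mul_diagonal]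
  by_cases hab : f b = f a
  · rw [hab, mul_comm]
  · rw [h b a hab]; simp

theorem signMatrix_anticomm {B : Type} [Fintype B] [DecidableEq B] (f : B → ℤ) (A : Matrix B B S)
    (h : ∀ b a, f b ≠ f a + 1 → f b ≠ f a - 1 → A b a = 0) :
    signMatrix S f * A = -(A * signMatrix S f) := by
  ext b a
  simp only [signMatrix, Matrix.diagonal_mul, Matrix.mul_diagonal, Matrix.neg_apply]
  by_cases h1 : f b = f a + 1
  · rw [h1, Int.negOnePow_succ]; push_cast; ring
  · by_cases h2 : f b = f a - 1
    · have : f a = f b + 1 := by omega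
      rw [this, Int.negOnePow_succ]; push_cast; ring
    · rw [h b a h1 h2]; simp

/-- The unit for the tensor product: `S` itself, with zero differential. -/
def MatFac.unit : MatFac S where
  B := Unit
  mf _ := 0
  q _ := 0
  potential := 0
  dp := 0
  dm := 0
  dp_deg _ _ _ := rfl
  dm_deg _ _ _ := rfl
  sq := by simp

/-- The elementary matrix factorization `S ⇄ S` given by multiplication by `x` (of degree `+1`)
and by `y` (of degree `-1`). The generator `false` is `1`, in degree `0`; the generator `true`
is in degree `-1`. If `x` has polynomial degree `n`, the generator `true` is placed in polynomial
degree `n - 2`, so that `dp` has polynomial degree `2`. -/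
def MatFac.koszul (x y : S) (n : ℤ) : MatFac S where
  B := Bool
  mf b := bif b then -1 else 0
  q b := bif b then n - 2 else 0
  potential := x * y
  dp := Matrix.of fun b a => match b, a with
    | false, true => x
    | _, _ => 0
  dm := Matrix.of fun b a => match b, a with
    | true, false => y
    | _, _ => 0
  dp_deg := by rintro (_ | _) (_ | _) h <;> simp_all
  dm_deg := by rintro (_ | _) (_ | _) h <;> simp_all
  sq := by
    ext (_ | _) (_ | _) <;> simp [Matrix.mul_apply, mul_comm]

/-- The tensor product of matrix factorizations, with the usual Koszul sign. -/
def MatFac.tensor (M N : MatFac S) : MatFac S where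
  B := M.B × N.B
  mf b := M.mf b.1 + N.mf b.2
  q b := M.q b.1 + N.q b.2
  potential := M.potential + N.potential
  dp := M.dp ⊗ₖ (1 : Matrix N.B N.B S) + signMatrix S M.mf ⊗ₖ N.dp
  dm := M.dm ⊗ₖ (1 : Matrix N.B N.B S) + signMatrix S M.mf ⊗ₖ N.dm
  dp_deg := by
    rintro ⟨b, b'⟩ ⟨a, a'⟩ h
    simp only [Matrix.add_apply, Matrix.kroneckerMap_apply, Matrix.one_apply, signMatrix,
      Matrix.diagonal_apply] at h ⊢
    have h1 : M.dp b a * (if b' = a' then (1 : S) else 0) = 0 := by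
      split_ifs with hb
      · subst hb; rw [M.dp_deg b a (by omega), zero_mul]
      · simp
    have h2 : (if b = a then (((M.mf b).negOnePow : ℤ) : S) else 0) * N.dp b' a' = 0 := by
      split_ifs with hb
      · subst hb; rw [N.dp_deg b' a' (by omega), mul_zero]
      · simp
    rw [h1, h2, add_zero]
  dm_deg := by
    rintro ⟨b, b'⟩ ⟨a, a'⟩ h
    simp only [Matrix.add_apply, Matrix.kroneckerMap_apply, Matrix.one_apply, signMatrix,
      Matrix.diagonal_apply] at h ⊢
    have h1 : M.dm b a * (if b' = a' then (1 : S) else 0) = 0 := by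
      split_ifs with hb
      · subst hb; rw [M.dm_deg b a (by omega), zero_mul]
      · simp
    have h2 : (if b = a then (((M.mf b).negOnePow : ℤ) : S) else 0) * N.dm b' a' = 0 := by
      split_ifs with hb
      · subst hb; rw [N.dm_deg b' a' (by omega), mul_zero]
      · simp
    rw [h1, h2, add_zero]
  sq := by
    have key : (M.dp ⊗ₖ (1 : Matrix N.B N.B S) + signMatrix S M.mf ⊗ₖ N.dp) +
        (M.dm ⊗ₖ (1 : Matrix N.B N.B S) + signMatrix S M.mf ⊗ₖ N.dm) =
        (M.dp + M.dm) ⊗ₖ (1 : Matrix N.B N.B S) + signMatrix S M.mf ⊗ₖ (N.dp + N.dm) := by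
      rw [Matrix.add_kronecker, Matrix.kronecker_add]; abel
    have anti := signMatrix_anticomm M.mf (M.dp + M.dm) (fun b a h1 h2 => by
      rw [Matrix.add_apply, M.dp_deg b a h1, M.dm_deg b a h2, add_zero])
    rw [key]
    simp only [add_mul, mul_add, ← Matrix.mul_kronecker_mul, one_mul, mul_one]
    simp only [← add_mul, ← mul_add, M.sq, N.sq, anti, signMatrix_sq]
    rw [Matrix.smul_kronecker, Matrix.kronecker_smul, Matrix.one_kronecker_one, add_smul,
      ← neg_one_smul S, Matrix.smul_kronecker, neg_one_smul]
    abel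

/-- The unit complex. -/
def MFComplex.unit : MFComplex S where
  toMatFac := MatFac.unit
  coh _ := 0
  dv := 0
  dp_coh _ _ _ := rfl
  dm_coh _ _ _ := rfl
  dv_mf _ _ _ := rfl
  dv_coh _ _ _ := rfl
  dv_sq := by simp
  dv_dp := by simp
  dv_dm := by simp

/-- A matrix factorization as a complex concentrated in cohomological degree `0`. -/
def MFComplex.single (M : MatFac S) : MFComplex S where
  toMatFac := M
  coh _ := 0
  dv := 0
  dp_coh _ _ h := absurd rfl h
  dm_coh _ _ h := absurd rfl h
  dv_mf _ _ _ := rfl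
  dv_coh _ _ _ := rfl
  dv_sq := by simp
  dv_dp := by simp
  dv_dm := by simp

/-- The two-term complex `f : M → N{s}` with `M` in cohomological degree `c` and `N` in degree
`c + 1`; the polynomial degrees of `N` are shifted by `s`. -/
def MFComplex.twoTerm (M N : MatFac S) (c s : ℤ) (f : Matrix N.B M.B S)
    (hpot : M.potential = N.potential) (hdeg : ∀ b a, N.mf b ≠ M.mf a → f b a = 0)
    (hp : f * M.dp = N.dp * f) (hm : f * M.dm = N.dm * f) : MFComplex S where
  B := M.B ⊕ N.B
  mf := Sum.elim M.mf N.mf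
  q := Sum.elim M.q (fun b => N.q b + s)
  potential := M.potential
  dp := Matrix.fromBlocks M.dp 0 0 N.dp
  dm := Matrix.fromBlocks M.dm 0 0 N.dm
  dp_deg := by
    rintro (b | b) (a | a) h
    · exact M.dp_deg b a h
    · rfl
    · rfl
    · exact N.dp_deg b a h
  dm_deg := by
    rintro (b | b) (a | a) h
    · exact M.dm_deg b a h
    · rfl
    · rfl
    · exact N.dm_deg b a h
  sq := by
    rw [Matrix.fromBlocks_add, Matrix.fromBlocks_multiply, ← Matrix.fromBlocks_one,
      Matrix.fromBlocks_smul]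
    simp [M.sq, N.sq, hpot]
  coh := Sum.elim (fun _ => c) (fun _ => c + 1)
  dv := Matrix.fromBlocks 0 0 f 0
  dp_coh := by rintro (b | b) (a | a) h <;> simp_all
  dm_coh := by rintro (b | b) (a | a) h <;> simp_all
  dv_mf := by
    rintro (b | b) (a | a) h
    · rfl
    · rfl
    · exact hdeg b a h
    · rfl
  dv_coh := by rintro (b | b) (a | a) h <;> simp_all
  dv_sq := by simp [Matrix.fromBlocks_multiply]
  dv_dp := by simp [Matrix.fromBlocks_multiply, hp]
  dv_dm := by simp [Matrix.fromBlocks_multiply, hm]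

theorem kronecker_sum_eq_zero {B C : Type} [DecidableEq B] [DecidableEq C] {g : B → ℤ}
    {A : Matrix B B S} {A' : Matrix C C S} {b a : B} {b' a' : C}
    (h1 : b' = a' → A b a = 0) (h2 : b = a → A' b' a' = 0) :
    (A ⊗ₖ (1 : Matrix C C S) + signMatrix S g ⊗ₖ A') (b, b') (a, a') = 0 := by
  simp only [Matrix.add_apply, Matrix.kroneckerMap_apply, Matrix.one_apply, signMatrix,
    Matrix.diagonal_apply]
  split_ifs with h h' h' <;> simp_all

/-- The tensor product of complexes of matrix factorizations: the tensor product in the matrix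
factorization direction, with the total complex differential in the cohomological direction. -/
def MFComplex.tensor (C D : MFComplex S) : MFComplex S where
  toMatFac := C.toMatFac.tensor D.toMatFac
  coh b := C.coh b.1 + D.coh b.2
  dv := C.dv ⊗ₖ (1 : Matrix D.B D.B S) + signMatrix S C.coh ⊗ₖ D.dv
  dp_coh := by
    rintro ⟨b, b'⟩ ⟨a, a'⟩ h
    refine kronecker_sum_eq_zero (fun e => C.dp_coh _ _ ?_) (fun e => D.dp_coh _ _ ?_) <;>
      · subst e; simpa using h
  dm_coh := by
    rintro ⟨b, b'⟩ ⟨a, a'⟩ h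
    refine kronecker_sum_eq_zero (fun e => C.dm_coh _ _ ?_) (fun e => D.dm_coh _ _ ?_) <;>
      · subst e; simpa using h
  dv_mf := by
    rintro ⟨b, b'⟩ ⟨a, a'⟩ h
    refine kronecker_sum_eq_zero (fun e => C.dv_mf _ _ ?_) (fun e => D.dv_mf _ _ ?_) <;>
      · subst e; simpa [MatFac.tensor] using h
  dv_coh := by
    rintro ⟨b, b'⟩ ⟨a, a'⟩ h
    refine kronecker_sum_eq_zero (fun e => C.dv_coh _ _ ?_) (fun e => D.dv_coh _ _ ?_) <;>
      · subst e; intro h'; apply h; simp only; omega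
  dv_sq := by
    have anti := signMatrix_anticomm C.coh C.dv (fun b a h1 _ => C.dv_coh b a h1)
    change (C.dv ⊗ₖ (1 : Matrix D.B D.B S) + signMatrix S C.coh ⊗ₖ D.dv) *
      (C.dv ⊗ₖ (1 : Matrix D.B D.B S) + signMatrix S C.coh ⊗ₖ D.dv) = 0
    simp only [add_mul, mul_add, ← Matrix.mul_kronecker_mul, one_mul, mul_one]
    rw [C.dv_sq, D.dv_sq, anti, ← neg_one_smul S, Matrix.smul_kronecker]
    simp
  dv_dp := by
    have h1 := signMatrix_comm C.mf C.dv C.dv_mf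
    have h2 := signMatrix_comm C.coh C.dp C.dp_coh
    have h3 : signMatrix S C.coh * signMatrix S C.mf = signMatrix S C.mf * signMatrix S C.coh := by
      simp [signMatrix, mul_comm]
    change (C.dv ⊗ₖ (1 : Matrix D.B D.B S) + signMatrix S C.coh ⊗ₖ D.dv) *
      (C.dp ⊗ₖ (1 : Matrix D.B D.B S) + signMatrix S C.mf ⊗ₖ D.dp) =
      (C.dp ⊗ₖ (1 : Matrix D.B D.B S) + signMatrix S C.mf ⊗ₖ D.dp) *
      (C.dv ⊗ₖ (1 : Matrix D.B D.B S) + signMatrix S C.coh ⊗ₖ D.dv)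
    simp only [add_mul, mul_add, ← Matrix.mul_kronecker_mul, one_mul, mul_one]
    rw [C.dv_dp, D.dv_dp, h1, h2, h3]
    abel
  dv_dm := by
    have h1 := signMatrix_comm C.mf C.dv C.dv_mf
    have h2 := signMatrix_comm C.coh C.dm C.dm_coh
    have h3 : signMatrix S C.coh * signMatrix S C.mf = signMatrix S C.mf * signMatrix S C.coh := by
      simp [signMatrix, mul_comm]
    change (C.dv ⊗ₖ (1 : Matrix D.B D.B S) + signMatrix S C.coh ⊗ₖ D.dv) *
      (C.dm ⊗ₖ (1 : Matrix D.B D.B S) + signMatrix S C.mf ⊗ₖ D.dm) =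
      (C.dm ⊗ₖ (1 : Matrix D.B D.B S) + signMatrix S C.mf ⊗ₖ D.dm) *
      (C.dv ⊗ₖ (1 : Matrix D.B D.B S) + signMatrix S C.coh ⊗ₖ D.dv)
    simp only [add_mul, mul_add, ← Matrix.mul_kronecker_mul, one_mul, mul_one]
    rw [C.dv_dm, D.dv_dm, h1, h2, h3]
    abel

end Constructions

/-! ### Polynomials attached to the potential -/

section Potential

variable {k : Type u} [CommRing k] {S : Type u} [CommRing S] [Algebra k S]

/-- The divided difference `(p(a) - p(b)) / (a - b)` as a polynomial in `a` and `b`. -/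
def divDiff (p : Polynomial k) (a b : S) : S :=
  p.sum fun m c => c • ∑ r ∈ Finset.range m, a ^ r * b ^ (m - 1 - r)

theorem divDiff_mul (p : Polynomial k) (a b : S) :
    (a - b) * divDiff p a b = Polynomial.aeval a p - Polynomial.aeval b p := by
  simp only [divDiff, Polynomial.aeval_def, Polynomial.eval₂_eq_sum, Polynomial.sum_def,
    ← Algebra.smul_def]
  rw [Finset.mul_sum, ← Finset.sum_sub_distrib]
  refine Finset.sum_congr rfl fun m _ => ?_
  rw [mul_smul_comm, (Commute.all a b).mul_geom_sum₂, smul_sub]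

/-- The power sum `a ^ m + b ^ m` as a polynomial in `s = a + b` and `q = a * b`. -/
def powerSum (s q : S) : ℕ → S
  | 0 => 2
  | 1 => s
  | m + 2 => s * powerSum s q (m + 1) - q * powerSum s q m

/-- `(powerSum s q m - powerSum s' q m) / (s - s')`. -/
def powerSumDiffLeft (s s' q : S) : ℕ → S
  | 0 => 0
  | 1 => 1
  | m + 2 => powerSum s q (m + 1) + s' * powerSumDiffLeft s s' q (m + 1)
      - q * powerSumDiffLeft s s' q m

/-- `(powerSum s' q m - powerSum s' q' m) / (q - q')`. -/
def powerSumDiffRight (s' q q' : S) : ℕ → S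
  | 0 => 0
  | 1 => 0
  | m + 2 => s' * powerSumDiffRight s' q q' (m + 1) - powerSum s' q m
      - q' * powerSumDiffRight s' q q' m

theorem powerSum_eq (a b : S) (m : ℕ) : powerSum (a + b) (a * b) m = a ^ m + b ^ m := by
  induction m using Nat.twoStepInduction with
  | zero => simp [powerSum]; norm_num
  | one => simp [powerSum]
  | more m h0 h1 => rw [powerSum, h0, h1]; ring

theorem powerSumDiff_eq (s s' q q' : S) (m : ℕ) :
    (s - s') * powerSumDiffLeft s s' q m + (q - q') * powerSumDiffRight s' q q' m =
      powerSum s q m - powerSum s' q' m := by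
  have hl : ∀ m, (s - s') * powerSumDiffLeft s s' q m = powerSum s q m - powerSum s' q m := by
    intro m
    induction m using Nat.twoStepInduction with
    | zero => simp [powerSum, powerSumDiffLeft]
    | one => simp [powerSum, powerSumDiffLeft]
    | more m h0 h1 =>
      rw [powerSum, powerSum, powerSumDiffLeft]
      linear_combination s' * h1 - q * h0
  have hr : ∀ m, (q - q') * powerSumDiffRight s' q q' m =
      powerSum s' q m - powerSum s' q' m := by
    intro m
    induction m using Nat.twoStepInduction with
    | zero => simp [powerSum, powerSumDiffRight]
    | one => simp [powerSum, powerSumDiffRight]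
    | more m h0 h1 =>
      rw [powerSum, powerSum, powerSumDiffRight]
      linear_combination s' * h1 - q' * h0
  rw [hl, hr]; ring

/-- The coefficient of `ti + tj - tk - tl` in the potential
`p(ti) + p(tj) - p(tk) - p(tl)` of a crossing. -/
def crossingY₁ (p : Polynomial k) (ti tj tk tl : S) : S :=
  p.sum fun m c => c • powerSumDiffLeft (ti + tj) (tk + tl) (ti * tj) m

/-- The coefficient of `ti * tj - tk * tl` in the potential of a crossing. -/
def crossingY₂ (p : Polynomial k) (ti tj tk tl : S) : S :=
  p.sum fun m c => c • powerSumDiffRight (tk + tl) (ti * tj) (tk * tl) m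

end Potential

/-! ### The complexes attached to edges and crossings -/

section Local

variable {k : Type u} [CommRing k] {S : Type u} [CommRing S] [Algebra k S]

/-- The Koszul matrix factorization of the pair `(t - t', (p(t) - p(t')) / (t - t'))`, where
`t`, `t'` are the variables at the head and at the tail of an edge or arc. -/
def arcFactor (p : Polynomial k) (head tail : S) : MatFac S :=
  MatFac.koszul (head - tail) (divDiff p head tail) 2

/-- The factorization `L'` of a crossing: the Koszul matrix factorization on the sequence
`(ti + tj - tk - tl, ti * tj - tk * tl)`. -/
def wideEdge (p : Polynomial k) (ti tj tk tl : S) : MatFac S :=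
  (MatFac.koszul (ti + tj - tk - tl) (crossingY₁ p ti tj tk tl) 2).tensor
    (MatFac.koszul (ti * tj - tk * tl) (crossingY₂ p ti tj tk tl) 4)

/-- The factorization `L''` of a crossing: a Koszul matrix factorization on the sequence
`(ti - tl, tj - tk)`, with the same potential. -/
def orientedSmoothing (p : Polynomial k) (ti tj tk tl : S) : MatFac S :=
  (MatFac.koszul (ti - tl) (crossingY₁ p ti tj tk tl + tk * crossingY₂ p ti tj tk tl) 2).tensor
    (MatFac.koszul (tj - tk) (crossingY₁ p ti tj tk tl + ti * crossingY₂ p ti tj tk tl) 2)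

theorem wideEdge_potential (p : Polynomial k) (ti tj tk tl : S) :
    (wideEdge p ti tj tk tl).potential =
      Polynomial.aeval ti p + Polynomial.aeval tj p
        - Polynomial.aeval tk p - Polynomial.aeval tl p := by
  change (ti + tj - tk - tl) * crossingY₁ p ti tj tk tl +
    (ti * tj - tk * tl) * crossingY₂ p ti tj tk tl = _
  simp only [crossingY₁, crossingY₂, Polynomial.aeval_def, Polynomial.eval₂_eq_sum,
    Polynomial.sum_def, ← Algebra.smul_def]
  rw [Finset.mul_sum, Finset.mul_sum, ← Finset.sum_add_distrib, ← Finset.sum_add_distrib,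
    ← Finset.sum_sub_distrib, ← Finset.sum_sub_distrib]
  refine Finset.sum_congr rfl fun m _ => ?_
  have h := powerSumDiff_eq (ti + tj) (tk + tl) (ti * tj) (tk * tl) m
  rw [powerSum_eq, powerSum_eq] at h
  rw [mul_smul_comm, mul_smul_comm, ← smul_add, ← smul_add, ← smul_sub, ← smul_sub]
  congr 1
  linear_combination h

theorem orientedSmoothing_potential (p : Polynomial k) (ti tj tk tl : S) :
    (wideEdge p ti tj tk tl).potential = (orientedSmoothing p ti tj tk tl).potential := by
  change (ti + tj - tk - tl) * crossingY₁ p ti tj tk tl +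
    (ti * tj - tk * tl) * crossingY₂ p ti tj tk tl =
    (ti - tl) * (crossingY₁ p ti tj tk tl + tk * crossingY₂ p ti tj tk tl) +
    (tj - tk) * (crossingY₁ p ti tj tk tl + ti * crossingY₂ p ti tj tk tl)
  ring

/-- The map `L' → L''`: it is `1` on the generators of degree `0`. -/
def rhoPlus (ti tk : S) : Matrix (Bool × Bool) (Bool × Bool) S :=
  Matrix.of fun b a => match b, a with
    | (false, false), (false, false) => 1
    | (true, false), (true, false) => 1
    | (false, true), (true, false) => 1
    | (true, false), (false, true) => tk
    | (false, true), (false, true) => ti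
    | (true, true), (true, true) => ti - tk
    | _, _ => 0

/-- The map `L'' → L'`: it is multiplication by `ti - tk` on the generators of degree `0`. -/
def rhoMinus (ti tk : S) : Matrix (Bool × Bool) (Bool × Bool) S :=
  Matrix.of fun b a => match b, a with
    | (false, false), (false, false) => ti - tk
    | (true, false), (true, false) => ti
    | (false, true), (true, false) => -1
    | (true, false), (false, true) => -tk
    | (false, true), (false, true) => 1
    | (true, true), (true, true) => 1
    | _, _ => 0

/-- The explicit form of `dp` for the tensor product of two elementary factorizations. -/
def koszulPlus (x x' : S) : Matrix (Bool × Bool) (Bool × Bool) S :=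
  Matrix.of fun b a => match b, a with
    | (false, false), (true, false) => x
    | (false, true), (true, true) => x
    | (false, false), (false, true) => x'
    | (true, false), (true, true) => -x'
    | _, _ => 0

/-- The explicit form of `dm` for the tensor product of two elementary factorizations. -/
def koszulMinus (y y' : S) : Matrix (Bool × Bool) (Bool × Bool) S :=
  Matrix.of fun b a => match b, a with
    | (true, false), (false, false) => y
    | (true, true), (false, true) => y
    | (false, true), (false, false) => y'
    | (true, true), (true, false) => -y'
    | _, _ => 0

theorem mul_apply_bool (A A' : Matrix (Bool × Bool) (Bool × Bool) S) (b a : Bool × Bool) :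
    (A * A') b a = A b (false, false) * A' (false, false) a + A b (false, true) * A' (false, true) a
      + A b (true, false) * A' (true, false) a + A b (true, true) * A' (true, true) a := by
  rw [Matrix.mul_apply, Fintype.sum_prod_type, Fintype.sum_bool, Fintype.sum_bool,
    Fintype.sum_bool]
  ring

theorem koszul_tensor_dp (x y x' y' : S) (n n' : ℤ) :
    ((MatFac.koszul x y n).tensor (MatFac.koszul x' y' n')).dp = koszulPlus x x' := by
  ext (⟨_ | _, _ | _⟩ : Bool × Bool) (⟨_ | _, _ | _⟩ : Bool × Bool) <;>
    simp [MatFac.tensor, MatFac.koszul, signMatrix, Matrix.kroneckerMap_apply, koszulPlus]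

theorem koszul_tensor_dm (x y x' y' : S) (n n' : ℤ) :
    ((MatFac.koszul x y n).tensor (MatFac.koszul x' y' n')).dm = koszulMinus y y' := by
  ext (⟨_ | _, _ | _⟩ : Bool × Bool) (⟨_ | _, _ | _⟩ : Bool × Bool) <;>
    simp [MatFac.tensor, MatFac.koszul, signMatrix, Matrix.kroneckerMap_apply, koszulMinus]

theorem rhoPlus_plus (ti tj tk tl : S) :
    rhoPlus ti tk * koszulPlus (ti + tj - tk - tl) (ti * tj - tk * tl) = koszulPlus (ti - tl) (tj - tk) * rhoPlus ti tk := by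
  ext ⟨_ | _, _ | _⟩ ⟨_ | _, _ | _⟩ <;>
    (rw [mul_apply_bool, mul_apply_bool]; dsimp only [rhoPlus, koszulPlus, Matrix.of_apply]; ring)

theorem rhoPlus_minus (ti tk y y' : S) :
    rhoPlus ti tk * koszulMinus y y' = koszulMinus (y + tk * y') (y + ti * y') * rhoPlus ti tk := by
  ext ⟨_ | _, _ | _⟩ ⟨_ | _, _ | _⟩ <;>
    (rw [mul_apply_bool, mul_apply_bool]; dsimp only [rhoPlus, koszulMinus, Matrix.of_apply]; ring)

theorem rhoMinus_plus (ti tj tk tl : S) :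
    rhoMinus ti tk * koszulPlus (ti - tl) (tj - tk) = koszulPlus (ti + tj - tk - tl) (ti * tj - tk * tl) * rhoMinus ti tk := by
  ext ⟨_ | _, _ | _⟩ ⟨_ | _, _ | _⟩ <;>
    (rw [mul_apply_bool, mul_apply_bool]; dsimp only [rhoMinus, koszulPlus, Matrix.of_apply]; ring)

theorem rhoMinus_minus (ti tk y y' : S) :
    rhoMinus ti tk * koszulMinus (y + tk * y') (y + ti * y') = koszulMinus y y' * rhoMinus ti tk := by
  ext ⟨_ | _, _ | _⟩ ⟨_ | _, _ | _⟩ <;>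
    (rw [mul_apply_bool, mul_apply_bool]; dsimp only [rhoMinus, koszulMinus, Matrix.of_apply]; ring)

theorem rhoPlus_comm (p : Polynomial k) (ti tj tk tl : S)
    (ρ : Matrix (orientedSmoothing p ti tj tk tl).B (wideEdge p ti tj tk tl).B S)
    (hρ : ρ = rhoPlus ti tk) :
    ρ * (wideEdge p ti tj tk tl).dp = (orientedSmoothing p ti tj tk tl).dp * ρ ∧
      ρ * (wideEdge p ti tj tk tl).dm = (orientedSmoothing p ti tj tk tl).dm * ρ := by
  subst hρ
  have e : (wideEdge p ti tj tk tl).dp = koszulPlus _ _ := koszul_tensor_dp ..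
  have e' : (orientedSmoothing p ti tj tk tl).dp = koszulPlus _ _ := koszul_tensor_dp ..
  have f : (wideEdge p ti tj tk tl).dm = koszulMinus _ _ := koszul_tensor_dm ..
  have f' : (orientedSmoothing p ti tj tk tl).dm = koszulMinus _ _ := koszul_tensor_dm ..
  rw [e, e', f, f']
  exact ⟨rhoPlus_plus ti tj tk tl, rhoPlus_minus ti tk _ _⟩

theorem rhoMinus_comm (p : Polynomial k) (ti tj tk tl : S)
    (ρ : Matrix (wideEdge p ti tj tk tl).B (orientedSmoothing p ti tj tk tl).B S)
    (hρ : ρ = rhoMinus ti tk) :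
    ρ * (orientedSmoothing p ti tj tk tl).dp = (wideEdge p ti tj tk tl).dp * ρ ∧
      ρ * (orientedSmoothing p ti tj tk tl).dm = (wideEdge p ti tj tk tl).dm * ρ := by
  subst hρ
  have e : (orientedSmoothing p ti tj tk tl).dp = koszulPlus _ _ := koszul_tensor_dp ..
  have e' : (wideEdge p ti tj tk tl).dp = koszulPlus _ _ := koszul_tensor_dp ..
  have f : (orientedSmoothing p ti tj tk tl).dm = koszulMinus _ _ := koszul_tensor_dm ..
  have f' : (wideEdge p ti tj tk tl).dm = koszulMinus _ _ := koszul_tensor_dm ..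
  rw [e, e', f, f']
  exact ⟨rhoMinus_plus ti tj tk tl, rhoMinus_minus ti tk _ _⟩

/-- The complex of a positive crossing: `L' → L''` with `L''` in cohomological degree `0`. -/
def positiveCrossing (p : Polynomial k) (ti tj tk tl : S) : MFComplex S :=
  MFComplex.twoTerm (wideEdge p ti tj tk tl) (orientedSmoothing p ti tj tk tl) (-1) 0
    (rhoPlus ti tk) (orientedSmoothing_potential p ti tj tk tl)
    (by rintro (⟨_ | _, _ | _⟩ : Bool × Bool) (⟨_ | _, _ | _⟩ : Bool × Bool) h <;>
      first | rfl | exact absurd rfl h)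
    (rhoPlus_comm p ti tj tk tl _ rfl).1 (rhoPlus_comm p ti tj tk tl _ rfl).2

/-- The complex of a negative crossing: `L'' → L'{-2}` with `L''` in cohomological degree `0`. -/
def negativeCrossing (p : Polynomial k) (ti tj tk tl : S) : MFComplex S :=
  MFComplex.twoTerm (orientedSmoothing p ti tj tk tl) (wideEdge p ti tj tk tl) 0 (-2)
    (rhoMinus ti tk) (orientedSmoothing_potential p ti tj tk tl).symm
    (by rintro (⟨_ | _, _ | _⟩ : Bool × Bool) (⟨_ | _, _ | _⟩ : Bool × Bool) h <;>
      first | rfl | exact absurd rfl h)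
    (rhoMinus_comm p ti tj tk tl _ rfl).1 (rhoMinus_comm p ti tj tk tl _ rfl).2

end Local

/-! ### Passing from matrices to modules -/

section Matrices

/-- The linear map of the block of a matrix between the basis vectors in `P` and those in `Q`. -/
def blockMap {S : Type u} [CommRing S] {B : Type} [Fintype B] (A : Matrix B B S)
    (P Q : B → Prop) [DecidablePred P] : ({b // P b} → S) →ₗ[S] ({b // Q b} → S) :=
  (A.submatrix Subtype.val Subtype.val).mulVecLin

theorem blockMap_comp {S : Type u} [CommRing S] {B : Type} [Fintype B] (A' A : Matrix B B S)
    (P Q R : B → Prop) [DecidablePred P] [DecidablePred Q]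
    (h : ∀ c a, P a → ¬ Q c → A c a = 0) :
    blockMap A' Q R ∘ₗ blockMap A P Q = blockMap (A' * A) P R := by
  rw [blockMap, blockMap, blockMap, ← Matrix.mulVecLin_mul]
  congr 1
  ext b a
  simp only [Matrix.mul_apply, Matrix.submatrix_apply]
  rw [← Finset.sum_filter_add_sum_filter_not Finset.univ Q, Finset.sum_subtype (p := Q)
    (Finset.univ.filter Q) (by simp)]
  rw [Finset.sum_eq_zero (s := Finset.univ.filter fun c => ¬ Q c), add_zero]
  intro c hc
  rw [h c a a.2 (by simpa using hc), mul_zero]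

theorem blockMap_eq_zero {S : Type u} [CommRing S] {B : Type} [Fintype B] (A : Matrix B B S)
    (P Q : B → Prop) [DecidablePred P] (h : ∀ b a, P a → Q b → A b a = 0) :
    blockMap A P Q = 0 := by
  ext v b
  simp [blockMap, Matrix.mulVec, dotProduct, h _ _ (Subtype.property _) (Subtype.property _)]

end Matrices

/-! ### Total homology -/

/-- A `ℤ`-indexed complex `(M, V)` of `k`-modules together with an endomorphism `D` of each term
commuting with `V` (the total differential of a complex of matrix factorizations). -/
structure DiffComplex (k : Type u) [CommRing k] where
  M : ℤ → Type u
  [grp : ∀ j, AddCommGroup (M j)]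
  [mod : ∀ j, Module k (M j)]
  D : ∀ j, M j →ₗ[k] M j
  V : ∀ i j, M i →ₗ[k] M j
  V_comp_D : ∀ i j, V i j ∘ₗ D i = D j ∘ₗ V i j
  V_shape : ∀ i j, i + 1 ≠ j → V i j = 0
  V_comp_V : ∀ i j l, V j l ∘ₗ V i j = 0

attribute [instance] DiffComplex.grp DiffComplex.mod

namespace DiffComplex

variable {k : Type u} [CommRing k] (E : DiffComplex k)

/-- The boundaries inside the cycles of `D`. -/
def boundaries (j : ℤ) : Submodule k (LinearMap.ker (E.D j)) :=
  (LinearMap.range (E.D j)).comap (LinearMap.ker (E.D j)).subtype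

/-- The homology `ker D / (im D ∩ ker D)` of the `j`-th term with respect to `D`; if the potential
vanishes then `D ^ 2 = 0` and this is `ker D / im D`. -/
def H (j : ℤ) : Type u := LinearMap.ker (E.D j) ⧸ E.boundaries j

instance (j : ℤ) : AddCommGroup (E.H j) :=
  inferInstanceAs (AddCommGroup (LinearMap.ker (E.D j) ⧸ E.boundaries j))

instance (j : ℤ) : Module k (E.H j) :=
  inferInstanceAs (Module k (LinearMap.ker (E.D j) ⧸ E.boundaries j))

/-- The map induced by `V` on cycles. -/
def cycleMap (i j : ℤ) : LinearMap.ker (E.D i) →ₗ[k] LinearMap.ker (E.D j) :=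
  (E.V i j).restrict fun x hx => by
    have h := LinearMap.congr_fun (E.V_comp_D i j) x
    simp only [LinearMap.comp_apply, LinearMap.mem_ker.1 hx, map_zero] at h
    exact h.symm

/-- The map induced by `V` on homology. -/
def homologyMap (i j : ℤ) : E.H i →ₗ[k] E.H j :=
  Submodule.mapQ _ _ (E.cycleMap i j) (by
    rintro ⟨x, hx⟩ ⟨y, hy⟩
    exact ⟨E.V i j y, by
      rw [← LinearMap.comp_apply, ← E.V_comp_D, LinearMap.comp_apply, hy]; rfl⟩)

/-- The complex of homology modules `H^t`: homology with respect to `D` in each term, with the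
differential induced by `V`. -/
def totalHomology : CochainComplex (ModuleCat.{u} k) ℤ where
  X j := ModuleCat.of k (E.H j)
  d i j := ModuleCat.ofHom (E.homologyMap i j)
  shape i j h := by
    have h0 : E.homologyMap i j = 0 := by
      refine Submodule.linearMap_qext _ (LinearMap.ext fun x => ?_)
      change Submodule.Quotient.mk (E.cycleMap i j x) = 0
      have : E.cycleMap i j x = 0 := Subtype.ext (by
        change E.V i j x = 0
        rw [E.V_shape i j h]; rfl)
      rw [this]; rfl
    rw [h0]; rfl
  d_comp_d' i j l _ _ := by
    have h0 : E.homologyMap j l ∘ₗ E.homologyMap i j = 0 := by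
      refine Submodule.linearMap_qext _ (LinearMap.ext fun x => ?_)
      change Submodule.Quotient.mk (E.cycleMap j l (E.cycleMap i j x)) = 0
      have : E.cycleMap j l (E.cycleMap i j x) = 0 := Subtype.ext
        (LinearMap.congr_fun (E.V_comp_V i j l) x)
      rw [this]; rfl
    rw [← ModuleCat.ofHom_comp, h0]; rfl

/-- The classes in `H^t` that have a representative in `P`. -/
def homologyPiece (j : ℤ) (P : Submodule k (E.M j)) :
    Submodule k (E.totalHomology.X j) :=
  Submodule.map (Submodule.mkQ (E.boundaries j)) (P.comap (LinearMap.ker (E.D j)).subtype)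

end DiffComplex

namespace MFComplex

section

variable {S : Type u} [CommRing S] (C : MFComplex S)

/-- The term of cohomological degree `j`. -/
abbrev Term (j : ℤ) : Type u := {b // C.coh b = j} → S

theorem dpm_coh (j : ℤ) (b a : C.B) (ha : C.coh a = j) (hb : C.coh b ≠ j) :
    (C.dp + C.dm) b a = 0 := by
  rw [Matrix.add_apply, C.dp_coh _ _ (by rw [ha]; exact hb), C.dm_coh _ _ (by rw [ha]; exact hb),
    add_zero]

/-- The differential `dp + dm` of the matrix factorization in cohomological degree `j`. -/
def D (j : ℤ) : C.Term j →ₗ[S] C.Term j :=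
  blockMap (C.dp + C.dm) (fun b => C.coh b = j) (fun b => C.coh b = j)

/-- The cohomological differential from degree `i` to degree `j` (zero unless `j = i + 1`). -/
def V (i j : ℤ) : C.Term i →ₗ[S] C.Term j :=
  blockMap C.dv (fun b => C.coh b = i) (fun b => C.coh b = j)

theorem V_shape (i j : ℤ) (h : i + 1 ≠ j) : C.V i j = 0 :=
  blockMap_eq_zero _ _ _ fun b a ha hb => C.dv_coh b a (by rw [ha, hb]; exact h.symm)

theorem V_comp_V (i j l : ℤ) : C.V j l ∘ₗ C.V i j = 0 := by
  by_cases h : i + 1 = j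
  · rw [V, V, blockMap_comp _ _ _ _ _ fun c a ha hc => C.dv_coh c a (by rw [ha, h]; exact hc),
      C.dv_sq, blockMap_eq_zero]
    intros; rfl
  · rw [C.V_shape i j h, LinearMap.comp_zero]

theorem V_comp_D (i j : ℤ) : C.V i j ∘ₗ C.D i = C.D j ∘ₗ C.V i j := by
  by_cases h : i + 1 = j
  · rw [V, D, D, blockMap_comp _ _ _ _ _ fun c a ha hc => C.dpm_coh i c a ha hc,
      blockMap_comp _ _ _ _ _ fun c a ha hc => C.dv_coh c a (by rw [ha, h]; exact hc),
      mul_add, add_mul, C.dv_dp, C.dv_dm]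
  · rw [C.V_shape i j h, LinearMap.comp_zero, LinearMap.zero_comp]

/-- The underlying complex of `k`-modules with the total matrix factorization differential. -/
def toDiffComplex (k : Type u) [CommRing k] [Algebra k S] : DiffComplex k where
  M j := C.Term j
  D j := (C.D j).restrictScalars k
  V i j := (C.V i j).restrictScalars k
  V_comp_D i j := LinearMap.ext fun x => LinearMap.congr_fun (C.V_comp_D i j) x
  V_shape i j h := LinearMap.ext fun x => LinearMap.congr_fun (C.V_shape i j h) x
  V_comp_V i j l := LinearMap.ext fun x => LinearMap.congr_fun (C.V_comp_V i j l) x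

/-! The functor `𝓗`: the zeroth cohomology of the positive complex, applied termwise. -/

/-- The part of cohomological degree `j` and matrix factorization degree `i`. -/
abbrev Piece (i j : ℤ) : Type u := {b // C.mf b = i ∧ C.coh b = j} → S

/-- The positive differential from matrix factorization degree `i` to degree `i'`. -/
def dpMap (i i' j : ℤ) : C.Piece i j →ₗ[S] C.Piece i' j :=
  blockMap C.dp (fun b => C.mf b = i ∧ C.coh b = j) (fun b => C.mf b = i' ∧ C.coh b = j)

/-- The cohomological differential in matrix factorization degree `i`. -/
def dvMap (i j j' : ℤ) : C.Piece i j →ₗ[S] C.Piece i j' :=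
  blockMap C.dv (fun b => C.mf b = i ∧ C.coh b = j) (fun b => C.mf b = i ∧ C.coh b = j')

theorem dvMap_shape (i j j' : ℤ) (h : j + 1 ≠ j') : C.dvMap i j j' = 0 :=
  blockMap_eq_zero _ _ _ fun b a ha hb => C.dv_coh b a (by rw [ha.2, hb.2]; exact h.symm)

theorem dvMap_comp_dvMap (i j j' l : ℤ) : C.dvMap i j' l ∘ₗ C.dvMap i j j' = 0 := by
  by_cases h : j + 1 = j'
  · rw [dvMap, dvMap, blockMap_comp, C.dv_sq, blockMap_eq_zero]
    · intros; rfl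
    · intro c a ha hc
      by_cases hm : C.mf c = C.mf a
      · exact C.dv_coh c a fun hcoh => hc ⟨hm.trans ha.1, by rw [hcoh, ha.2, h]⟩
      · exact C.dv_mf c a hm
  · rw [C.dvMap_shape i j j' h, LinearMap.comp_zero]

theorem dvMap_comp_dpMap (i i' j j' : ℤ) (hi : i + 1 = i') :
    C.dvMap i' j j' ∘ₗ C.dpMap i i' j = C.dpMap i i' j' ∘ₗ C.dvMap i j j' := by
  by_cases h : j + 1 = j'
  · rw [dvMap, dpMap, dvMap, dpMap, blockMap_comp, blockMap_comp, C.dv_dp]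
    · intro c a ha hc
      by_cases hm : C.mf c = C.mf a
      · exact C.dv_coh c a fun hcoh => hc ⟨hm.trans ha.1, by rw [hcoh, ha.2, h]⟩
      · exact C.dv_mf c a hm
    · intro c a ha hc
      by_cases hm : C.coh c = C.coh a
      · exact C.dp_deg c a fun hmf => hc ⟨by rw [hmf, ha.1, hi], hm.trans ha.2⟩
      · exact C.dp_coh c a hm
  · rw [C.dvMap_shape i' j j' h, C.dvMap_shape i j j' h, LinearMap.comp_zero,
      LinearMap.zero_comp]

/-- The cycles of degree zero of the positive complex in cohomological degree `j`. -/
abbrev posCycles (j : ℤ) : Submodule S (C.Piece 0 j) := LinearMap.ker (C.dpMap 0 1 j)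

/-- The boundaries of degree zero of the positive complex, inside the cycles. -/
def posBoundaries (j : ℤ) : Submodule S (C.posCycles j) :=
  (LinearMap.range (C.dpMap (-1) 0 j)).comap (C.posCycles j).subtype

/-- The module `𝓗` of the `j`-th term: the zeroth cohomology of its positive complex. -/
abbrev Naive (j : ℤ) : Type u := C.posCycles j ⧸ C.posBoundaries j

/-- The differential of the complex of modules `𝓗(C)`. -/
def naiveMap (i j : ℤ) : C.Naive i →ₗ[S] C.Naive j :=
  Submodule.mapQ _ _ ((C.dvMap 0 i j).restrict (p := C.posCycles i) (q := C.posCycles j)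
    fun x hx => by
      have h := LinearMap.congr_fun (C.dvMap_comp_dpMap 0 1 i j rfl) x
      simp only [LinearMap.comp_apply, LinearMap.mem_ker.1 hx, map_zero] at h
      exact h.symm) (by
    rintro ⟨x, hx⟩ ⟨y, hy⟩
    refine ⟨C.dvMap (-1) i j y, ?_⟩
    rw [← LinearMap.comp_apply, ← C.dvMap_comp_dpMap (-1) 0 i j rfl, LinearMap.comp_apply, hy]
    rfl)

theorem naiveMap_shape (i j : ℤ) (h : i + 1 ≠ j) : C.naiveMap i j = 0 := by
  refine Submodule.linearMap_qext _ (LinearMap.ext fun x => ?_)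
  refine (Submodule.Quotient.mk_eq_zero _).2 ?_
  convert Submodule.zero_mem _
  refine Subtype.ext ?_
  change C.dvMap 0 i j x = 0
  rw [C.dvMap_shape 0 i j h]; rfl

theorem naiveMap_comp (i j l : ℤ) : C.naiveMap j l ∘ₗ C.naiveMap i j = 0 := by
  refine Submodule.linearMap_qext _ (LinearMap.ext fun x => ?_)
  refine (Submodule.Quotient.mk_eq_zero _).2 ?_
  convert Submodule.zero_mem _
  exact Subtype.ext (LinearMap.congr_fun (C.dvMap_comp_dvMap 0 i j l) x)

/-- The complex `𝓗(C) ⊗ Z` of (trivial) matrix factorizations, where `𝓗(C)` is considered as a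
complex of modules over `A` and `Z` is a matrix factorization over `A`. Since the modules `𝓗(C)`
carry the zero matrix factorization differential, the differential of the tensor product is
induced by that of `Z`. -/
def naiveTensor (k A : Type u) [CommRing k] [CommRing A] [Algebra k A] [Algebra k S] [Algebra A S]
    [IsScalarTower k A S] (Z : MatFac A) : DiffComplex k where
  M j := C.Naive j ⊗[A] (Z.B → A)
  grp _ := TensorProduct.addCommGroup
  mod _ := TensorProduct.leftModule
  D j := ((Z.dp + Z.dm).mulVecLin.lTensor (C.Naive j)).restrictScalars k
  V i j := (((C.naiveMap i j).restrictScalars A).rTensor (Z.B → A)).restrictScalars k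
  V_comp_D i j := LinearMap.ext fun x => by
    change (((C.naiveMap i j).restrictScalars A).rTensor (Z.B → A) ∘ₗ
      (Z.dp + Z.dm).mulVecLin.lTensor (C.Naive i)) x =
      ((Z.dp + Z.dm).mulVecLin.lTensor (C.Naive j) ∘ₗ
        ((C.naiveMap i j).restrictScalars A).rTensor (Z.B → A)) x
    rw [LinearMap.rTensor_comp_lTensor, LinearMap.lTensor_comp_rTensor]
  V_shape i j h := LinearMap.ext fun x => by
    change ((C.naiveMap i j).restrictScalars A).rTensor (Z.B → A) x = 0
    rw [C.naiveMap_shape i j h, LinearMap.restrictScalars_zero, LinearMap.rTensor_zero]; rfl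
  V_comp_V i j l := LinearMap.ext fun x => by
    change (((C.naiveMap j l).restrictScalars A).rTensor (Z.B → A) ∘ₗ
      ((C.naiveMap i j).restrictScalars A).rTensor (Z.B → A)) x = 0
    rw [← LinearMap.rTensor_comp, ← LinearMap.restrictScalars_comp, C.naiveMap_comp,
      LinearMap.restrictScalars_zero, LinearMap.rTensor_zero]; rfl

/-! Homogeneous elements. Let `gr` be a grading of the ground ring by a group `G`. The basis vector
`b` is given the degree `q b • α + mf b • β`. -/

/-- The elements of degree `g` in a free module with basis `ι`, where `b` has degree `deg b`. -/
def freePiece (k : Type u) [CommRing k] [Algebra k S] {G : Type} [AddCommGroup G]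
    (gr : G → Submodule k S) {ι : Type} (deg : ι → G) (g : G) : Submodule k (ι → S) :=
  Submodule.pi Set.univ fun b => gr (g - deg b)

/-- The part of degree `g` of the term of cohomological degree `j`. -/
def termPiece (k : Type u) [CommRing k] [Algebra k S] {G : Type} [AddCommGroup G]
    (gr : G → Submodule k S) (α β : G) (j : ℤ) (g : G) : Submodule k (C.Term j) :=
  freePiece k gr (fun b => C.q b.1 • α + C.mf b.1 • β) g

/-- The part of degree `g` of the module `𝓗` of the term of cohomological degree `j`. -/
def naivePiece (k : Type u) [CommRing k] [Algebra k S] {G : Type} [AddCommGroup G]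
    (gr : G → Submodule k S) (α β : G) (j : ℤ) (g : G) : Submodule k (C.Naive j) :=
  ((freePiece k gr (fun b : {b // C.mf b = 0 ∧ C.coh b = j} => C.q b.1 • α + C.mf b.1 • β) g).comap
    ((C.posCycles j).subtype.restrictScalars k)).map
      ((Submodule.mkQ (C.posBoundaries j)).restrictScalars k)

/-- The part of degree `g` of the term of cohomological degree `j` of `𝓗(C) ⊗ Z`. -/
def naiveTensorPiece (k A : Type u) [CommRing k] [CommRing A] [Algebra k A] [Algebra k S]
    [Algebra A S] [IsScalarTower k A S] (Z : MatFac A) {G : Type} [AddCommGroup G]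
    (gr : G → Submodule k S) (grA : G → Submodule k A) (α β : G) (j : ℤ) (g : G) :
    Submodule k ((C.naiveTensor k A Z).M j) :=
  Submodule.span k {x : C.Naive j ⊗[A] (Z.B → A) | ∃ h : G, ∃ m ∈ C.naivePiece k gr α β j h,
    ∃ z ∈ freePiece k grA (fun b => Z.q b • α + Z.mf b • β) (g - h), m ⊗ₜ[A] z = x}

end

end MFComplex

/-! ### Oriented tangle diagrams and their complexes -/

/-- A crossing, given by its sign and its four flags: both strands point upwards, and `i`, `j`, `k`,
`l` are the flags at the upper left (outgoing), upper right (outgoing), lower right (incoming) and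
lower left (incoming). -/
structure Crossing (F : Type) where
  positive : Bool
  i : F
  j : F
  k : F
  l : F

/-- The data of the oriented graph of a tangle diagram: the set of flags, the flags at the vertices
of degree one (the end points), the list of edges, each recorded by its flag at the tail and its
flag at the head, and the list of crossings. A closed component without crossings is recorded by a
marked point on it, that is by one flag together with a loop edge from this flag to itself. -/
structure Diagram where
  Flag : Type
  End : Type
  endFlag : End → Flag
  edges : List (Flag × Flag)
  crossings : List (Crossing Flag)

namespace Diagram

variable (k : Type u) [CommRing k] (T : Diagram)

/-- The polynomial ring with one variable for each flag. -/
def FlagRing : Type u := MvPolynomial T.Flag k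

instance : CommRing (T.FlagRing k) := inferInstanceAs (CommRing (MvPolynomial T.Flag k))

instance : Algebra k (T.FlagRing k) := inferInstanceAs (Algebra k (MvPolynomial T.Flag k))

/-- The polynomial ring with one variable for each end point. -/
def EndRing : Type u := MvPolynomial T.End k

instance : CommRing (T.EndRing k) := inferInstanceAs (CommRing (MvPolynomial T.End k))

instance : Algebra k (T.EndRing k) := inferInstanceAs (Algebra k (MvPolynomial T.End k))

instance : Algebra (T.EndRing k) (T.FlagRing k) :=
  (MvPolynomial.rename (R := k) T.endFlag).toRingHom.toAlgebra

instance : IsScalarTower k (T.EndRing k) (T.FlagRing k) :=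
  IsScalarTower.of_algebraMap_eq' (MvPolynomial.rename (R := k) T.endFlag).comp_algebraMap.symm

/-- The variable of a flag. -/
def flagVar (f : T.Flag) : T.FlagRing k := MvPolynomial.X (R := k) f

/-- The variable of an end point. -/
def endVar (x : T.End) : T.EndRing k := MvPolynomial.X (R := k) x

/-- The grading of the ring of flags in which all variables have degree `v`. -/
def flagGrading {G : Type} [AddCommGroup G] (v g : G) : Submodule k (T.FlagRing k) :=
  MvPolynomial.weightedHomogeneousSubmodule k (fun _ : T.Flag => v) g

/-- The grading of the ring of end points in which all variables have degree `v`. -/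
def endGrading {G : Type} [AddCommGroup G] (v g : G) : Submodule k (T.EndRing k) :=
  MvPolynomial.weightedHomogeneousSubmodule k (fun _ : T.End => v) g

variable {k}

/-- The complex of matrix factorizations of a crossing. -/
def crossingComplex (p : Polynomial k) (x : Crossing T.Flag) : MFComplex (T.FlagRing k) :=
  if x.positive then
    positiveCrossing p (T.flagVar k x.i) (T.flagVar k x.j) (T.flagVar k x.k) (T.flagVar k x.l)
  else
    negativeCrossing p (T.flagVar k x.i) (T.flagVar k x.j) (T.flagVar k x.k) (T.flagVar k x.l)

/-- The matrix factorization of an edge, as a complex. -/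
def edgeComplex (p : Polynomial k) (e : T.Flag × T.Flag) : MFComplex (T.FlagRing k) :=
  MFComplex.single (arcFactor p (T.flagVar k e.2) (T.flagVar k e.1))

/-- The Khovanov–Rozansky complex of matrix factorizations of a diagram: the tensor product of the
complexes of all edges and of all crossings. -/
def KR (p : Polynomial k) : MFComplex (T.FlagRing k) :=
  (T.edges.map (T.edgeComplex p) ++ T.crossings.map (T.crossingComplex p)).foldr
    MFComplex.tensor MFComplex.unit

/-- The Khovanov–Rozansky complex `𝓚_p(T)` of `k`-vector spaces of a closed diagram: the total
homology of each of the matrix factorizations, with the induced differential. -/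
def KRHomology (p : Polynomial k) : CochainComplex (ModuleCat.{u} k) ℤ :=
  ((T.KR p).toDiffComplex k).totalHomology

/-- The part of degree `g` of `𝓚_p(T)`, where variables have degree `2 • α`. -/
def KRHomologyPiece (p : Polynomial k) {G : Type} [AddCommGroup G] (α β : G) (j : ℤ) (g : G) :
    Submodule k ((T.KRHomology p).X j) :=
  ((T.KR p).toDiffComplex k).homologyPiece j
    ((T.KR p).termPiece k (T.flagGrading k (2 • α)) α β j g)

/-- The Koszul matrix factorization of a system of arcs joining end points of `T`; each arc is
given by its tail and its head. -/
def arcFactorization (p : Polynomial k) (arcs : List (T.End × T.End)) : MatFac (T.EndRing k) :=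
  (arcs.map fun a => arcFactor p (T.endVar k a.2) (T.endVar k a.1)).foldr
    MatFac.tensor MatFac.unit

/-- The complex of (trivial) matrix factorizations `𝓝(T) ⊗ Z`, where `𝓝(T) = 𝓗(KR_p(T))` is the
naive complex of `T`, considered as a complex of modules over the ring of end points, and `Z` is
the factorization of a system of arcs. -/
def naiveArcs (p : Polynomial k) (arcs : List (T.End × T.End)) : DiffComplex k :=
  (T.KR p).naiveTensor k (T.EndRing k) (T.arcFactorization p arcs)

/-- The complex `H^t(𝓝(T) ⊗ Z)`. -/
def naiveArcsHomology (p : Polynomial k) (arcs : List (T.End × T.End)) :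
    CochainComplex (ModuleCat.{u} k) ℤ :=
  (T.naiveArcs p arcs).totalHomology

/-- The part of degree `g` of `H^t(𝓝(T) ⊗ Z)`, where variables have degree `2 • α`. -/
def naiveArcsHomologyPiece (p : Polynomial k) (arcs : List (T.End × T.End)) {G : Type}
    [AddCommGroup G] (α β : G) (j : ℤ) (g : G) :
    Submodule k ((T.naiveArcsHomology p arcs).X j) :=
  (T.naiveArcs p arcs).homologyPiece j
    ((T.KR p).naiveTensorPiece k (T.EndRing k) (T.arcFactorization p arcs)
      (T.flagGrading k (2 • α)) (T.endGrading k (2 • α)) α β j g)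

end Diagram

/-! ### Braids and their closures -/

/-- A letter `σ_i` or `σ_i⁻¹` of a braid word on `d` strands: a crossing between the strands in the
positions `i` and `i + 1` (counted from `0`), with its sign. -/
structure BraidLetter (d : ℕ) where
  idx : ℕ
  lt : idx + 1 < d
  positive : Bool

namespace BraidLetter

variable {d : ℕ} (a : BraidLetter d)

/-- The left position. -/
def left : Fin d := ⟨a.idx, Nat.lt_of_succ_lt a.lt⟩

/-- The right position. -/
def right : Fin d := ⟨a.idx + 1, a.lt⟩

/-- The crossing involves the strand in position `c`. -/
def touches (c : Fin d) : Bool := decide (a.left = c ∨ a.right = c)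

end BraidLetter

/-- The four corners of a crossing. -/
inductive Corner
  | upperLeft
  | upperRight
  | lowerRight
  | lowerLeft

namespace Braid

variable {d : ℕ} (w : List (BraidLetter d))

/-- The flags at the crossings of a braid word. -/
abbrev CrossingFlag : Type := Fin w.length × Corner

/-- The outgoing flag in position `c` of the crossing number `y`. -/
def outFlag (y : Fin w.length) (c : Fin d) : CrossingFlag w :=
  (y, if (w.get y).left = c then Corner.upperLeft else Corner.upperRight)

/-- The crossings in position `c`, from bottom to top. -/
def crossingsAt (c : Fin d) : List (Fin w.length) :=
  (List.finRange w.length).filter fun y => (w.get y).touches c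

/-- The crossings in position `c` below the crossing number `x`. -/
def crossingsBelow (x : Fin w.length) (c : Fin d) : List (Fin w.length) :=
  (crossingsAt w c).filter fun y => decide (y < x)

/-- The crossings in position `c` above the crossing number `x`. -/
def crossingsAbove (x : Fin w.length) (c : Fin d) : List (Fin w.length) :=
  (crossingsAt w c).filter fun y => decide (x < y)

/-- The flags of the braid diagram: those at the crossings, at the bottom end points and at the top
end points. -/
abbrev BraidFlag : Type := CrossingFlag w ⊕ (Fin d ⊕ Fin d)

/-- The flag from which a strand in position `c` emerges after passing through the crossings in the
list `L`: the outgoing flag of the last of them, or the bottom end point if there are none. -/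
def strandTail (L : List (Fin w.length)) (c : Fin d) : BraidFlag w :=
  match L.getLast? with
  | some y => Sum.inl (outFlag w y c)
  | none => Sum.inr (Sum.inl c)

/-- The diagram of a braid word, drawn upwards: the letters are read from bottom to top, and all
strands are oriented upwards. The end points are the `d` bottom points `Sum.inl c` and the `d` top
points `Sum.inr c`. -/
def diagram : Diagram where
  Flag := BraidFlag w
  End := Fin d ⊕ Fin d
  endFlag := Sum.inr
  edges :=
    (List.finRange w.length).flatMap (fun x =>
      [(strandTail w (crossingsBelow w x (w.get x).left) (w.get x).left,
          Sum.inl (x, Corner.lowerLeft)),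
        (strandTail w (crossingsBelow w x (w.get x).right) (w.get x).right,
          Sum.inl (x, Corner.lowerRight))]) ++
    (List.finRange d).map fun c => (strandTail w (crossingsAt w c) c, Sum.inr (Sum.inr c))
  crossings := (List.finRange w.length).map fun x =>
    { positive := (w.get x).positive
      i := Sum.inl (x, Corner.upperLeft)
      j := Sum.inl (x, Corner.upperRight)
      k := Sum.inl (x, Corner.lowerRight)
      l := Sum.inl (x, Corner.lowerLeft) }

/-- The flags of the closed braid diagram: those at the crossings, and a marked point on each strand
without crossings (which closes up to a circle). -/
abbrev ClosureFlag : Type := CrossingFlag w ⊕ {c : Fin d // crossingsAt w c = []}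

/-- In the closed diagram, the crossing from which the strand entering the crossing `x` in position
`c` comes: the preceding crossing in position `c`, in the cyclic order of the crossings (this is `x`
itself if it is the only one). -/
def cyclicPrevious (x : Fin w.length) (c : Fin d) : Fin w.length :=
  (crossingsAbove w x c ++ crossingsBelow w x c).getLastD x

/-- The diagram of the closure of a braid word: for each position, the top end point is joined to
the bottom end point. -/
def closure : Diagram where
  Flag := ClosureFlag w
  End := Empty
  endFlag := Empty.elim
  edges :=
    (List.finRange w.length).flatMap (fun x =>
      [(Sum.inl (outFlag w (cyclicPrevious w x (w.get x).left) (w.get x).left),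
          Sum.inl (x, Corner.lowerLeft)),
        (Sum.inl (outFlag w (cyclicPrevious w x (w.get x).right) (w.get x).right),
          Sum.inl (x, Corner.lowerRight))]) ++
    (List.finRange d).filterMap fun c =>
      if h : crossingsAt w c = [] then some (Sum.inr ⟨c, h⟩, Sum.inr ⟨c, h⟩) else none
  crossings := (List.finRange w.length).map fun x =>
    { positive := (w.get x).positive
      i := Sum.inl (x, Corner.upperLeft)
      j := Sum.inl (x, Corner.upperRight)
      k := Sum.inl (x, Corner.lowerRight)
      l := Sum.inl (x, Corner.lowerLeft) }

/-- The arcs of the braid closure diagram: from the top point to the bottom point in each position.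
The corresponding Koszul matrix factorization is that of the sequences `x_c ⊗ 1 - 1 ⊗ x_c` and
`(p (x_c ⊗ 1) - p (1 ⊗ x_c)) / (x_c ⊗ 1 - 1 ⊗ x_c)`, where `x_c ⊗ 1` and `1 ⊗ x_c` are the variables
of the bottom and of the top point in position `c`. -/
def closureArcs : List ((diagram w).End × (diagram w).End) :=
  (List.finRange d).map fun c => (Sum.inr c, Sum.inl c)

end Braid

end KhovanovRozansky

end

/-! Both complexes are total homologies of quotients of one complex of matrix factorizations: the
tensor product of `KR` of the open braid with the arc factorization, extended to the ring of flags.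
Its potential is zero, because the terms `p (head) - p (tail)` telescope along the strands and the
arcs close them up (`potential_eq_zero`).

The quotients come from a single principle. Let `X` be a complex of matrix factorizations in degrees
`≤ 0` whose positive complex is exact except in degree `0`, and let `Y` be such that `X ⊗ Y` has
potential zero. The elements of `X ⊗ Y` whose `X`-degree-`0` part is a `d_+`-boundary form a
subcomplex that is acyclic for the total differential. Indeed, apart from `d_+` of `X` no part of
the differential raises the `X`-degree, so a contracting homotopy for `d_+` replaces a cycle by a
homologous one of smaller top `X`-degree, and only finitely many degrees occur (`tensor_acyclic`).
Passing to the quotient therefore preserves total homology (`homologyEquiv_of_contraction`).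

With `X = KR (σ)` and `Y` the arcs, the quotient is `N(σ) ⊗ Z` (`naiveTensor_homologyEquiv`). With
`X` the Koszul factorization of the arcs and of the final edges of the strands that meet a crossing,
the quotient identifies the variables joined in the closure (`quotient_homologyEquiv`), and the
remaining factors become `KR` of the closed diagram (`closure_equiv`). The two ways of writing the
tensor product differ by a reordering of factors, that is, by a signed permutation of basis vectors
(`elimination_equiv`).

The exactness for `KR (σ)` is the geometric input (`KR_contraction`). An edge imposes an equation
linear in the variable at its head. A crossing imposes an equation linear in one outgoing variable
and, after a change of basis or directly, a linear equation or a product of two linear ones in the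
other. Division by such a polynomial in `v` gives a homotopy that is linear over the polynomials not
involving `v`. Ordered from the top of the braid to the bottom, each factor eliminates variables
absent from all later ones, which is what is needed to combine the homotopies. They are not linear
over the full ring, so a contraction consists of additive maps and records a set of scalars with
which it commutes.

For the gradings, one map is compared with the homogeneous pieces of all admissible gradings at
once. A homogeneous cycle of the quotient lifts to a homogeneous cycle because the correction term
can be projected to the required degree. -/

noncomputable section

namespace KhovanovRozansky

open Matrix

/-! ### Comparison of total homologies together with their homogeneous pieces -/

namespace DiffComplex

variable {k : Type u} [CommRing k]

/-- The complexes of total homology of `E` and `E'` are isomorphic, by an isomorphism that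
identifies the pieces of the homology coming from the families `P` and `P'` of submodules. -/
def HomologyEquiv {I : Type*} (E E' : DiffComplex k) (P : I → ∀ j, Submodule k (E.M j))
    (P' : I → ∀ j, Submodule k (E'.M j)) : Prop :=
  ∃ e : E.totalHomology ≅ E'.totalHomology, ∀ i j,
    (E.homologyPiece j (P i j)).map (e.hom.f j).hom = E'.homologyPiece j (P' i j)

theorem HomologyEquiv.symm {I : Type*} {E E' : DiffComplex k} {P : I → ∀ j, Submodule k (E.M j)}
    {P' : I → ∀ j, Submodule k (E'.M j)} (h : HomologyEquiv E E' P P') :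
    HomologyEquiv E' E P' P := by
  obtain ⟨e, he⟩ := h
  refine ⟨e.symm, fun i j => ?_⟩
  rw [← he i j, ← Submodule.map_comp, ← ModuleCat.hom_comp, ← HomologicalComplex.comp_f]
  simp

theorem HomologyEquiv.trans {I : Type*} {E E' E'' : DiffComplex k}
    {P : I → ∀ j, Submodule k (E.M j)} {P' : I → ∀ j, Submodule k (E'.M j)}
    {P'' : I → ∀ j, Submodule k (E''.M j)} (h : HomologyEquiv E E' P P')
    (h' : HomologyEquiv E' E'' P' P'') : HomologyEquiv E E'' P P'' := by
  obtain ⟨e, he⟩ := h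
  obtain ⟨e', he'⟩ := h'
  refine ⟨e ≪≫ e', fun i j => ?_⟩
  rw [← he' i j, ← he i j, ← Submodule.map_comp, ← ModuleCat.hom_comp, ← HomologicalComplex.comp_f]
  rfl

section OfMap

variable {E E' : DiffComplex k} (f : ∀ j, E.M j →ₗ[k] E'.M j)
  (hD : ∀ j x, f j (E.D j x) = E'.D j (f j x))

/-- The map on cycles of a map commuting with the total differential. -/
def mapCycles (j : ℤ) : LinearMap.ker (E.D j) →ₗ[k] LinearMap.ker (E'.D j) :=
  (f j).restrict fun x hx => by
    rw [LinearMap.mem_ker] at hx ⊢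
    rw [← hD, hx, map_zero]

/-- The map on homology of a map commuting with the total differential. -/
def mapH (j : ℤ) : E.H j →ₗ[k] E'.H j :=
  Submodule.mapQ _ _ (mapCycles f hD j) (by
    rintro ⟨x, hx⟩ ⟨y, hy⟩
    exact ⟨f j y, by rw [← hD, hy]; rfl⟩)

/-- A map of complexes with differential that is bijective on homology and matches the given
pieces induces an equivalence on homology. -/
theorem HomologyEquiv.of_map {I : Type*} {P : I → ∀ j, Submodule k (E.M j)}
    {P' : I → ∀ j, Submodule k (E'.M j)} (hD : ∀ j x, f j (E.D j x) = E'.D j (f j x))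
    (hV : ∀ i j x, f j (E.V i j x) = E'.V i j (f i x))
    (surj : ∀ j y, E'.D j y = 0 → ∃ x, E.D j x = 0 ∧ f j x = y)
    (inj : ∀ j x y, E.D j x = 0 → f j x = E'.D j y → ∃ z, E.D j z = x)
    (hP : ∀ i j x, x ∈ P i j → f j x ∈ P' i j)
    (surjP : ∀ i j y, y ∈ P' i j → E'.D j y = 0 → ∃ x ∈ P i j, E.D j x = 0 ∧ f j x = y) :
    HomologyEquiv E E' P P' := by
  have bij : ∀ j, Function.Bijective (mapH f hD j) := by
    intro j
    constructor
    · rw [injective_iff_map_eq_zero]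
      intro x hx
      induction x using Submodule.Quotient.induction_on with
      | _ x =>
      change Submodule.Quotient.mk (mapCycles f hD j x) = 0 at hx
      obtain ⟨y, hy⟩ := (Submodule.Quotient.mk_eq_zero _).1 hx
      exact (Submodule.Quotient.mk_eq_zero _).2 (inj j x.1 y x.2 hy.symm)
    · intro y
      induction y using Submodule.Quotient.induction_on with
      | _ y =>
      obtain ⟨x, hx, hxy⟩ := surj j y.1 y.2
      exact ⟨Submodule.Quotient.mk ⟨x, hx⟩, congrArg Submodule.Quotient.mk (Subtype.ext hxy)⟩
  let e : ∀ j, E.totalHomology.X j ≅ E'.totalHomology.X j := fun j =>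
    (LinearEquiv.ofBijective (mapH f hD j) (bij j)).toModuleIso
  refine ⟨HomologicalComplex.Hom.isoOfComponents e fun i j _ => ?_, fun i j => ?_⟩
  · apply ModuleCat.hom_ext
    refine Submodule.linearMap_qext _ (LinearMap.ext fun x => ?_)
    change Submodule.Quotient.mk (E'.cycleMap i j (mapCycles f hD i x)) =
      (Submodule.Quotient.mk (mapCycles f hD j (E.cycleMap i j x)) : E'.H j)
    congr 1
    exact Subtype.ext (hV i j x.1).symm
  · change (Submodule.map (Submodule.mkQ (E.boundaries j))
      ((P i j).comap (LinearMap.ker (E.D j)).subtype)).map (mapH f hD j) =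
      Submodule.map (Submodule.mkQ (E'.boundaries j))
        ((P' i j).comap (LinearMap.ker (E'.D j)).subtype)
    apply le_antisymm
    · rintro _ ⟨_, ⟨x, hx, rfl⟩, rfl⟩
      exact ⟨mapCycles f hD j x, hP i j _ hx, rfl⟩
    · rintro _ ⟨y, hy, rfl⟩
      obtain ⟨x, hxP, hx, hxy⟩ := surjP i j y.1 hy y.2
      exact ⟨_, ⟨⟨x, hx⟩, hxP, rfl⟩, congrArg Submodule.Quotient.mk (Subtype.ext hxy)⟩

end OfMap

end DiffComplex

/-! ### Contractions of positive complexes -/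

namespace MatFac

variable {S : Type u} [CommRing S]

open Matrix

/-- The component of matrix factorization degree `n` of a vector. -/
def comp (M : MatFac S) (n : ℤ) (v : M.B → S) : M.B → S := fun b => if M.mf b = n then v b else 0

/-- The component of degree `2` of `d ^ 2` is `dp * dp`, while the potential acts in degree `0`. -/
theorem dp_mul_dp (M : MatFac S) : M.dp * M.dp = 0 := by
  ext b a
  by_cases h : M.mf b = M.mf a + 2
  · have h0 := congrFun (congrFun M.sq b) a
    have hba : b ≠ a := by rintro rfl; omega
    rw [Matrix.smul_apply, Matrix.one_apply_ne hba, smul_zero] at h0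
    rw [Matrix.zero_apply, ← h0, Matrix.mul_apply, Matrix.mul_apply]
    refine Finset.sum_congr rfl fun c _ => ?_
    simp only [Matrix.add_apply]
    by_cases h1 : M.mf c = M.mf a + 1
    · rw [M.dm_deg c a (by omega), M.dm_deg b c (by omega)]; ring
    · rw [M.dp_deg c a h1]
      by_cases h2 : M.mf c = M.mf a - 1
      · rw [M.dp_deg b c (by omega), M.dm_deg b c (by omega)]; ring
      · rw [M.dm_deg c a h2]; ring
  · rw [Matrix.mul_apply, Matrix.zero_apply]
    refine Finset.sum_eq_zero fun c _ => ?_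
    by_cases h1 : M.mf c = M.mf a + 1
    · rw [M.dp_deg b c (by omega), zero_mul]
    · rw [M.dp_deg c a h1, mul_zero]

/-- A contraction of the positive complex of a matrix factorization in nonpositive degrees onto its
part of degree `0`; the homotopy commutes with multiplication by the elements of `A`. -/
structure Contraction (M : MatFac S) (A : Set S) where
  h : AddMonoid.End (M.B → S)
  ε : AddMonoid.End (M.B → S)
  nonpos : ∀ b, M.mf b ≤ 0
  h_deg : ∀ v b, h v b = h (M.comp (M.mf b + 1) v) b
  homotopy : ∀ v, M.dp *ᵥ h v + h (M.dp *ᵥ v) + ε v = v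
  ε_apply : ∀ v b, M.mf b ≠ 0 → ε v b = 0
  ε_eq_zero : ∀ v, (∀ b, M.mf b = 0 → v b = 0) → ε v = 0
  h_smul : ∀ a ∈ A, ∀ v, h (a • v) = a • h v

namespace Contraction

variable {M : MatFac S} {A : Set S} (c : M.Contraction A)

theorem ε_congr {v w : M.B → S} (h : ∀ b, M.mf b = 0 → v b = w b) : c.ε v = c.ε w := by
  rw [← sub_eq_zero, ← map_sub]
  exact c.ε_eq_zero _ fun b hb => by rw [Pi.sub_apply, h b hb, sub_self]

theorem dp_apply_eq_zero (c : M.Contraction A) (b a : M.B) (ha : M.mf a = 0) : M.dp b a = 0 :=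
  M.dp_deg b a (by have := c.nonpos b; omega)

theorem dp_ε (v : M.B → S) : M.dp *ᵥ c.ε v = 0 := by
  ext b
  refine Finset.sum_eq_zero fun a _ => ?_
  change M.dp b a * _ = 0
  by_cases ha : M.mf a = 0
  · rw [c.dp_apply_eq_zero b a ha, zero_mul]
  · rw [c.ε_apply v a ha, mul_zero]

/-- Applying `dp` to the homotopy identity gives `dp h dp = dp`; the same identity at `dp v` then
leaves nothing for `ε`. -/
theorem ε_dp (v : M.B → S) : c.ε (M.dp *ᵥ v) = 0 := by
  have h1 := c.homotopy (M.dp *ᵥ v)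
  have h2 := congrArg (M.dp *ᵥ ·) (c.homotopy v)
  simp only [mulVec_add, mulVec_mulVec, M.dp_mul_dp, zero_mulVec, map_zero, add_zero, zero_add,
    c.dp_ε] at h1 h2
  rw [h2] at h1
  exact add_eq_left.1 h1

/-- Linearity of `ε` need not be assumed: `ε = 1 - dp h - h dp`, and `dp` is linear over the whole
ring. -/
theorem ε_smul (a : S) (ha : a ∈ A) (v : M.B → S) : c.ε (a • v) = a • c.ε v := by
  have h1 := c.homotopy (a • v)
  have h2 := congrArg (a • ·) (c.homotopy v)
  simp only [mulVec_smul, c.h_smul a ha, smul_add] at h1 h2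
  exact add_left_cancel (h1.trans h2.symm)

/-- The elements annihilated by `ε` are those whose component of degree `0` is a boundary. -/
theorem ε_eq_zero_iff (v : M.B → S) :
    c.ε v = 0 ↔ ∃ u, ∀ b, M.mf b = 0 → v b = (M.dp *ᵥ u) b := by
  constructor
  · intro h
    refine ⟨c.h (M.comp 0 v), fun b hb => ?_⟩
    have h1 := congrFun (c.homotopy (M.comp 0 v)) b
    have h2 : M.dp *ᵥ M.comp 0 v = 0 := by
      ext b
      refine Finset.sum_eq_zero fun a _ => ?_
      change M.dp b a * _ = 0
      by_cases ha : M.mf a = 0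
      · rw [c.dp_apply_eq_zero b a ha, zero_mul]
      · rw [comp, if_neg ha, mul_zero]
    have h3 : c.ε (M.comp 0 v) = c.ε v := c.ε_congr fun b hb => if_pos hb
    rw [h2, map_zero, add_zero, h3, h, add_zero, comp, if_pos hb] at h1
    exact h1.symm
  · rintro ⟨u, hu⟩
    rw [c.ε_congr hu, c.ε_dp]

/-- Restriction of scalars for a contraction. -/
def mono {A' : Set S} (h : A' ⊆ A) : M.Contraction A' :=
  { c with h_smul := fun a ha => c.h_smul a (h ha) }

/-- The homotopy has odd degree `-1`, so it anticommutes with the parity sign. -/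
theorem h_sign (v : M.B → S) (b : M.B) :
    c.h (fun b => (((M.mf b).negOnePow : ℤ) : S) * v b) b =
      -((((M.mf b).negOnePow : ℤ) : S) * c.h v b) := by
  rw [c.h_deg, c.h_deg v]
  have : M.comp (M.mf b + 1) (fun b => (((M.mf b).negOnePow : ℤ) : S) * v b) =
      ((M.mf b + 1).negOnePow : ℤ) • M.comp (M.mf b + 1) v := by
    ext a
    simp only [comp, Pi.smul_apply]
    split_ifs with ha
    · rw [ha, zsmul_eq_mul]
    · simp
  rw [this, map_zsmul, Int.negOnePow_succ, Pi.smul_apply, zsmul_eq_mul]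
  push_cast
  ring

end Contraction

section Tensor

variable {M N : MatFac S}

/-- The operator on the tensor product given by an operator on the first factor. -/
def onLeft (N : MatFac S) (f : AddMonoid.End (M.B → S)) : AddMonoid.End (M.B × N.B → S) where
  toFun v := fun b => f (fun a => v (a, b.2)) b.1
  map_zero' := by ext b; exact congrFun (map_zero f) b.1
  map_add' v w := by ext b; exact congrFun (map_add f _ _) b.1

/-- The operator on the tensor product given by an operator on the second factor. -/
def onRight (M : MatFac S) (f : AddMonoid.End (N.B → S)) : AddMonoid.End (M.B × N.B → S) where
  toFun v := fun b => f (fun a => v (b.1, a)) b.2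
  map_zero' := by ext b; exact congrFun (map_zero f) b.2
  map_add' v w := by ext b; exact congrFun (map_add f _ _) b.2

/-- The operator given by a matrix. -/
def op {B : Type} [Fintype B] (A : Matrix B B S) : AddMonoid.End (B → S) :=
  A.mulVecLin.toAddMonoidHom

/-- The operator of the sign of the first factor. -/
def signLeft (M N : MatFac S) : AddMonoid.End (M.B × N.B → S) where
  toFun v := fun b => (((M.mf b.1).negOnePow : ℤ) : S) * v b
  map_zero' := by ext b; simp
  map_add' v w := by ext b; simp [mul_add]

theorem kronecker_one_mulVec (A : Matrix M.B M.B S) (v : M.B × N.B → S) :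
    (A ⊗ₖ (1 : Matrix N.B N.B S)) *ᵥ v = onLeft N (op A) v := by
  ext ⟨b, b'⟩
  change _ = ∑ a, A b a * v (a, b')
  simp only [mulVec, dotProduct, kroneckerMap_apply, Fintype.sum_prod_type, Matrix.one_apply]
  refine Finset.sum_congr rfl fun a _ => ?_
  rw [Finset.sum_eq_single b'] <;> simp +contextual [eq_comm]

theorem sign_kronecker_mulVec (f : M.B → ℤ) (A : Matrix N.B N.B S) (v : M.B × N.B → S)
    (b : M.B × N.B) :
    ((signMatrix S f ⊗ₖ A) *ᵥ v) b = (((f b.1).negOnePow : ℤ) : S) * onRight M (op A) v b := by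
  obtain ⟨b, b'⟩ := b
  change _ = (((f b).negOnePow : ℤ) : S) * ∑ a, A b' a * v (b, a)
  simp only [mulVec, dotProduct, kroneckerMap_apply, Fintype.sum_prod_type, signMatrix,
    diagonal_apply]
  rw [Finset.sum_eq_single b]
  · simp [Finset.mul_sum, mul_assoc]
  · intro a _ hab
    simp [hab.symm]
  · simp

theorem tensor_dp_mulVec (v : M.B × N.B → S) :
    (M.tensor N).dp *ᵥ v = onLeft N (op M.dp) v + signLeft M N (onRight M (op N.dp) v) := by
  change (M.dp ⊗ₖ (1 : Matrix N.B N.B S) + signMatrix S M.mf ⊗ₖ N.dp) *ᵥ v = _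
  rw [add_mulVec, kronecker_one_mulVec]
  congr 1
  ext b
  exact sign_kronecker_mulVec _ _ _ _

theorem tensor_dm_mulVec (v : M.B × N.B → S) :
    (M.tensor N).dm *ᵥ v = onLeft N (op M.dm) v + signLeft M N (onRight M (op N.dm) v) := by
  change (M.dm ⊗ₖ (1 : Matrix N.B N.B S) + signMatrix S M.mf ⊗ₖ N.dm) *ᵥ v = _
  rw [add_mulVec, kronecker_one_mulVec]
  congr 1
  ext b
  exact sign_kronecker_mulVec _ _ _ _

/-- This is where the scalars `A` enter: an operator on the first factor that is merely `A`-linear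
commutes with a matrix on the second factor as soon as the entries of the matrix lie in `A`. -/
theorem onLeft_commute_onRight {A : Set S} (f : AddMonoid.End (M.B → S))
    (hf : ∀ a ∈ A, ∀ v, f (a • v) = a • f v) (D : Matrix N.B N.B S) (hD : ∀ b a, D b a ∈ A) :
    onRight M (op D) * onLeft N f = onLeft N f * onRight M (op D) := by
  ext v b
  obtain ⟨b, b'⟩ := b
  change ∑ a', D b' a' * f (fun a => v (a, a')) b = f (fun a => ∑ a', D b' a' * v (a, a')) b
  have : (fun a => ∑ a', D b' a' * v (a, a')) = ∑ a', D b' a' • fun a => v (a, a') := by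
    ext a; simp
  rw [this, map_sum, Finset.sum_apply]
  refine Finset.sum_congr rfl fun a' _ => ?_
  rw [hf _ (hD b' a')]; rfl

theorem signLeft_onRight (f : AddMonoid.End (N.B → S)) :
    signLeft M N * onRight M f = onRight M f * signLeft M N := by
  ext v b
  change (((M.mf b.1).negOnePow : ℤ) : S) * f (fun a => v (b.1, a)) b.2 =
    f (fun a => (((M.mf b.1).negOnePow : ℤ) : S) * v (b.1, a)) b.2
  have : (fun a => (((M.mf b.1).negOnePow : ℤ) : S) * v (b.1, a)) =
    ((M.mf b.1).negOnePow : ℤ) • (fun a => v (b.1, a)) := by ext a; simp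
  rw [this, map_zsmul]; simp

namespace Contraction

variable {A A' : Set S} (c : M.Contraction A) (c' : N.Contraction A')

/-- The values of `ε` are concentrated in degree `0`, where the parity sign is trivial. -/
theorem signLeft_ε : signLeft M N * onLeft N c.ε = onLeft N c.ε := by
  ext v b
  change (((M.mf b.1).negOnePow : ℤ) : S) * c.ε (fun a => v (a, b.2)) b.1 =
    c.ε (fun a => v (a, b.2)) b.1
  by_cases hb : M.mf b.1 = 0
  · simp [hb]
  · rw [c.ε_apply _ _ hb, mul_zero]

theorem ε_signLeft : onLeft N c.ε * signLeft M N = onLeft N c.ε := by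
  ext v b
  refine congrFun (c.ε_congr fun a ha => ?_) b.1
  change (((M.mf a).negOnePow : ℤ) : S) * v (a, b.2) = v (a, b.2)
  simp [ha]

theorem h_signLeft : signLeft M N * onLeft N c.h + onLeft N c.h * signLeft M N = 0 := by
  ext v b
  exact (congrArg _ (c.h_sign (fun a => v (a, b.2)) b.1)).trans (add_neg_cancel _)

theorem op_homotopy : op M.dp * c.h + c.h * op M.dp + c.ε = 1 := by
  ext1 v
  exact c.homotopy v

/-- An operator on the second factor leaves the image of `ε` in degree `0` of the first, from which
`dp` has no nonzero target. -/
theorem dp_onRight_ε (f : AddMonoid.End (N.B → S)) :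
    onLeft N (op M.dp) * (onRight M f * onLeft N c.ε) = 0 := by
  ext v b
  refine Finset.sum_eq_zero fun a _ => ?_
  change M.dp b.1 a * _ = 0
  by_cases ha : M.mf a = 0
  · rw [c.dp_apply_eq_zero _ a ha, zero_mul]
  · have : (fun a' => c.ε (fun x => v (x, a')) a) = 0 := by
      ext a'; exact c.ε_apply _ _ ha
    change M.dp b.1 a * f (fun a' => c.ε (fun x => v (x, a')) a) b.2 = 0
    rw [this, map_zero, Pi.zero_apply, mul_zero]

/-- The contraction of a tensor product. -/
def tensor (hN : ∀ b a, N.dp b a ∈ A) : (M.tensor N).Contraction (A ∩ A') where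
  -- The composite homotopy `h ⊗ 1 + ε ⊗ h'`: contract the first factor onto degree `0`, then
  -- contract the second. The second term needs no Koszul sign because `ε` lives in degree `0`.
  h := onLeft N c.h + onRight M c'.h * onLeft N c.ε
  ε := onRight M c'.ε * onLeft N c.ε
  nonpos b := add_nonpos (c.nonpos b.1) (c'.nonpos b.2)
  h_deg v b := by
    obtain ⟨b, b'⟩ := b
    change c.h (fun a => v (a, b')) b + c'.h (fun a' => c.ε (fun a => v (a, a')) b) b' =
      c.h (fun a => if M.mf a + N.mf b' = M.mf b + N.mf b' + 1 then v (a, b') else 0) b +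
        c'.h (fun a' => c.ε (fun a => if M.mf a + N.mf a' = M.mf b + N.mf b' + 1
          then v (a, a') else 0) b) b'
    congr 1
    · refine (c.h_deg _ _).trans (Eq.trans ?_ (c.h_deg _ _).symm)
      refine congrArg (fun w => c.h w b) (funext fun a => ?_)
      simp only [comp]
      split_ifs <;> first | rfl | omega
    · refine (c'.h_deg _ _).trans (Eq.trans ?_ (c'.h_deg _ _).symm)
      refine congrArg (fun w => c'.h w b') (funext fun a' => ?_)
      simp only [comp]
      split_ifs with ha'
      · by_cases hb : M.mf b = 0
        · refine congrFun (c.ε_congr fun a ha => ?_) b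
          rw [if_pos (by omega)]
        · rw [c.ε_apply _ _ hb, c.ε_apply _ _ hb]
      · rfl
  homotopy v := by
    have e1 : onLeft N (op M.dp) * onLeft N c.h + onLeft N c.h * onLeft N (op M.dp) =
        1 - onLeft N c.ε := by
      rw [eq_sub_iff_add_eq]
      exact congrArg (onLeft N) c.op_homotopy
    have e2 : onRight M (op N.dp) * onRight M c'.h + onRight M c'.h * onRight M (op N.dp) =
        1 - onRight M c'.ε := by
      rw [eq_sub_iff_add_eq]
      exact congrArg (onRight M) c'.op_homotopy
    have e3 := onLeft_commute_onRight (N := N) c.h c.h_smul N.dp hN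
    have e4 := onLeft_commute_onRight (N := N) c.ε c.ε_smul N.dp hN
    have e5 : onLeft N c.ε * onLeft N (op M.dp) = 0 := by
      ext v b
      exact congrFun (c.ε_dp (fun a => v (a, b.2))) b.1
    -- In this noncommutative expansion the cross terms of `h` with the second differential cancel,
    -- since `h` commutes with that differential and anticommutes with the sign. What remains is `(1
    -- - ε) ⊗ 1 + ε ⊗ (1 - ε')`, completed to `1` by `ε ⊗ ε'`.
    have key : (onLeft N (op M.dp) + signLeft M N * onRight M (op N.dp)) *
        (onLeft N c.h + onRight M c'.h * onLeft N c.ε) +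
        (onLeft N c.h + onRight M c'.h * onLeft N c.ε) *
        (onLeft N (op M.dp) + signLeft M N * onRight M (op N.dp)) +
        onRight M c'.ε * onLeft N c.ε = 1 := by
      calc _ = (onLeft N (op M.dp) * onLeft N c.h + onLeft N c.h * onLeft N (op M.dp)) +
            onLeft N (op M.dp) * (onRight M c'.h * onLeft N c.ε) +
            (signLeft M N * (onRight M (op N.dp) * onLeft N c.h) +
              (onLeft N c.h * signLeft M N) * onRight M (op N.dp)) +
            (signLeft M N * onRight M (op N.dp)) * onRight M c'.h * onLeft N c.ε +
            onRight M c'.h * (onLeft N c.ε * onLeft N (op M.dp)) +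
            onRight M c'.h * ((onLeft N c.ε * signLeft M N) * onRight M (op N.dp)) +
            onRight M c'.ε * onLeft N c.ε := by noncomm_ring
        _ = 1 - onLeft N c.ε + onRight M (op N.dp) * (signLeft M N * onRight M c'.h) *
              onLeft N c.ε +
            onRight M c'.h * (onRight M (op N.dp) * onLeft N c.ε) +
            onRight M c'.ε * onLeft N c.ε := by
          rw [e1, c.dp_onRight_ε, e3, ← mul_assoc (signLeft M N), ← add_mul, c.h_signLeft,
            signLeft_onRight, e5, c.ε_signLeft, ← e4]
          noncomm_ring
        _ = 1 - onLeft N c.ε + (onRight M (op N.dp) * onRight M c'.h +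
              onRight M c'.h * onRight M (op N.dp)) * onLeft N c.ε +
            onRight M c'.ε * onLeft N c.ε := by
          rw [signLeft_onRight, mul_assoc, mul_assoc, c.signLeft_ε]
          noncomm_ring
        _ = 1 := by rw [e2, sub_mul, one_mul]; abel
    refine Eq.trans ?_ (DFunLike.congr_fun key v)
    refine congrArg₂ _ (congrArg₂ _ (tensor_dp_mulVec _) ?_) rfl
    exact congrArg (onLeft N c.h + onRight M c'.h * onLeft N c.ε) (tensor_dp_mulVec v)
  ε_apply v b hb := by
    obtain ⟨b, b'⟩ := b
    change c'.ε (fun a' => c.ε (fun a => v (a, a')) b) b' = 0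
    by_cases h1 : M.mf b = 0
    · exact c'.ε_apply _ _ fun h2 => hb (by change M.mf b + N.mf b' = 0; omega)
    · have : (fun a' => c.ε (fun a => v (a, a')) b) = 0 := by
        ext a'; exact c.ε_apply _ _ h1
      rw [this, map_zero]; rfl
  ε_eq_zero v hv := by
    ext ⟨b, b'⟩
    change c'.ε (fun a' => c.ε (fun a => v (a, a')) b) b' = 0
    rw [c'.ε_eq_zero]
    · rfl
    · intro a' ha'
      rw [c.ε_eq_zero]
      · rfl
      · intro a ha
        exact hv (a, a') (by change M.mf a + N.mf a' = 0; omega)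
  h_smul a ha v := by
    ext ⟨b, b'⟩
    change c.h (a • fun x => v (x, b')) b + c'.h (fun a' => c.ε (a • fun x => v (x, a')) b) b' =
      a * (c.h (fun x => v (x, b')) b + c'.h (fun a' => c.ε (fun x => v (x, a')) b) b')
    rw [c.h_smul a ha.1]
    simp only [c.ε_smul a ha.1]
    have := congrFun (c'.h_smul a ha.2 (fun a' => c.ε (fun x => v (x, a')) b)) b'
    rw [mul_add]
    exact congrArg₂ _ rfl this

end Contraction

end Tensor

namespace Contraction

/-- The contraction of an elementary factorization given by a left inverse to the multiplication
by `x`. -/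
def koszul (x y : S) (n : ℤ) (A : Set S) (q : S →+ S) (hq : ∀ g, q (x * g) = g)
    (hA : ∀ a ∈ A, ∀ g, q (a * g) = a * q g) : (MatFac.koszul x y n).Contraction A where
  h :=
    { toFun := fun (v : Bool → S) (b : Bool) => bif b then q (v false) else 0
      map_zero' := funext fun b => by
        cases b
        · rfl
        · exact map_zero q
      map_add' := fun (v w : Bool → S) => funext fun b => by
        cases b
        · exact (add_zero (0 : S)).symm
        · exact map_add q (v false) (w false) }
  ε :=
    -- The homotopy is the quotient of a division by `x`, and `ε` is its remainder.
    { toFun := fun (v : Bool → S) (b : Bool) => bif b then 0 else v false - x * q (v false)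
      map_zero' := funext fun b => by
        cases b
        · change (0 : S) - x * q 0 = 0
          simp
        · rfl
      map_add' := fun (v w : Bool → S) => funext fun b => by
        cases b
        · change v false + w false - x * q (v false + w false) =
            v false - x * q (v false) + (w false - x * q (w false))
          rw [map_add]; ring
        · exact (add_zero (0 : S)).symm }
  nonpos := by rintro (_ | _) <;> simp [MatFac.koszul]
  h_deg := by
    rintro v (_ | _)
    · rfl
    · rfl
  homotopy v := by
    ext (_ | _)
    · change (∑ a : Bool, (MatFac.koszul x y n).dp false a * (bif a then q (v false) else 0)) +
        0 + (v false - x * q (v false)) = v false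
      rw [Fintype.sum_bool]
      simp [MatFac.koszul]
    · change (∑ a : Bool, (MatFac.koszul x y n).dp true a * (bif a then q (v false) else 0)) +
        q (∑ a : Bool, (MatFac.koszul x y n).dp false a * v a) + 0 = v true
      rw [Fintype.sum_bool, Fintype.sum_bool]
      simp [MatFac.koszul, hq]
  ε_apply := by
    rintro v (_ | _) hb
    · exact absurd rfl hb
    · rfl
  ε_eq_zero v hv := by
    ext (_ | _)
    · change v false - x * q (v false) = 0
      rw [hv false rfl, map_zero, mul_zero, sub_zero]
    · rfl
  h_smul a ha v := by
    ext (_ | _)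
    · change (0 : S) = a * 0
      simp
    · exact hA a ha (v false)

/-- The contraction of the unit. -/
def unit (A : Set S) : (MatFac.unit : MatFac S).Contraction A where
  h := 0
  ε := 1
  nonpos _ := le_rfl
  h_deg _ _ := rfl
  homotopy v := by
    funext b
    change (∑ a : Unit, (0 : S) * 0) + 0 + v b = v b
    simp
  ε_apply _ _ hb := absurd rfl hb
  ε_eq_zero v hv := by ext b; exact hv b rfl
  h_smul _ _ _ := by simp

/-- Transport of a contraction along an isomorphism of the positive complexes. -/
def conj {M N : MatFac S} {A : Set S} (c : M.Contraction A) (P : Matrix N.B M.B S)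
    (Q : Matrix M.B N.B S) (hPQ : P * Q = 1) (hP : P * M.dp = N.dp * P)
    (degP : ∀ b a, N.mf b ≠ M.mf a → P b a = 0) (degQ : ∀ b a, M.mf b ≠ N.mf a → Q b a = 0)
    (hQ : Q * N.dp = M.dp * Q) (nonpos : ∀ b, N.mf b ≤ 0) : N.Contraction A where
  h := P.mulVecLin.toAddMonoidHom.comp (c.h.comp Q.mulVecLin.toAddMonoidHom)
  ε := P.mulVecLin.toAddMonoidHom.comp (c.ε.comp Q.mulVecLin.toAddMonoidHom)
  nonpos := nonpos
  h_deg v b := by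
    refine Finset.sum_congr rfl fun a _ => ?_
    by_cases hab : N.mf b = M.mf a
    · congr 1
      change c.h (Q *ᵥ v) a = c.h (Q *ᵥ _) a
      refine (c.h_deg _ _).trans (Eq.trans ?_ (c.h_deg _ _).symm)
      refine congrArg (fun w => c.h w a) (funext fun x => ?_)
      simp only [comp]
      split_ifs with hx
      · refine Finset.sum_congr rfl fun y _ => ?_
        change Q x y * _ = Q x y * (if _ then _ else _)
        by_cases hy : M.mf x = N.mf y
        · rw [if_pos (by omega)]
        · rw [degQ _ _ hy, zero_mul, zero_mul]
      · rfl
    · change P b a * _ = P b a * _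
      rw [degP _ _ hab, zero_mul, zero_mul]
  homotopy v := by
    change N.dp *ᵥ (P *ᵥ c.h (Q *ᵥ v)) + P *ᵥ c.h (Q *ᵥ (N.dp *ᵥ v)) + P *ᵥ c.ε (Q *ᵥ v) = v
    rw [mulVec_mulVec, ← hP, mulVec_mulVec, hQ, ← mulVec_mulVec, ← mulVec_mulVec, ← mulVec_add,
      ← mulVec_add, c.homotopy, mulVec_mulVec, hPQ, one_mulVec]
  ε_apply v b hb := by
    refine Finset.sum_eq_zero fun a _ => ?_
    by_cases hab : N.mf b = M.mf a
    · change _ * c.ε (Q *ᵥ v) a = 0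
      rw [c.ε_apply _ _ (by omega), mul_zero]
    · change P b a * _ = 0
      rw [degP _ _ hab, zero_mul]
  ε_eq_zero v hv := by
    change P *ᵥ c.ε (Q *ᵥ v) = 0
    rw [c.ε_eq_zero, mulVec_zero]
    intro b hb
    refine Finset.sum_eq_zero fun y _ => ?_
    change Q b y * _ = 0
    by_cases hy : M.mf b = N.mf y
    · rw [hv _ (by omega), mul_zero]
    · rw [degQ _ _ hy, zero_mul]
  h_smul a ha v := by
    change P *ᵥ c.h (Q *ᵥ (a • v)) = a • P *ᵥ c.h (Q *ᵥ v)
    rw [mulVec_smul, c.h_smul a ha, mulVec_smul]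

/-- The contraction of a two-term complex. -/
def twoTerm {M N : MatFac S} {A : Set S} (c : M.Contraction A) (c' : N.Contraction A) (j s : ℤ)
    (f : Matrix N.B M.B S) (hpot : M.potential = N.potential)
    (hdeg : ∀ b a, N.mf b ≠ M.mf a → f b a = 0) (hp : f * M.dp = N.dp * f)
    (hm : f * M.dm = N.dm * f) :
    (MFComplex.twoTerm M N j s f hpot hdeg hp hm).toMatFac.Contraction A where
  h :=
    { toFun := fun (v : M.B ⊕ N.B → S) => Sum.elim (c.h (v ∘ Sum.inl)) (c'.h (v ∘ Sum.inr))
      map_zero' := by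
        ext (b | b)
        · exact congrFun (map_zero c.h) b
        · exact congrFun (map_zero c'.h) b
      map_add' := by
        intro v w
        ext (b | b)
        · exact congrFun (map_add c.h _ _) b
        · exact congrFun (map_add c'.h _ _) b }
  ε :=
    { toFun := fun (v : M.B ⊕ N.B → S) => Sum.elim (c.ε (v ∘ Sum.inl)) (c'.ε (v ∘ Sum.inr))
      map_zero' := by
        ext (b | b)
        · exact congrFun (map_zero c.ε) b
        · exact congrFun (map_zero c'.ε) b
      map_add' := by
        intro v w
        ext (b | b)
        · exact congrFun (map_add c.ε _ _) b
        · exact congrFun (map_add c'.ε _ _) b }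
  nonpos := by
    rintro (b | b)
    · exact c.nonpos b
    · exact c'.nonpos b
  h_deg := by
    rintro v (b | b)
    · exact c.h_deg _ b
    · exact c'.h_deg _ b
  homotopy v := by
    have e (w : M.B ⊕ N.B → S) : (MFComplex.twoTerm M N j s f hpot hdeg hp hm).dp *ᵥ w =
        Sum.elim (M.dp *ᵥ (w ∘ Sum.inl)) (N.dp *ᵥ (w ∘ Sum.inr)) := by
      refine (fromBlocks_mulVec M.dp 0 0 N.dp w).trans ?_
      simp
    refine (congrArg₂ (· + ·) (congrArg₂ (· + ·) (e _) (congrArg _ (e v))) rfl).trans ?_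
    ext (b | b)
    · exact congrFun (c.homotopy (v ∘ Sum.inl)) b
    · exact congrFun (c'.homotopy (v ∘ Sum.inr)) b
  ε_apply := by
    rintro v (b | b) hb
    · exact c.ε_apply _ b hb
    · exact c'.ε_apply _ b hb
  ε_eq_zero v hv := by
    ext (b | b)
    · exact congrFun (c.ε_eq_zero (v ∘ Sum.inl) fun b hb => hv (Sum.inl b) hb) b
    · exact congrFun (c'.ε_eq_zero (v ∘ Sum.inr) fun b hb => hv (Sum.inr b) hb) b
  h_smul a ha v := by
    ext (b | b)
    · exact congrFun (c.h_smul a ha (v ∘ Sum.inl)) b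
    · exact congrFun (c'.h_smul a ha (v ∘ Sum.inr)) b

end Contraction

end MatFac

/-! ### Acyclicity of the kernel of the projection onto the zeroth homology -/

namespace MatFac

variable {S : Type u} [CommRing S]

/-- The component of degree `0` of the vector is a boundary of the positive complex. -/
def IsBoundary (M : MatFac S) (v : M.B → S) : Prop :=
  ∃ u, ∀ b, M.mf b = 0 → v b = (M.dp *ᵥ u) b

theorem sq_mulVec (M : MatFac S) (h : M.potential = 0) (v : M.B → S) :
    (M.dp + M.dm) *ᵥ ((M.dp + M.dm) *ᵥ v) = 0 := by
  rw [mulVec_mulVec, M.sq, h, zero_smul, zero_mulVec]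

/-- The grouping isolates the only summand that raises the degree of the first factor. -/
theorem tensor_mulVec (M N : MatFac S) (v : M.B × N.B → S) :
    ((M.tensor N).dp + (M.tensor N).dm) *ᵥ v = onLeft N (op M.dp) v +
      (onLeft N (op M.dm) v + signLeft M N (onRight M (op (N.dp + N.dm)) v)) := by
  refine (add_mulVec _ _ _).trans ((congrArg₂ _ (tensor_dp_mulVec v) (tensor_dm_mulVec v)).trans ?_)
  have : onRight M (op (N.dp + N.dm)) v = onRight M (op N.dp) v + onRight M (op N.dm) v := by
    ext b
    exact congrFun (add_mulVec N.dp N.dm _) b.2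
  rw [this, map_add]
  abel

section

variable {M N : MatFac S}

/-- The total differential of a tensor product minus the positive differential of the first
factor. -/
def lowerPart (M N : MatFac S) : AddMonoid.End (M.B × N.B → S) :=
  onLeft N (op M.dm) + signLeft M N * onRight M (op (N.dp + N.dm))

/-- The negative differential of the first factor lowers its degree and the differential of the
second preserves it, so the top degree of a vector in the first factor cannot increase. -/
theorem lowerPart_support (m : ℤ) (v : M.B × N.B → S) (hv : ∀ b, m ≤ M.mf b.1 → v b = 0)
    (b : M.B × N.B) (hb : m ≤ M.mf b.1) : lowerPart M N v b = 0 := by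
  change ∑ a, M.dm b.1 a * v (a, b.2) +
    (((M.mf b.1).negOnePow : ℤ) : S) * ∑ a, (N.dp + N.dm) b.2 a * v (b.1, a) = 0
  rw [Finset.sum_eq_zero, Finset.sum_eq_zero, mul_zero, add_zero]
  · intro a _
    exact (congrArg _ (hv (b.1, a) hb)).trans (mul_zero _)
  · intro a _
    by_cases h : M.mf b.1 = M.mf a - 1
    · rw [hv _ (by change m ≤ M.mf a; omega), mul_zero]
    · rw [M.dm_deg _ _ h, zero_mul]

namespace Contraction

variable {A : Set S} (c : M.Contraction A)

theorem h_support (m : ℤ) (v : M.B × N.B → S) (hv : ∀ b, m + 1 ≤ M.mf b.1 → v b = 0)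
    (b : M.B × N.B) (hb : m ≤ M.mf b.1) : onLeft N c.h v b = 0 := by
  change c.h (fun a => v (a, b.2)) b.1 = 0
  rw [c.h_deg]
  have : M.comp (M.mf b.1 + 1) (fun a => v (a, b.2)) = 0 := by
    ext a
    simp only [comp]
    split_ifs with ha
    · exact hv _ (by change m + 1 ≤ M.mf a; omega)
    · rfl
  rw [this, map_zero]; rfl

theorem ε_support (v : M.B × N.B → S) (hv : ∀ b, 0 ≤ M.mf b.1 → v b = 0) :
    onLeft N c.ε v = 0 := by
  ext b
  change c.ε (fun a => v (a, b.2)) b.1 = 0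
  rw [c.ε_eq_zero]
  · rfl
  · intro a ha
    exact hv _ ha.ge

theorem onLeft_ε_dp (v : M.B × N.B → S) : onLeft N c.ε (onLeft N (op M.dp) v) = 0 := by
  ext b
  exact congrFun (c.ε_dp (fun a => v (a, b.2))) b.1

/-- A perturbation argument: replacing the cycle `v` by `v - D (h v)` strictly lowers its top degree
in the first factor and keeps it in the kernel of `ε`. Since the degrees are bounded below, finitely
many such steps reach zero. -/
theorem tensor_acyclic (hpot : (M.tensor N).potential = 0) (v : M.B × N.B → S)
    (hv : ((M.tensor N).dp + (M.tensor N).dm) *ᵥ v = 0) (hε : onLeft N c.ε v = 0) :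
    ∃ y : M.B × N.B → S, ((M.tensor N).dp + (M.tensor N).dm) *ᵥ y = v ∧ onLeft N c.ε y = 0 := by
  obtain ⟨lo, hlo⟩ := (Set.finite_range M.mf).bddBelow
  have hlo (b : M.B) : lo ≤ M.mf b := hlo ⟨b, rfl⟩
  set D : AddMonoid.End (M.B × N.B → S) := onLeft N (op M.dp) + lowerPart M N with hDdef
  have hD (w : M.B × N.B → S) : ((M.tensor N).dp + (M.tensor N).dm) *ᵥ w = D w :=
    tensor_mulVec M N w
  have hsq (w : M.B × N.B → S) : D (D w) = 0 := by
    rw [← hD, ← hD]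
    exact (M.tensor N).sq_mulVec hpot w
  rw [hD] at hv
  simp only [hD]
  have main : ∀ n : ℕ, ∀ v : M.B × N.B → S, D v = 0 → onLeft N c.ε v = 0 →
      (∀ b, lo + n ≤ M.mf b.1 → v b = 0) → ∃ y, D y = v ∧ onLeft N c.ε y = 0 := by
    intro n
    induction n with
    | zero =>
      intro v _ _ h
      refine ⟨0, ?_, map_zero _⟩
      rw [map_zero]
      ext b
      exact (h b (by simpa using hlo b.1)).symm
    | succ n ih =>
      intro v hv hε h
      have hhom : onLeft N (op M.dp) (onLeft N c.h v) + onLeft N c.h (onLeft N (op M.dp) v) +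
          onLeft N c.ε v = v :=
        DFunLike.congr_fun (congrArg (onLeft N) c.op_homotopy) v
      have hDv : onLeft N (op M.dp) v + lowerPart M N v = 0 := hv
      have hDy : D (onLeft N c.h v) = onLeft N (op M.dp) (onLeft N c.h v) +
        lowerPart M N (onLeft N c.h v) := rfl
      -- The image of `h` lies in degrees `≤ -1`, because the complex has nothing in degree `1`;
      -- hence `ε` vanishes on it.
      have h0 : ∀ b, (0 : ℤ) ≤ M.mf b.1 → onLeft N c.h v b = 0 :=
        c.h_support 0 v fun b hb => absurd (c.nonpos b.1) (by omega)
      have hεy : onLeft N c.ε (onLeft N c.h v) = 0 := c.ε_support _ h0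
      have hεDy : onLeft N c.ε (D (onLeft N c.h v)) = 0 := by
        rw [hDy, map_add, c.onLeft_ε_dp, c.ε_support _ (lowerPart_support 0 _ h0), add_zero]
      -- The homotopy identity, combined with `dp v = -lowerPart v` and `ε v = 0`, leaves only terms
      -- in which `h` occurs once next to `lowerPart`; these have smaller top degree than `v`.
      have hv' : v - D (onLeft N c.h v) =
          -onLeft N c.h (lowerPart M N v) - lowerPart M N (onLeft N c.h v) := by
        have : onLeft N (op M.dp) v = -lowerPart M N v := eq_neg_of_add_eq_zero_left hDv
        rw [hε, add_zero, this, map_neg] at hhom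
        rw [hDy]
        nth_rewrite 1 [← hhom]
        abel
      obtain ⟨y, hy, hyε⟩ := ih (v - D (onLeft N c.h v)) (by rw [map_sub, hv, hsq, sub_zero])
        (by rw [map_sub, hε, hεDy, sub_zero]) (by
          intro b hb
          rw [hv', Pi.sub_apply, Pi.neg_apply, c.h_support (lo + n) _ _ b hb,
            lowerPart_support (lo + n) _ _ b hb, neg_zero, sub_zero]
          · exact c.h_support (lo + n) v fun b hb => h b (by push_cast; omega)
          · intro b hb
            exact lowerPart_support (lo + n + 1) v (fun b hb => h b (by push_cast; omega)) b hb)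
      refine ⟨y + onLeft N c.h v, ?_, ?_⟩
      · rw [map_add, hy, sub_add_cancel]
      · rw [map_add, hyε, hεy, add_zero]
  -- With this bound the support condition concerns degrees at least `1` only, where there are no
  -- basis vectors.
  refine main (1 - lo).toNat v hv hε fun b hb => ?_
  have := c.nonpos b.1
  omega

end Contraction

end

end MatFac

namespace MFComplex

variable {S : Type u} [CommRing S] (C : MFComplex S)

/-- Extension by zero of a vector of cohomological degree `j`. -/
def extend (j : ℤ) (x : C.Term j) : C.B → S := fun b => if h : C.coh b = j then x ⟨b, h⟩ else 0

/-- Restriction of a vector to cohomological degree `j`. -/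
def restrict (j : ℤ) (v : C.B → S) : C.Term j := fun b => v b.1

theorem restrict_extend (j : ℤ) (x : C.Term j) : C.restrict j (C.extend j x) = x := by
  ext ⟨b, h⟩
  simp [restrict, extend, h]

theorem dpm_eq_zero (b a : C.B) (h : C.coh b ≠ C.coh a) : (C.dp + C.dm) b a = 0 :=
  C.dpm_coh (C.coh a) b a rfl h

theorem D_restrict (j : ℤ) (v : C.B → S) :
    C.D j (C.restrict j v) = C.restrict j ((C.dp + C.dm) *ᵥ v) := by
  ext ⟨b, hb⟩
  change ∑ a : {a // C.coh a = j}, (C.dp + C.dm) b a.1 * v a.1 = ∑ a, (C.dp + C.dm) b a * v a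
  rw [← Finset.sum_filter_add_sum_filter_not Finset.univ fun a => C.coh a = j,
    Finset.sum_subtype (p := fun a => C.coh a = j) (Finset.univ.filter fun a => C.coh a = j)
    (by simp)]
  rw [Finset.sum_eq_zero (s := Finset.univ.filter fun a => ¬ C.coh a = j), add_zero]
  intro a ha
  rw [C.dpm_eq_zero b a (by rw [hb]; exact fun h => (Finset.mem_filter.1 ha).2 h.symm), zero_mul]

theorem extend_D (j : ℤ) (x : C.Term j) :
    C.extend j (C.D j x) = (C.dp + C.dm) *ᵥ C.extend j x := by
  ext b
  rw [extend]
  split_ifs with h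
  · conv_lhs => rw [← C.restrict_extend j x, D_restrict]
    rfl
  · refine (Finset.sum_eq_zero fun a _ => ?_).symm
    change (C.dp + C.dm) b a * (if h : C.coh a = j then x ⟨a, h⟩ else 0) = 0
    split_ifs with ha
    · rw [C.dpm_eq_zero b a (by rw [ha]; exact h), zero_mul]
    · rw [mul_zero]

theorem D_D (h : C.potential = 0) (j : ℤ) (x : C.Term j) : C.D j (C.D j x) = 0 := by
  conv_lhs => rw [← C.restrict_extend j x, D_restrict, D_restrict, C.sq_mulVec h]
  rfl

/-- Since `dp` preserves the cohomological degree, a preimage can be truncated along with the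
boundary. -/
theorem isBoundary_cut (i : ℤ) (v : C.B → S) (h : C.IsBoundary v) :
    C.IsBoundary fun b => if C.coh b = i then v b else 0 := by
  obtain ⟨u, hu⟩ := h
  refine ⟨fun b => if C.coh b = i then u b else 0, fun b hb => ?_⟩
  change (if C.coh b = i then v b else 0) = ∑ a, C.dp b a * if C.coh a = i then u a else 0
  split_ifs with h
  · rw [hu b hb]
    refine Finset.sum_congr rfl fun a _ => ?_
    change C.dp b a * u a = _
    split_ifs with ha
    · rfl
    · rw [C.dp_coh b a (by rw [h]; exact Ne.symm ha), zero_mul, zero_mul]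
  · refine (Finset.sum_eq_zero fun a _ => ?_).symm
    split_ifs with ha
    · rw [C.dp_coh b a (by rw [ha]; exact h), zero_mul]
    · rw [mul_zero]

section Tensor

variable {X Y : MFComplex S}

/-- The part of a vector in the tensor product along a basis vector of the second factor. -/
def slice {j : ℤ} (x : (X.tensor Y).Term j) (b' : Y.B) : X.B → S :=
  fun b => (X.tensor Y).extend j x (b, b')

/-- The acyclicity in a single cohomological degree: the vector is extended by zero, a primitive is
found in the whole module, and the primitive is restricted again. -/
theorem tensor_term_acyclic {A : Set S} (c : X.Contraction A) (hpot : (X.tensor Y).potential = 0)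
    (j : ℤ) (x : (X.tensor Y).Term j) (hx : (X.tensor Y).D j x = 0)
    (hb : ∀ b', X.IsBoundary (slice x b')) :
    ∃ y, (X.tensor Y).D j y = x ∧ ∀ b', X.IsBoundary (slice y b') := by
  obtain ⟨y, hy, hyε⟩ := c.tensor_acyclic (N := Y.toMatFac) hpot ((X.tensor Y).extend j x)
    ((extend_D _ j x).symm.trans (by
      rw [hx]
      funext b
      change (if h : _ then (0 : S) else 0) = 0
      exact dite_eq_right_iff.2 fun _ => rfl)) (by
      ext b
      exact congrFun ((c.ε_eq_zero_iff _).2 (hb b.2)) b.1)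
  refine ⟨(X.tensor Y).restrict j y, ?_, fun b' => ?_⟩
  · exact (D_restrict (X.tensor Y) j y).trans ((congrArg _ hy).trans (restrict_extend _ j x))
  · have h1 : X.IsBoundary fun b => y (b, b') :=
      (c.ε_eq_zero_iff _).1 (funext fun b => congrFun hyε (b, b'))
    -- The part of total degree `j` along `b'` has cohomological degree `j - coh b'` in the first
    -- factor.
    convert X.isBoundary_cut (j - Y.coh b') _ h1 using 1
    ext b
    change (if h : X.coh b + Y.coh b' = j then y (b, b') else 0) = _
    by_cases h : X.coh b + Y.coh b' = j
    · rw [dif_pos h, if_pos (by omega)]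
    · rw [dif_neg h, if_neg (by omega)]

end Tensor

end MFComplex

/-! ### Gradings -/

/-- A grading of the `k`-algebra `S` given by its homogeneous pieces and the projections onto
them. -/
structure ScalarGrading (k S : Type u) [CommRing k] [CommRing S] [Algebra k S] (G : Type)
    [AddCommGroup G] where
  piece : G → Submodule k S
  proj : G → S →ₗ[k] S
  proj_mem : ∀ g x, proj g x ∈ piece g
  proj_eq : ∀ g x, x ∈ piece g → proj g x = x
  one_mem : 1 ∈ piece 0
  proj_mul : ∀ g h a x, a ∈ piece g → proj h (a * x) = a * proj (h - g) x

namespace ScalarGrading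

variable {k S : Type u} [CommRing k] [CommRing S] [Algebra k S] {G : Type} [AddCommGroup G]
  (gr : ScalarGrading k S G)

theorem mul_mem {g h : G} {a b : S} (ha : a ∈ gr.piece g) (hb : b ∈ gr.piece h) :
    a * b ∈ gr.piece (g + h) := by
  have := gr.proj_mul g (g + h) a b ha
  rw [add_sub_cancel_left, gr.proj_eq h b hb] at this
  rw [← this]
  exact gr.proj_mem _ _

end ScalarGrading

namespace MatFac

variable {k S : Type u} [CommRing k] [CommRing S] [Algebra k S] {G : Type} [AddCommGroup G]

/-- The degree of a basis vector. -/
def deg (M : MatFac S) (α β : G) (b : M.B) : G := M.q b • α + M.mf b • β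

/-- The differential is homogeneous of degree `2 • α + β`. -/
def Homogeneous (M : MatFac S) (gr : ScalarGrading k S G) (α β : G) : Prop :=
  ∀ b a, M.dp b a ∈ gr.piece (2 • α + β + M.deg α β a - M.deg α β b) ∧
    M.dm b a ∈ gr.piece (2 • α + β + M.deg α β a - M.deg α β b)

/-- A homogeneous matrix intertwines the projections onto homogeneous components, up to its degree
`2 • α + β`. -/
theorem Homogeneous.proj_mulVec {M : MatFac S} {gr : ScalarGrading k S G} {α β : G}
    {A : Matrix M.B M.B S}
    (h : ∀ b a, A b a ∈ gr.piece (2 • α + β + M.deg α β a - M.deg α β b)) (g : G) (v : M.B → S)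
    (b : M.B) : gr.proj (g + (2 • α + β) - M.deg α β b) ((A *ᵥ v) b) =
      (A *ᵥ fun a => gr.proj (g - M.deg α β a) (v a)) b := by
  change gr.proj _ (∑ a, A b a * v a) = ∑ a, A b a * _
  rw [map_sum]
  refine Finset.sum_congr rfl fun a _ => ?_
  rw [gr.proj_mul _ _ _ _ (h b a)]
  congr 2
  abel_nf

/-- A homogeneous component of a boundary is the boundary of a homogeneous component of a primitive.
-/
theorem IsBoundary.proj {M : MatFac S} {gr : ScalarGrading k S G} {α β : G}
    (hM : M.Homogeneous gr α β) {v : M.B → S} (h : M.IsBoundary v) (g : G) :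
    M.IsBoundary fun b => gr.proj (g - M.deg α β b) (v b) := by
  obtain ⟨u, hu⟩ := h
  refine ⟨fun a => gr.proj (g - (2 • α + β) - M.deg α β a) (u a), fun b hb => ?_⟩
  change gr.proj (g - M.deg α β b) (v b) = _
  rw [← Homogeneous.proj_mulVec fun b a => (hM b a).1, hu b hb, sub_add_cancel]

theorem tensor_deg (M N : MatFac S) (α β : G) (b : M.B × N.B) :
    (M.tensor N).deg α β b = M.deg α β b.1 + N.deg α β b.2 := by
  change (M.q b.1 + N.q b.2) • α + (M.mf b.1 + N.mf b.2) • β = _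
  rw [add_smul, add_smul, deg, deg]
  abel

theorem Homogeneous.tensor {M N : MatFac S} {gr : ScalarGrading k S G} {α β : G}
    (hM : M.Homogeneous gr α β) (hN : N.Homogeneous gr α β) :
    (M.tensor N).Homogeneous gr α β := by
  have key (A : Matrix M.B M.B S) (A' : Matrix N.B N.B S)
      (hA : ∀ b a, A b a ∈ gr.piece (2 • α + β + M.deg α β a - M.deg α β b))
      (hA' : ∀ b a, A' b a ∈ gr.piece (2 • α + β + N.deg α β a - N.deg α β b))
      (b a : M.B) (b' a' : N.B) :
      (A ⊗ₖ (1 : Matrix N.B N.B S) + signMatrix S M.mf ⊗ₖ A') (b, b') (a, a') ∈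
        gr.piece (2 • α + β + (M.deg α β a + N.deg α β a') - (M.deg α β b + N.deg α β b')) := by
    simp only [Matrix.add_apply, Matrix.kroneckerMap_apply, Matrix.one_apply, signMatrix,
      Matrix.diagonal_apply]
    refine add_mem ?_ ?_
    · split_ifs with h
      · subst h
        rw [mul_one]
        convert hA b a using 2
        abel
      · simp
    · split_ifs with h
      · subst h
        rw [← zsmul_eq_mul]
        refine zsmul_mem ?_ _
        convert hA' b' a' using 2
        abel
      · simp
  rintro ⟨b, b'⟩ ⟨a, a'⟩
  rw [tensor_deg, tensor_deg]
  exact ⟨key _ _ (fun b a => (hM b a).1) (fun b a => (hN b a).1) b a b' a',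
    key _ _ (fun b a => (hM b a).2) (fun b a => (hN b a).2) b a b' a'⟩

theorem Homogeneous.unit {gr : ScalarGrading k S G} {α β : G} :
    (MatFac.unit : MatFac S).Homogeneous gr α β :=
  fun _ _ => ⟨Submodule.zero_mem _, Submodule.zero_mem _⟩

/-- The degree required of `y` is the one for which `x * y` has degree `4 • α + 2 • β`, twice the
degree of the differential. -/
theorem Homogeneous.koszul {gr : ScalarGrading k S G} {α β : G} {x y : S} {n : ℤ}
    (hx : x ∈ gr.piece (n • α)) (hy : y ∈ gr.piece (2 • α + 2 • β + (2 - n) • α)) :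
    (MatFac.koszul x y n).Homogeneous gr α β := by
  have h1 : (MatFac.koszul x y n).deg α β true = (n - 2) • α + (-1 : ℤ) • β := rfl
  have h0 : (MatFac.koszul x y n).deg α β false = 0 := by
    change (0 : ℤ) • α + (0 : ℤ) • β = 0
    simp
  rintro (_ | _) (_ | _)
  · exact ⟨Submodule.zero_mem _, Submodule.zero_mem _⟩
  · refine ⟨?_, Submodule.zero_mem _⟩
    rw [h0, h1]
    change x ∈ _
    convert hx using 2
    module
  · refine ⟨Submodule.zero_mem _, ?_⟩
    rw [h0, h1]
    change y ∈ _
    convert hy using 2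
    module
  · exact ⟨Submodule.zero_mem _, Submodule.zero_mem _⟩

end MatFac

/-- A grading group with the degrees `2 • α` of the variables and `β` of the matrix factorization
degree for which the potential given by `p` is homogeneous. -/
structure GradingDatum {k : Type u} [CommRing k] (p : Polynomial k) where
  G : Type
  [grp : AddCommGroup G]
  α : G
  β : G
  cond : ∀ m : ℕ, p.coeff (m + 1) ≠ 0 → (2 * m) • α = 2 • α + 2 • β

attribute [instance] GradingDatum.grp

/-! ### The comparison principle for quotients by acyclic kernels -/

namespace MFComplex

variable {k S : Type u} [CommRing k] [CommRing S] [Algebra k S] {p : Polynomial k}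

/-- A surjective chain map out of a tensor product whose kernel consists of the elements that are
boundaries for the positive differential of the contractible first factor, induces an
isomorphism on total homology. -/
theorem homologyEquiv_of_contraction {X Y : MFComplex S} {A : Set S} (c : X.Contraction A)
    (hpot : (X.tensor Y).potential = 0) (E : DiffComplex k)
    (f : ∀ j, (X.tensor Y).Term j →ₗ[k] E.M j)
    (hD : ∀ j x, f j ((X.tensor Y).D j x) = E.D j (f j x))
    (hV : ∀ i j x, f j ((X.tensor Y).V i j x) = E.V i j (f i x))
    (surj : ∀ j, Function.Surjective (f j))
    (ker : ∀ j x, f j x = 0 ↔ ∀ b', X.IsBoundary (slice x b'))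
    (gr : ∀ γ : GradingDatum p, ScalarGrading k S γ.G)
    (hX : ∀ γ, X.Homogeneous (gr γ) γ.α γ.β) (hY : ∀ γ, Y.Homogeneous (gr γ) γ.α γ.β)
    (P' : (Σ γ : GradingDatum p, γ.G) → ∀ j, Submodule k (E.M j))
    (hP : ∀ i j, ((X.tensor Y).termPiece k (gr i.1).piece i.1.α i.1.β j i.2).map (f j) = P' i j) :
    DiffComplex.HomologyEquiv ((X.tensor Y).toDiffComplex k) E
      (fun i j => (X.tensor Y).termPiece k (gr i.1).piece i.1.α i.1.β j i.2) P' := by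
  -- If `f x` is a cycle, then `D x` is a cycle in the acyclic kernel, hence `D z` with `z` in the
  -- kernel; `x - z` is a cycle with the same image as `x`.
  have lift (j : ℤ) (x : (X.tensor Y).Term j) (hy : E.D j (f j x) = 0) :
      ∃ z, (X.tensor Y).D j z = (X.tensor Y).D j x ∧ ∀ b', X.IsBoundary (slice z b') := by
    rw [← hD] at hy
    exact tensor_term_acyclic c hpot j _ (D_D _ hpot j x) ((ker j _).1 hy)
  have h1 (j : ℤ) (y : E.M j) (hy : E.D j y = 0) :
      ∃ x : (X.tensor Y).Term j, (X.tensor Y).D j x = 0 ∧ f j x = y := by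
    obtain ⟨x, rfl⟩ := surj j y
    obtain ⟨z, hz, hzb⟩ := lift j x hy
    exact ⟨x - z, by rw [map_sub, hz, sub_self], by rw [map_sub, (ker j z).2 hzb, sub_zero]⟩
  have h2 (j : ℤ) (x : (X.tensor Y).Term j) (y : E.M j) (hx : (X.tensor Y).D j x = 0)
      (hxy : f j x = E.D j y) : ∃ z, (X.tensor Y).D j z = x := by
    obtain ⟨z, rfl⟩ := surj j y
    rw [← hD, ← sub_eq_zero, ← map_sub] at hxy
    obtain ⟨z', hz', -⟩ := tensor_term_acyclic c hpot j _ (by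
      rw [map_sub, D_D _ hpot, sub_zero]; exact hx) ((ker j _).1 hxy)
    exact ⟨z' + z, by rw [map_add, hz', sub_add_cancel]⟩
  have h3 (i : Σ γ : GradingDatum p, γ.G) (j : ℤ) (y : E.M j) (hyP : y ∈ P' i j)
      (hy : E.D j y = 0) : ∃ x ∈ (X.tensor Y).termPiece k (gr i.1).piece i.1.α i.1.β j i.2,
        (X.tensor Y).D j x = 0 ∧ f j x = y := by
    obtain ⟨γ, g⟩ := i
    rw [← hP] at hyP
    obtain ⟨x, hx, rfl⟩ := hyP
    obtain ⟨z, hz, hzb⟩ := lift j x hy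
    have hT : (X.tensor Y).Homogeneous (gr γ) γ.α γ.β := MatFac.Homogeneous.tensor (hX γ) (hY γ)
    -- The projection onto the elements of degree `g`. It turns the correction term into a
    -- homogeneous one without leaving the kernel of `f`.
    let pr (g : γ.G) (v : (X.tensor Y).Term j) : (X.tensor Y).Term j :=
      fun b => (gr γ).proj (g - (X.tensor Y).deg γ.α γ.β b.1) (v b)
    have ext_pr (g : γ.G) (v : (X.tensor Y).Term j) : (X.tensor Y).extend j (pr g v) =
        fun b => (gr γ).proj (g - (X.tensor Y).deg γ.α γ.β b) ((X.tensor Y).extend j v b) := by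
      ext b
      simp only [extend, pr]
      split_ifs <;> simp
    have D_pr (v : (X.tensor Y).Term j) : (X.tensor Y).D j (pr g v) =
        pr (g + (2 • γ.α + γ.β)) ((X.tensor Y).D j v) := by
      rw [← (X.tensor Y).restrict_extend j (pr g v), D_restrict, ext_pr]
      ext ⟨b, hb⟩
      have h1 : (X.tensor Y).D j v ⟨b, hb⟩ =
          (((X.tensor Y).dp + (X.tensor Y).dm) *ᵥ (X.tensor Y).extend j v) b := by
        rw [← extend_D, extend, dif_pos hb]
      change _ = (gr γ).proj _ ((X.tensor Y).D j v ⟨b, hb⟩)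
      rw [h1, MatFac.Homogeneous.proj_mulVec (M := (X.tensor Y).toMatFac)
        (A := (X.tensor Y).dp + (X.tensor Y).dm) fun b a => add_mem (hT b a).1 (hT b a).2]
      rfl
    have pr_x : pr g x = x := by
      ext b
      exact (gr γ).proj_eq _ _ (hx b trivial)
    refine ⟨x - pr g z, ?_, ?_, ?_⟩
    · refine sub_mem hx fun b _ => ?_
      exact (gr γ).proj_mem _ _
    · rw [map_sub, D_pr, hz, ← D_pr, pr_x, sub_self]
    · rw [map_sub, (ker j (pr g z)).2, sub_zero]
      intro b'
      -- Along the basis vector `b'`, elements of degree `g` have degree `g - deg b'` in the first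
      -- factor.
      have := MatFac.IsBoundary.proj (hX γ) (hzb b') (g - Y.deg γ.α γ.β b')
      convert this using 1
      ext b
      refine (congrFun (ext_pr g z) (b, b')).trans ?_
      change (gr γ).proj (g - (X.toMatFac.tensor Y.toMatFac).deg γ.α γ.β (b, b')) _ = _
      rw [MatFac.tensor_deg, sub_sub, add_comm (Y.deg γ.α γ.β b')]
      rfl
  exact DiffComplex.HomologyEquiv.of_map (E := (X.tensor Y).toDiffComplex k) (E' := E) (f := f)
    hD hV h1 h2 (fun i j x hx => by rw [← hP]; exact ⟨x, hx, rfl⟩) h3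

end MFComplex

/-! ### Differentials of tensor products up to signed bijections of bases -/

section KroneckerSum

variable {S : Type u} [CommRing S]

/-- The sign of a unit of `ℤ` in a ring. -/
def unitSign (S : Type u) [CommRing S] (s : ℤˣ) : S := ((s : ℤ) : S)

theorem unitSign_mul (s t : ℤˣ) : unitSign S (s * t) = unitSign S s * unitSign S t := by
  simp [unitSign]

theorem unitSign_mul_self (s : ℤˣ) : unitSign S s * unitSign S s = 1 := by
  rw [← unitSign_mul, Int.units_mul_self]; simp [unitSign]

theorem unitSign_one : unitSign S 1 = 1 := by simp [unitSign]

/-- The matrix of a differential on a tensor product. -/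
def kronSum {B C : Type} [DecidableEq B] [DecidableEq C] (f : B → ℤ) (A : Matrix B B S)
    (A' : Matrix C C S) : Matrix (B × C) (B × C) S :=
  A ⊗ₖ (1 : Matrix C C S) + signMatrix S f ⊗ₖ A'

theorem kronSum_apply {B C : Type} [DecidableEq B] [DecidableEq C] (f : B → ℤ) (A : Matrix B B S)
    (A' : Matrix C C S) (b a : B) (b' a' : C) :
    kronSum f A A' (b, b') (a, a') = (if b' = a' then A b a else 0) +
      if b = a then unitSign S (f b).negOnePow * A' b' a' else 0 := by
  simp only [kronSum, Matrix.add_apply, Matrix.kroneckerMap_apply, Matrix.one_apply, signMatrix,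
    Matrix.diagonal_apply, mul_ite, mul_one, mul_zero, ite_mul, zero_mul, unitSign]

/-- Two matrices agree up to a bijection of the index sets and signs. -/
def SignRel {B C : Type} (e : B ≃ C) (s : B → ℤˣ) (A : Matrix B B S) (A' : Matrix C C S) : Prop :=
  ∀ b a, A' (e b) (e a) = unitSign S (s b) * unitSign S (s a) * A b a

theorem SignRel.one {B : Type} (A : Matrix B B S) : SignRel (Equiv.refl B) 1 A A :=
  fun b a => by simp [unitSign_one]

theorem SignRel.symm {B C : Type} {e : B ≃ C} {s : B → ℤˣ} {A : Matrix B B S} {A' : Matrix C C S}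
    (h : SignRel e s A A') : SignRel e.symm (s ∘ e.symm) A' A := fun b a => by
  have := h (e.symm b) (e.symm a)
  rw [e.apply_symm_apply, e.apply_symm_apply] at this
  rw [this, Function.comp_apply, Function.comp_apply]
  linear_combination (-A (e.symm b) (e.symm a)) * unitSign_mul_self (S := S) (s (e.symm b)) -
    A (e.symm b) (e.symm a) * unitSign S (s (e.symm b)) * unitSign S (s (e.symm b)) *
    unitSign_mul_self (S := S) (s (e.symm a))

theorem SignRel.trans {B C D : Type} {e : B ≃ C} {s : B → ℤˣ} {A : Matrix B B S}
    {A' : Matrix C C S} {A'' : Matrix D D S} {e' : C ≃ D} {s' : C → ℤˣ}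
    (h : SignRel e s A A') (h' : SignRel e' s' A' A'') :
    SignRel (e.trans e') (fun b => s' (e b) * s b) A A'' := fun b a => by
  have := h' (e b) (e a)
  rw [h b a] at this
  rw [Equiv.trans_apply, Equiv.trans_apply, this, unitSign_mul, unitSign_mul]
  ring

theorem SignRel.kronSum {B C B' C' : Type} [DecidableEq B] [DecidableEq C] [DecidableEq B']
    [DecidableEq C'] {e : B ≃ C} {s : B → ℤˣ} {A : Matrix B B S} {A₁ : Matrix C C S}
    {e' : B' ≃ C'} {s' : B' → ℤˣ} {A' : Matrix B' B' S} {A₁' : Matrix C' C' S} {f : B → ℤ}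
    {f₁ : C → ℤ} (hf : ∀ b, f₁ (e b) = f b) (h : SignRel e s A A₁) (h' : SignRel e' s' A' A₁') :
    SignRel (e.prodCongr e') (fun b => s b.1 * s' b.2) (kronSum f A A')
      (kronSum f₁ A₁ A₁') := by
  rintro ⟨b, b'⟩ ⟨a, a'⟩
  have h1 := unitSign_mul_self (S := S) (s b)
  have h2 := unitSign_mul_self (S := S) (s' b')
  simp only [Equiv.prodCongr_apply, Prod.map_apply, kronSum_apply, hf, h b a, h' b' a',
    e.apply_eq_iff_eq, e'.apply_eq_iff_eq, unitSign_mul]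
  by_cases hb : b = a <;> by_cases hb' : b' = a'
  · subst hb hb'
    simp only [if_true]
    linear_combination (-A b b * unitSign S (s b) * unitSign S (s b)) * h2 -
      unitSign S (s' b') * unitSign S (s' b') *
        unitSign S (f b).negOnePow * A' b' b' * h1
  · subst hb
    simp only [if_true, if_neg hb', zero_add]
    linear_combination -unitSign S (s' b') * unitSign S (s' a') *
        unitSign S (f b).negOnePow * A' b' a' * h1
  · subst hb'
    simp only [if_true, if_neg hb, add_zero]
    linear_combination (-A b a * unitSign S (s b) * unitSign S (s a)) * h2
  · simp [hb, hb']

/-- The sign `s` has to change by the parity of the other factor only across nonzero matrix entries,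
so that knowing the degree of a differential is enough to verify the hypotheses. -/
theorem SignRel.kronSum_comm {B C : Type} [DecidableEq B] [DecidableEq C] (s : B × C → ℤˣ)
    (f : B → ℤ) (f' : C → ℤ) (A : Matrix B B S) (A' : Matrix C C S)
    (h : ∀ b a c, A b a ≠ 0 → s (b, c) * s (a, c) = (f' c).negOnePow)
    (h' : ∀ b c c', A' c c' ≠ 0 → s (b, c) * s (b, c') = (f b).negOnePow) :
    SignRel (Equiv.prodComm B C) s (KhovanovRozansky.kronSum f A A')
      (KhovanovRozansky.kronSum f' A' A) := by
  rintro ⟨b, b'⟩ ⟨a, a'⟩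
  simp only [Equiv.prodComm_apply, Prod.swap_prod_mk, kronSum_apply, ← unitSign_mul]
  rw [mul_add, add_comm]
  congr 1
  · split_ifs with hb
    · subst hb
      by_cases hA : A b a = 0
      · simp [hA]
      · rw [h b a b' hA]
    · simp
  · split_ifs with hb
    · subst hb
      by_cases hA : A' b' a' = 0
      · simp [hA]
      · rw [h' b b' a' hA, ← mul_assoc, unitSign_mul_self, one_mul]
    · simp

theorem SignRel.kronSum_assoc {B C D : Type} [DecidableEq B] [DecidableEq C] [DecidableEq D]
    (f : B → ℤ) (f' : C → ℤ) (A : Matrix B B S) (A' : Matrix C C S) (A'' : Matrix D D S) :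
    SignRel (Equiv.prodAssoc B C D) 1
      (KhovanovRozansky.kronSum (fun b => f b.1 + f' b.2)
        (KhovanovRozansky.kronSum f A A') A'')
      (KhovanovRozansky.kronSum f A (KhovanovRozansky.kronSum f' A' A'')) := by
  rintro ⟨⟨b, b'⟩, b''⟩ ⟨⟨a, a'⟩, a''⟩
  simp only [Equiv.prodAssoc_apply, kronSum_apply, Pi.one_apply, unitSign_one, one_mul,
    Prod.mk.injEq, Int.negOnePow_add, unitSign_mul]
  by_cases h : b = a <;> by_cases h' : b' = a' <;> by_cases h'' : b'' = a'' <;>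
    simp [h, h', h''] <;> ring

end KroneckerSum

/-! ### Signed isomorphisms: symmetry and associativity of the tensor product -/

namespace MFComplex

variable {S : Type u} [CommRing S]

/-- An isomorphism of complexes of matrix factorizations that maps basis vectors to basis vectors
up to sign. -/
structure SignedEquiv (X Y : MFComplex S) where
  e : X.B ≃ Y.B
  s : X.B → ℤˣ
  mf : ∀ b, Y.mf (e b) = X.mf b
  q : ∀ b, Y.q (e b) = X.q b
  coh : ∀ b, Y.coh (e b) = X.coh b
  potential : Y.potential = X.potential
  dp : SignRel e s X.dp Y.dp
  dm : SignRel e s X.dm Y.dm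
  dv : SignRel e s X.dv Y.dv

namespace SignedEquiv

/-- The identity. -/
def refl (X : MFComplex S) : SignedEquiv X X :=
  ⟨Equiv.refl _, 1, fun _ => rfl, fun _ => rfl, fun _ => rfl, rfl, SignRel.one _, SignRel.one _,
    SignRel.one _⟩

/-- The inverse. -/
def symm {X Y : MFComplex S} (h : SignedEquiv X Y) : SignedEquiv Y X where
  e := h.e.symm
  s := h.s ∘ h.e.symm
  mf b := by rw [← h.mf, h.e.apply_symm_apply]
  q b := by rw [← h.q, h.e.apply_symm_apply]
  coh b := by rw [← h.coh, h.e.apply_symm_apply]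
  potential := h.potential.symm
  dp := h.dp.symm
  dm := h.dm.symm
  dv := h.dv.symm

/-- The composition. -/
def trans {X Y Z : MFComplex S} (h : SignedEquiv X Y) (h' : SignedEquiv Y Z) :
    SignedEquiv X Z where
  e := h.e.trans h'.e
  s b := h'.s (h.e b) * h.s b
  mf b := (h'.mf _).trans (h.mf b)
  q b := (h'.q _).trans (h.q b)
  coh b := (h'.coh _).trans (h.coh b)
  potential := h'.potential.trans h.potential
  dp := h.dp.trans h'.dp
  dm := h.dm.trans h'.dm
  dv := h.dv.trans h'.dv

/-- The tensor product. -/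
def tensor {X X' Y Y' : MFComplex S} (h : SignedEquiv X X') (h' : SignedEquiv Y Y') :
    SignedEquiv (X.tensor Y) (X'.tensor Y') where
  e := h.e.prodCongr h'.e
  s b := h.s b.1 * h'.s b.2
  mf b := congrArg₂ (· + ·) (h.mf b.1) (h'.mf b.2)
  q b := congrArg₂ (· + ·) (h.q b.1) (h'.q b.2)
  coh b := congrArg₂ (· + ·) (h.coh b.1) (h'.coh b.2)
  potential := congrArg₂ (· + ·) h.potential h'.potential
  dp := SignRel.kronSum h.mf h.dp h'.dp
  dm := SignRel.kronSum h.mf h.dm h'.dm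
  dv := SignRel.kronSum h.coh h.dv h'.dv

/-- The symmetry of the tensor product. -/
def tensorComm (X Y : MFComplex S) : SignedEquiv (X.tensor Y) (Y.tensor X) where
  e := Equiv.prodComm X.B Y.B
  -- The product of two independent Koszul signs: `dp` and `dm` carry the parity of the matrix
  -- factorization degree, and `dv` that of the cohomological degree.
  s b := (X.mf b.1 * Y.mf b.2).negOnePow * (X.coh b.1 * Y.coh b.2).negOnePow
  mf _ := add_comm _ _
  q _ := add_comm _ _
  coh _ := add_comm _ _
  potential := add_comm _ _
  dp := by
    apply SignRel.kronSum_comm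
    · intro b a c h
      rw [← Int.negOnePow_add, ← Int.negOnePow_add, ← Int.negOnePow_add,
        not_imp_comm.1 (X.dp_deg b a) h, not_imp_comm.1 (X.dp_coh b a) h, Int.negOnePow_eq_iff]
      exact ⟨X.mf a * Y.mf c + X.coh a * Y.coh c, by ring⟩
    · intro b c c' h
      rw [← Int.negOnePow_add, ← Int.negOnePow_add, ← Int.negOnePow_add,
        not_imp_comm.1 (Y.dp_deg c c') h, not_imp_comm.1 (Y.dp_coh c c') h, Int.negOnePow_eq_iff]
      exact ⟨X.mf b * Y.mf c' + X.coh b * Y.coh c', by ring⟩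
  dm := by
    apply SignRel.kronSum_comm
    · intro b a c h
      rw [← Int.negOnePow_add, ← Int.negOnePow_add, ← Int.negOnePow_add,
        not_imp_comm.1 (X.dm_deg b a) h, not_imp_comm.1 (X.dm_coh b a) h, Int.negOnePow_eq_iff]
      exact ⟨X.mf a * Y.mf c + X.coh a * Y.coh c - Y.mf c, by ring⟩
    · intro b c c' h
      rw [← Int.negOnePow_add, ← Int.negOnePow_add, ← Int.negOnePow_add,
        not_imp_comm.1 (Y.dm_deg c c') h, not_imp_comm.1 (Y.dm_coh c c') h, Int.negOnePow_eq_iff]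
      exact ⟨X.mf b * Y.mf c' + X.coh b * Y.coh c' - X.mf b, by ring⟩
  dv := by
    apply SignRel.kronSum_comm
    · intro b a c h
      rw [← Int.negOnePow_add, ← Int.negOnePow_add, ← Int.negOnePow_add,
        not_imp_comm.1 (X.dv_mf b a) h, not_imp_comm.1 (X.dv_coh b a) h, Int.negOnePow_eq_iff]
      exact ⟨X.mf a * Y.mf c + X.coh a * Y.coh c, by ring⟩
    · intro b c c' h
      rw [← Int.negOnePow_add, ← Int.negOnePow_add, ← Int.negOnePow_add,
        not_imp_comm.1 (Y.dv_mf c c') h, not_imp_comm.1 (Y.dv_coh c c') h, Int.negOnePow_eq_iff]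
      exact ⟨X.mf b * Y.mf c' + X.coh b * Y.coh c', by ring⟩

/-- The associativity of the tensor product. -/
def tensorAssoc (X Y Z : MFComplex S) :
    SignedEquiv ((X.tensor Y).tensor Z) (X.tensor (Y.tensor Z)) where
  e := Equiv.prodAssoc X.B Y.B Z.B
  s := 1
  mf _ := (add_assoc _ _ _).symm
  q _ := (add_assoc _ _ _).symm
  coh _ := (add_assoc _ _ _).symm
  potential := (add_assoc _ _ _).symm
  dp := SignRel.kronSum_assoc X.mf Y.mf X.dp Y.dp Z.dp
  dm := SignRel.kronSum_assoc X.mf Y.mf X.dm Y.dm Z.dm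
  dv := SignRel.kronSum_assoc X.coh Y.coh X.dv Y.dv Z.dv

theorem signRel_unit_kronSum {C : Type} [DecidableEq C] (A : Matrix C C S) :
    SignRel (Equiv.punitProd C) 1 (kronSum (fun _ : Unit => 0) (0 : Matrix Unit Unit S) A) A := by
  rintro ⟨⟨⟩, b⟩ ⟨⟨⟩, a⟩
  simp [kronSum_apply, unitSign_one]

/-- The left unit of the tensor product. -/
def unitTensor (X : MFComplex S) : SignedEquiv (MFComplex.unit.tensor X) X where
  e := Equiv.punitProd X.B
  s := 1
  mf _ := (zero_add _).symm
  q _ := (zero_add _).symm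
  coh _ := (zero_add _).symm
  potential := (zero_add _).symm
  dp := signRel_unit_kronSum X.dp
  dm := signRel_unit_kronSum X.dm
  dv := signRel_unit_kronSum X.dv

/-- The tensor product of two complexes concentrated in degree `0`. -/
def singleTensor (M N : MatFac S) :
    SignedEquiv (single (M.tensor N)) ((single M).tensor (single N)) where
  e := Equiv.refl _
  s := 1
  mf _ := rfl
  q _ := rfl
  coh _ := rfl
  potential := rfl
  dp := SignRel.one (kronSum M.mf M.dp N.dp)
  dm := SignRel.one (kronSum M.mf M.dm N.dm)
  dv := by
    have : SignRel (Equiv.refl (M.B × N.B)) 1 0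
        (kronSum (fun _ => 0) (0 : Matrix M.B M.B S) (0 : Matrix N.B N.B S)) := by
      rintro ⟨b, b'⟩ ⟨a, a'⟩
      simp [kronSum_apply]
    exact this

end SignedEquiv

/-- The tensor product of a list. -/
def tensorList (l : List (MFComplex S)) : MFComplex S := l.foldr MFComplex.tensor MFComplex.unit

/-- Permutations are generated by adjacent swaps, each handled by symmetry and associativity. This
frees every later argument from the order of the factors in `KR`. -/
theorem SignedEquiv.tensorList_perm {l l' : List (MFComplex S)} (h : l.Perm l') :
    Nonempty (SignedEquiv (tensorList l) (tensorList l')) := by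
  induction h with
  | nil => exact ⟨refl _⟩
  | cons x _ ih => exact ih.map fun h => (refl x).tensor h
  | swap x y l =>
    exact ⟨(tensorAssoc y x _).symm.trans
      (((tensorComm y x).tensor (refl (tensorList l))).trans (tensorAssoc x y _))⟩
  | trans _ _ h h' => exact h.elim fun h => h'.map fun h' => h.trans h'

/-- The tensor product of an appended list. -/
def SignedEquiv.tensorListAppend (l l' : List (MFComplex S)) :
    SignedEquiv (tensorList (l ++ l')) ((tensorList l).tensor (tensorList l')) :=
  match l with
  | [] => (unitTensor _).symm
  | x :: l => ((refl x).tensor (tensorListAppend l l')).trans (tensorAssoc _ _ _).symm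

/-! ### Base change -/

section Map

variable {S' : Type u} [CommRing S'] (φ : S →+* S')

/-- Base change of a complex of matrix factorizations along a ring homomorphism. -/
def map (X : MFComplex S) : MFComplex S' where
  B := X.B
  mf := X.mf
  q := X.q
  potential := φ X.potential
  dp := X.dp.map φ
  dm := X.dm.map φ
  dp_deg b a h := by rw [Matrix.map_apply, X.dp_deg b a h, map_zero]
  dm_deg b a h := by rw [Matrix.map_apply, X.dm_deg b a h, map_zero]
  sq := by
    have := congrArg (fun A : Matrix X.B X.B S => A.map φ) X.sq
    simp only [Matrix.map_mul, Matrix.map_add φ (map_add φ)] at this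
    rw [this]
    ext b a
    simp only [Matrix.map_apply, Matrix.smul_apply, smul_eq_mul, map_mul, Matrix.one_apply]
    split_ifs <;> simp
  coh := X.coh
  dv := X.dv.map φ
  dp_coh b a h := by rw [Matrix.map_apply, X.dp_coh b a h, map_zero]
  dm_coh b a h := by rw [Matrix.map_apply, X.dm_coh b a h, map_zero]
  dv_mf b a h := by rw [Matrix.map_apply, X.dv_mf b a h, map_zero]
  dv_coh b a h := by rw [Matrix.map_apply, X.dv_coh b a h, map_zero]
  dv_sq := by rw [← Matrix.map_mul, X.dv_sq, Matrix.map_zero _ (map_zero φ)]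
  dv_dp := by rw [← Matrix.map_mul, X.dv_dp, Matrix.map_mul]
  dv_dm := by rw [← Matrix.map_mul, X.dv_dm, Matrix.map_mul]

namespace SignedEquiv

theorem map_unitSign (s : ℤˣ) : φ (unitSign S s) = unitSign S' s := by simp [unitSign]

/-- Base change of an isomorphism. -/
def map {X Y : MFComplex S} (h : SignedEquiv X Y) : SignedEquiv (X.map φ) (Y.map φ) where
  e := h.e
  s := h.s
  mf := h.mf
  q := h.q
  coh := h.coh
  potential := congrArg φ h.potential
  dp b a := (congrArg φ (h.dp b a)).trans (by rw [map_mul, map_mul, map_unitSign, map_unitSign]; rfl)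
  dm b a := (congrArg φ (h.dm b a)).trans (by rw [map_mul, map_mul, map_unitSign, map_unitSign]; rfl)
  dv b a := (congrArg φ (h.dv b a)).trans (by rw [map_mul, map_mul, map_unitSign, map_unitSign]; rfl)

theorem signRel_map_kronSum {B C : Type} [DecidableEq B] [DecidableEq C] (f : B → ℤ)
    (A : Matrix B B S) (A' : Matrix C C S) :
    SignRel (Equiv.refl _) 1 ((kronSum f A A').map φ) (kronSum f (A.map φ) (A'.map φ)) := by
  rintro ⟨b, b'⟩ ⟨a, a'⟩
  simp only [Equiv.refl_apply, Matrix.map_apply, kronSum_apply, Pi.one_apply, unitSign_one, one_mul,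
    map_add, apply_ite φ, map_mul, map_unitSign, map_zero]

/-- Base change commutes with tensor products. -/
def mapTensor (X Y : MFComplex S) :
    SignedEquiv ((X.tensor Y).map φ) ((X.map φ).tensor (Y.map φ)) where
  e := Equiv.refl _
  s := 1
  mf _ := rfl
  q _ := rfl
  coh _ := rfl
  potential := (map_add φ _ _).symm
  dp := signRel_map_kronSum φ X.mf X.dp Y.dp
  dm := signRel_map_kronSum φ X.mf X.dm Y.dm
  dv := signRel_map_kronSum φ X.coh X.dv Y.dv

/-- Base change of the unit. -/
def mapUnit : SignedEquiv ((MFComplex.unit : MFComplex S).map φ) MFComplex.unit where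
  e := Equiv.refl _
  s := 1
  mf _ := rfl
  q _ := rfl
  coh _ := rfl
  potential := (map_zero φ).symm
  dp _ _ := (mul_zero _).symm.trans (congrArg _ (map_zero φ).symm)
  dm _ _ := (mul_zero _).symm.trans (congrArg _ (map_zero φ).symm)
  dv _ _ := (mul_zero _).symm.trans (congrArg _ (map_zero φ).symm)

theorem map_tensorList {l : List (MFComplex S)} {l' : List (MFComplex S')}
    (h : List.Forall₂ (fun X Y => Nonempty (SignedEquiv (X.map φ) Y)) l l') :
    Nonempty (SignedEquiv ((tensorList l).map φ) (tensorList l')) := by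
  induction h with
  | nil => exact ⟨mapUnit φ⟩
  | cons h _ ih =>
    exact h.elim fun h => ih.map fun h' => (mapTensor φ _ _).trans (h.tensor h')

end SignedEquiv

end Map

/-! ### Transport along signed bijections -/

namespace SignedEquiv

variable {X Y : MFComplex S} (h : SignedEquiv X Y)

/-- Transport of a contraction. -/
def contraction {A : Set S} (c : X.Contraction A) : Y.Contraction A :=
  -- The signed permutation matrix of `h`, followed by its inverse.
  c.conj (Matrix.of fun b a => if h.e a = b then unitSign S (h.s a) else 0)
    (Matrix.of fun b a => if h.e b = a then unitSign S (h.s b) else 0)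
    (by
      ext b a
      obtain ⟨b, rfl⟩ := h.e.surjective b
      simp only [Matrix.mul_apply, Matrix.of_apply, ite_mul, zero_mul, h.e.apply_eq_iff_eq,
        Finset.sum_ite_eq', Finset.mem_univ, if_true, Matrix.one_apply]
      split_ifs <;> simp [unitSign_mul_self])
    (by
      ext b a
      obtain ⟨b, rfl⟩ := h.e.surjective b
      simp only [Matrix.mul_apply, Matrix.of_apply, ite_mul, zero_mul, h.e.apply_eq_iff_eq,
        Finset.sum_ite_eq', Finset.mem_univ, if_true, mul_ite, mul_zero, Finset.sum_ite_eq, h.dp b a]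
      linear_combination (-unitSign S (h.s b) * X.dp b a) * unitSign_mul_self (S := S) (h.s a))
    (by
      intro b a hab
      exact if_neg fun hb => hab (by rw [← hb, h.mf]))
    (by
      intro b a hab
      exact if_neg fun hb => hab (by rw [← hb, h.mf]))
    (by
      ext b a
      obtain ⟨a, rfl⟩ := h.e.surjective a
      simp only [Matrix.mul_apply, Matrix.of_apply, ite_mul, zero_mul, h.e.apply_eq_iff_eq,
        Finset.sum_ite_eq', Finset.mem_univ, if_true, mul_ite, mul_zero, Finset.sum_ite_eq, h.dp b a]
      linear_combination (unitSign S (h.s a) * X.dp b a) * unitSign_mul_self (S := S) (h.s b))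
    (fun b => by
      obtain ⟨b, rfl⟩ := h.e.surjective b
      rw [h.mf]
      exact c.nonpos b)

/-- The map of terms. -/
def term (k : Type u) [CommRing k] [Algebra k S] (j : ℤ) : X.Term j →ₗ[k] Y.Term j where
  toFun x b := unitSign S (h.s (h.e.symm b.1)) * x ⟨h.e.symm b.1, by
    rw [← h.coh, h.e.apply_symm_apply]; exact b.2⟩
  map_add' x y := by ext b; exact mul_add _ _ _
  map_smul' a x := by ext b; exact mul_smul_comm _ _ _

/-- The bijection of the basis vectors of cohomological degree `j`. -/
def subtypeEquiv (j : ℤ) : {b // X.coh b = j} ≃ {b // Y.coh b = j} :=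
  h.e.subtypeEquiv fun b => by rw [h.coh]

theorem term_blockMap (k : Type u) [CommRing k] [Algebra k S] (i j : ℤ) (A : Matrix X.B X.B S)
    (A' : Matrix Y.B Y.B S) (hA : SignRel h.e h.s A A') (x : X.Term i) :
    h.term k j (blockMap A (fun b => X.coh b = i) (fun b => X.coh b = j) x) =
      blockMap A' (fun b => Y.coh b = i) (fun b => Y.coh b = j) (h.term k i x) := by
  ext b
  obtain ⟨⟨b, hb⟩, rfl⟩ := (h.subtypeEquiv j).surjective b
  change unitSign S (h.s (h.e.symm (h.e b))) * ∑ a : {b // X.coh b = i},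
      A (h.e.symm (h.e b)) a.1 * x a =
    ∑ a : {b // Y.coh b = i}, A' (h.e b) a.1 * h.term k i x a
  rw [← (h.subtypeEquiv i).sum_comp, Finset.mul_sum, h.e.symm_apply_apply]
  refine Finset.sum_congr rfl fun a _ => ?_
  have h1 : h.term k i x (h.subtypeEquiv i a) = unitSign S (h.s a.1) * x a := by
    change unitSign S (h.s (h.e.symm (h.e a.1))) * x ⟨h.e.symm (h.e a.1), _⟩ = _
    exact congrArg₂ (fun s y => unitSign S s * y) (congrArg h.s (h.e.symm_apply_apply a.1))
      (congrArg x (Subtype.ext (h.e.symm_apply_apply a.1)))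
  have h2 : A' (h.e b) (h.subtypeEquiv i a).1 = _ := hA b a.1
  rw [h1, h2]
  linear_combination (-unitSign S (h.s b) * A b a.1 * x a) * unitSign_mul_self (S := S) (h.s a.1)

theorem term_symm (k : Type u) [CommRing k] [Algebra k S] (j : ℤ) (y : Y.Term j) :
    h.term k j (h.symm.term k j y) = y := by
  ext ⟨b, hb⟩
  obtain ⟨b, rfl⟩ := h.e.surjective b
  change unitSign S (h.s (h.e.symm (h.e b))) * (unitSign S (h.s (h.e.symm (h.e
    (h.e.symm (h.e b))))) * y ⟨h.e (h.e.symm (h.e b)), _⟩) = _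
  simp only [h.e.symm_apply_apply]
  rw [← mul_assoc, unitSign_mul_self, one_mul]

theorem symm_term (k : Type u) [CommRing k] [Algebra k S] (j : ℤ) (x : X.Term j) :
    h.symm.term k j (h.term k j x) = x := by
  ext ⟨b, hb⟩
  change unitSign S (h.s (h.e.symm (h.e b))) * (unitSign S (h.s (h.e.symm (h.e b))) *
    x ⟨h.e.symm (h.e b), _⟩) = _
  simp only [h.e.symm_apply_apply]
  rw [← mul_assoc, unitSign_mul_self, one_mul]

theorem termPiece_le {k : Type u} [CommRing k] [Algebra k S] {G : Type} [AddCommGroup G]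
    (gr : G → Submodule k S) (α β : G) (j : ℤ) (g : G) (x : X.Term j)
    (hx : x ∈ X.termPiece k gr α β j g) : h.term k j x ∈ Y.termPiece k gr α β j g := by
  rintro ⟨b, hb⟩ -
  obtain ⟨b, rfl⟩ := h.e.surjective b
  change unitSign S (h.s (h.e.symm (h.e b))) * x ⟨h.e.symm (h.e b), _⟩ ∈
    gr (g - (Y.q (h.e b) • α + Y.mf (h.e b) • β))
  have h1 := hx ⟨h.e.symm (h.e b), by rw [h.e.symm_apply_apply, ← h.coh]; exact hb⟩ trivial
  rw [unitSign, ← zsmul_eq_mul]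
  refine zsmul_mem ?_ _
  rw [h.q, h.mf]
  have h2 := h.e.symm_apply_apply b
  simp only at h1
  rw [show X.q b = X.q (h.e.symm (h.e b)) by rw [h2], show X.mf b = X.mf (h.e.symm (h.e b)) by rw [h2]]
  exact h1

/-- The grading group varies with the index `i`, so that one isomorphism serves all gradings
simultaneously. -/
theorem homologyEquiv (h : SignedEquiv X Y) (k : Type u) [CommRing k] [Algebra k S] {I : Type*} {G : I → Type}
    [∀ i, AddCommGroup (G i)] (gr : ∀ i, G i → Submodule k S) (α β g : ∀ i, G i) :
    DiffComplex.HomologyEquiv (X.toDiffComplex k) (Y.toDiffComplex k)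
      (fun i j => X.termPiece k (gr i) (α i) (β i) j (g i))
      (fun i j => Y.termPiece k (gr i) (α i) (β i) j (g i)) := by
  have hD (Z W : MFComplex S) (h : SignedEquiv Z W) (j : ℤ) (x : Z.Term j) :
      h.term k j (Z.D j x) = W.D j (h.term k j x) := by
    refine h.term_blockMap k j j _ _ (fun b a => ?_) x
    rw [Matrix.add_apply, Matrix.add_apply, h.dp, h.dm, mul_add]
  refine DiffComplex.HomologyEquiv.of_map (E := X.toDiffComplex k) (E' := Y.toDiffComplex k)
    (f := h.term k) (hD X Y h) (fun i j x => h.term_blockMap k i j _ _ h.dv x) ?_ ?_ ?_ ?_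
  · intro j y hy
    exact ⟨h.symm.term k j y, (hD _ _ h.symm j y).symm.trans
      ((congrArg (h.symm.term k j) hy).trans (map_zero (h.symm.term k j))), h.term_symm k j y⟩
  · intro j x y _ hxy
    refine ⟨h.symm.term k j y, ?_⟩
    refine (hD _ _ h.symm j y).symm.trans ((congrArg (h.symm.term k j) hxy.symm).trans ?_)
    exact h.symm_term k j x
  · intro i j x hx
    exact h.termPiece_le _ _ _ _ _ x hx
  · intro i j y hyP hy
    exact ⟨h.symm.term k j y, h.symm.termPiece_le _ _ _ _ _ y hyP, (hD _ _ h.symm j y).symm.trans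
      ((congrArg (h.symm.term k j) hy).trans (map_zero (h.symm.term k j))), h.term_symm k j y⟩

end SignedEquiv

end MFComplex

/-! ### The projection of `C ⊗ Z` onto the tensor product of the naive complex with `Z` -/

namespace MFComplex

section Class

variable {S : Type u} [CommRing S] (C : MFComplex S)

/-- The map from a term to the zeroth homology of its positive complex. -/
def toNaive (hC : ∀ b, C.mf b ≤ 0) (j : ℤ) : C.Term j →ₗ[S] C.Naive j :=
  (C.posBoundaries j).mkQ ∘ₗ
    (LinearMap.funLeft S S fun b : {b // C.mf b = 0 ∧ C.coh b = j} =>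
      (⟨b.1, b.2.2⟩ : {b // C.coh b = j})).codRestrict (C.posCycles j) fun v => by
        rw [LinearMap.mem_ker]
        ext b
        have := hC b.1
        have := b.2.1
        omega

variable {C}
variable (hC : ∀ b, C.mf b ≤ 0)

theorem toNaive_surjective (j : ℤ) : Function.Surjective (C.toNaive hC j) := by
  intro y
  induction y using Submodule.Quotient.induction_on with
  | _ y =>
  refine ⟨fun b => if h : C.mf b.1 = 0 then y.1 ⟨b.1, h, b.2⟩ else 0, ?_⟩
  refine congrArg Submodule.Quotient.mk (Subtype.ext ?_)
  ext b
  exact dif_pos b.2.1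

theorem dpMap_apply (j : ℤ) (u : C.B → S) (b : {b // C.mf b = 0 ∧ C.coh b = j}) :
    C.dpMap (-1) 0 j (fun a => u a.1) b = (C.dp *ᵥ u) b.1 := by
  change ∑ a : {b // C.mf b = -1 ∧ C.coh b = j}, C.dp b.1 a.1 * u a.1 = ∑ a, C.dp b.1 a * u a
  rw [← Finset.sum_filter_add_sum_filter_not Finset.univ fun a => C.mf a = -1 ∧ C.coh a = j,
    Finset.sum_subtype (p := fun a => C.mf a = -1 ∧ C.coh a = j)
      (Finset.univ.filter fun a => C.mf a = -1 ∧ C.coh a = j) (by simp)]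
  rw [Finset.sum_eq_zero (s := Finset.univ.filter fun a => ¬ (C.mf a = -1 ∧ C.coh a = j)), add_zero]
  intro a ha
  have ha := (Finset.mem_filter.1 ha).2
  by_cases h1 : C.mf a = -1
  · rw [C.dp_coh b.1 a (by rw [b.2.2]; exact fun h => ha ⟨h1, h.symm⟩), zero_mul]
  · rw [C.dp_deg b.1 a (by rw [b.2.1]; omega), zero_mul]

/-- A primitive may be restricted to degree `-1` and cohomological degree `j`, since `dp` respects
both gradings; so the boundaries defining the naive complex are those of the comparison principle.
-/
theorem toNaive_eq_zero_iff (j : ℤ) (v : C.Term j) :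
    C.toNaive hC j v = 0 ↔ C.IsBoundary (C.extend j v) := by
  refine (Submodule.Quotient.mk_eq_zero _).trans ?_
  constructor
  · rintro ⟨u, hu⟩
    refine ⟨fun b => if h : C.mf b = -1 ∧ C.coh b = j then u ⟨b, h⟩ else 0, fun b hb => ?_⟩
    by_cases h : C.coh b = j
    · rw [← dpMap_apply j _ ⟨b, hb, h⟩, extend, dif_pos h]
      have := congrFun hu ⟨b, hb, h⟩
      refine this.symm.trans ?_
      exact congrArg (fun u => C.dpMap (-1) 0 j u ⟨b, hb, h⟩)
        (funext fun a => (show (if h : C.mf a.1 = -1 ∧ C.coh a.1 = j then u ⟨a.1, h⟩ else 0) = u a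
          from dif_pos a.2).symm)
    · rw [extend, dif_neg h]
      refine (Finset.sum_eq_zero fun a _ => ?_).symm
      change C.dp b a * dite _ _ _ = 0
      split_ifs with ha
      · rw [C.dp_coh b a (by rw [ha.2]; exact h), zero_mul]
      · rw [mul_zero]
  · rintro ⟨u, hu⟩
    refine ⟨fun a => u a.1, ?_⟩
    ext b
    rw [dpMap_apply, ← hu _ b.2.1, extend, dif_pos b.2.2]
    rfl

theorem toNaive_congr (j : ℤ) {v w : C.Term j} (h : ∀ b, C.mf b.1 = 0 → v b = w b) :
    C.toNaive hC j v = C.toNaive hC j w := by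
  refine congrArg Submodule.Quotient.mk (Subtype.ext ?_)
  ext b
  exact h _ b.2.1

theorem toNaive_V (i j : ℤ) (v : C.Term i) :
    C.toNaive hC j (C.V i j v) = C.naiveMap i j (C.toNaive hC i v) := by
  refine congrArg Submodule.Quotient.mk (Subtype.ext ?_)
  ext b
  change ∑ a : {b // C.coh b = i}, C.dv b.1 a.1 * v a =
    ∑ a : {b // C.mf b = 0 ∧ C.coh b = i}, C.dv b.1 a.1 * v ⟨a.1, a.2.2⟩
  rw [← Finset.sum_filter_add_sum_filter_not Finset.univ fun a : {b // C.coh b = i} =>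
    C.mf a.1 = 0]
  rw [Finset.sum_eq_zero (s := Finset.univ.filter fun a : {b // C.coh b = i} => ¬ C.mf a.1 = 0),
    add_zero]
  · refine (Finset.sum_bij (fun (a : {b // C.mf b = 0 ∧ C.coh b = i}) _ =>
      (⟨a.1, a.2.2⟩ : {b // C.coh b = i})) ?_ ?_ ?_ ?_).symm
    · intro a _
      simpa using a.2.1
    · intro a _ a' _ h
      have h' : a.1 = a'.1 := congrArg (fun b : {b // C.coh b = i} => b.1) h
      exact Subtype.ext h'
    · intro a ha
      exact ⟨⟨a.1, by simpa using ha, a.2⟩, Finset.mem_univ _, rfl⟩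
    · intro a _
      rfl
  · intro a ha
    rw [C.dv_mf b.1 a.1 (by rw [b.2.1]; exact fun h => (Finset.mem_filter.1 ha).2 h.symm),
      zero_mul]

end Class

section NaiveTensor

variable {k A S : Type u} [CommRing k] [CommRing A] [CommRing S] [Algebra k A] [Algebra k S]
  [Algebra A S] [IsScalarTower k A S] (C : MFComplex S) (Z : MatFac A)

/-- A matrix factorization over `A` as a complex of matrix factorizations over an `A`-algebra. -/
def baseChange (S : Type u) [CommRing S] [Algebra A S] (Z : MatFac A) : MFComplex S :=
  (single Z).map (algebraMap A S)

variable {C Z}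

/-- The component of an element of the tensor product along a basis vector of `Z`. -/
def component (j : ℤ) (z : Z.B) : (C.tensor (baseChange S Z)).Term j →ₗ[S] C.Term j :=
  LinearMap.funLeft S S fun b => ⟨(b.1, z), (add_zero _).trans b.2⟩

theorem extend_component (j : ℤ) (z : Z.B) (x : (C.tensor (baseChange S Z)).Term j) :
    C.extend j (component j z x) = slice x z := by
  ext b
  change (if h : C.coh b = j then x ⟨(b, z), _⟩ else 0) =
    if h : C.coh b + 0 = j then x ⟨(b, z), h⟩ else 0
  by_cases h : C.coh b = j
  · rw [dif_pos h, dif_pos ((add_zero _).trans h)]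
  · rw [dif_neg h, dif_neg (by rwa [add_zero])]

theorem component_V (i j : ℤ) (z : Z.B) (x : (C.tensor (baseChange S Z)).Term i) :
    component j z ((C.tensor (baseChange S Z)).V i j x) = C.V i j (component i z x) := by
  ext b
  have h0 : ((0 : Matrix Z.B Z.B A).map (algebraMap A S)) = 0 := Matrix.map_zero _ (map_zero _)
  change ∑ a : {b : C.B × Z.B // C.coh b.1 + 0 = i},
      kronSum C.coh C.dv ((0 : Matrix Z.B Z.B A).map (algebraMap A S)) (b.1, z) a.1 * x a =
    ∑ a : {b // C.coh b = i}, C.dv b.1 a.1 * x ⟨(a.1, z), _⟩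
  rw [h0]
  refine (Finset.sum_of_injOn (fun a : {b // C.coh b = i} =>
    (⟨(a.1, z), (add_zero _).trans a.2⟩ : {b : C.B × Z.B // C.coh b.1 + 0 = i})) ?_ ?_ ?_ ?_).symm
  · intro a _ a' _ h
    exact Subtype.ext (congrArg (fun b => b.1.1) h)
  · intro a _
    exact Finset.mem_coe.2 (Finset.mem_univ _)
  · rintro ⟨⟨a, z'⟩, ha⟩ _ h
    have : z ≠ z' := by
      rintro rfl
      exact h ⟨⟨a, (add_zero _).symm.trans ha⟩, by simp, rfl⟩
    rw [kronSum_apply, if_neg this]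
    simp
  · intro a _
    rw [kronSum_apply, if_pos rfl, Matrix.zero_apply, mul_zero, ite_self, add_zero]
    rfl

/-- Modulo boundaries only the differential of `Z` survives: the contribution of `dp` of `C` is a
boundary, `dm` could reach degree `0` only from degree `1`, and the Koszul sign is trivial in degree
`0`. -/
theorem toNaive_component_D (hC : ∀ b, C.mf b ≤ 0) (j : ℤ) (z : Z.B)
    (x : (C.tensor (baseChange S Z)).Term j) :
    C.toNaive hC j (component j z ((C.tensor (baseChange S Z)).D j x)) =
      ∑ z', (Z.dp + Z.dm) z z' • C.toNaive hC j (component j z' x) := by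
  have h1 (b : C.B) (hb : C.coh b = j) : component j z ((C.tensor (baseChange S Z)).D j x) ⟨b, hb⟩ =
      (C.dp *ᵥ slice x z) b + ((C.dm *ᵥ slice x z) b + (((C.mf b).negOnePow : ℤ) : S) *
        ∑ z', algebraMap A S ((Z.dp + Z.dm) z z') * slice x z' b) := by
    have h2 := congrFun ((C.tensor (baseChange S Z)).extend_D j x) (b, z)
    have h3 := congrFun (MatFac.tensor_mulVec C.toMatFac (baseChange S Z).toMatFac
      ((C.tensor (baseChange S Z)).extend j x)) (b, z)
    refine Eq.trans ?_ (h2.trans (h3.trans ?_))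
    · change _ = if h : C.coh b + 0 = j then (C.tensor (baseChange S Z)).D j x ⟨(b, z), h⟩ else 0
      rw [dif_pos ((add_zero _).trans hb)]
      rfl
    · change _ + (_ + _ * ∑ z', (Z.dp.map (algebraMap A S) + Z.dm.map (algebraMap A S)) z z' *
        slice x z' b) = _
      simp only [Matrix.add_apply, Matrix.map_apply, map_add]
      rfl
  have h4 : C.toNaive hC j (component j z ((C.tensor (baseChange S Z)).D j x)) =
      C.toNaive hC j (C.restrict j (C.dp *ᵥ slice x z)) +
      C.toNaive hC j (∑ z', algebraMap A S ((Z.dp + Z.dm) z z') • component j z' x) := by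
    rw [← map_add]
    refine toNaive_congr hC j ?_
    rintro ⟨b, hb⟩ hb0
    have hb0 : C.mf b = 0 := hb0
    have h5 : (C.dm *ᵥ slice x z) b = 0 := by
      refine Finset.sum_eq_zero fun a _ => ?_
      change C.dm b a * _ = 0
      rw [C.dm_deg b a (by have := hC a; omega), zero_mul]
    rw [h1, h5, hb0, zero_add, Int.negOnePow_zero]
    change _ = (C.dp *ᵥ slice x z) b + _
    congr 1
    rw [Finset.sum_apply]
    simp only [Units.val_one, Int.cast_one, one_mul]
    refine Finset.sum_congr rfl fun z' _ => ?_
    change _ = algebraMap A S _ * component j z' x ⟨b, hb⟩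
    rw [← extend_component, extend, dif_pos hb]
  rw [h4, (toNaive_eq_zero_iff hC j _).2, zero_add, map_sum]
  · refine Finset.sum_congr rfl fun z' _ => ?_
    rw [map_smul, algebraMap_smul]
  · refine ⟨fun b => if C.coh b = j then slice x z b else 0, fun b hb => ?_⟩
    change _ = ∑ a, C.dp b a * if C.coh a = j then slice x z a else 0
    rw [extend]
    split_ifs with h
    · refine Finset.sum_congr rfl fun a _ => ?_
      change C.dp b a * slice x z a = _
      split_ifs with ha
      · rfl
      · rw [C.dp_coh b a (by rw [h]; exact Ne.symm ha), zero_mul, zero_mul]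
    · refine (Finset.sum_eq_zero fun a _ => ?_).symm
      split_ifs with ha
      · rw [C.dp_coh b a (by rw [ha]; exact h), zero_mul]
      · rw [mul_zero]

/-- The projection of the tensor product of `C` and `Z` onto the tensor product of the zeroth
homology of the positive complex of `C` and `Z`. -/
def toNaiveTensor (k : Type u) [CommRing k] [Algebra k A] [Algebra k S] [IsScalarTower k A S]
    (hC : ∀ b, C.mf b ≤ 0) (j : ℤ) :
    (C.tensor (baseChange S Z)).Term j →ₗ[k] (C.naiveTensor k A Z).M j where
  toFun x := (TensorProduct.piScalarRight A A (C.Naive j) Z.B).symm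
    fun z => C.toNaive hC j (component j z x)
  map_add' x y := by
    simp only [map_add]
    exact map_add (TensorProduct.piScalarRight A A (C.Naive j) Z.B).symm _ _
  map_smul' a x := by
    have : (fun z => C.toNaive hC j (component j z (a • x))) =
        algebraMap k A a • fun z => C.toNaive hC j (component j z x) := by
      ext z
      rw [Pi.smul_apply, algebraMap_smul, LinearMap.map_smul_of_tower, LinearMap.map_smul_of_tower]
    rw [this, map_smul, algebraMap_smul]
    rfl

theorem piScalarRight_toNaiveTensor (hC : ∀ b, C.mf b ≤ 0) (j : ℤ)
    (x : (C.tensor (baseChange S Z)).Term j) (z : Z.B) :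
    TensorProduct.piScalarRight A A (C.Naive j) Z.B (toNaiveTensor k hC j x) z =
      C.toNaive hC j (component j z x) :=
  congrFun (LinearEquiv.apply_symm_apply _ _) z

theorem piScalarRight_lTensor {N : Type u} [AddCommGroup N] [Module A N] (Q : Matrix Z.B Z.B A)
    (y : N ⊗[A] (Z.B → A)) (z : Z.B) :
    TensorProduct.piScalarRight A A N Z.B (Q.mulVecLin.lTensor N y) z =
      ∑ z', Q z z' • TensorProduct.piScalarRight A A N Z.B y z' := by
  induction y with
  | zero => simp
  | add y y' h h' => simp only [map_add, Pi.add_apply, h, h', smul_add, Finset.sum_add_distrib]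
  | tmul m w =>
    simp only [LinearMap.lTensor_tmul, TensorProduct.piScalarRight_apply,
      TensorProduct.piScalarRightHom_tmul, Matrix.mulVecLin_apply, Matrix.mulVec, dotProduct,
      Finset.sum_smul, mul_smul]

theorem piScalarRight_rTensor {N N' : Type u} [AddCommGroup N] [Module A N] [AddCommGroup N']
    [Module A N'] (g : N →ₗ[A] N') (y : N ⊗[A] (Z.B → A)) (z : Z.B) :
    TensorProduct.piScalarRight A A N' Z.B (g.rTensor (Z.B → A) y) z =
      g (TensorProduct.piScalarRight A A N Z.B y z) := by
  induction y with
  | zero => simp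
  | add y y' h h' => simp only [map_add, Pi.add_apply, h, h']
  | tmul m w =>
    simp only [LinearMap.rTensor_tmul, TensorProduct.piScalarRight_apply,
      TensorProduct.piScalarRightHom_tmul, map_smul]

variable {p : Polynomial k}

/-- An element splits along the basis of `Z` into homogeneous pure tensors, the class along `z`
having degree `g - deg z`. Conversely, a pure tensor of a class and `w` lifts to a representative
multiplied by the coordinates of `w` and extended by zero outside degree `0`. -/
theorem map_toNaiveTensor_termPiece (hC : ∀ b, C.mf b ≤ 0) {G : Type} [AddCommGroup G]
    (gr : ScalarGrading k S G) (grA : ScalarGrading k A G)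
    (hgr : ∀ g, ∀ a ∈ grA.piece g, algebraMap A S a ∈ gr.piece g) (α β : G) (j : ℤ) (g : G) :
    ((C.tensor (baseChange S Z)).termPiece k gr.piece α β j g).map (toNaiveTensor k hC j) =
      C.naiveTensorPiece k A Z gr.piece grA.piece α β j g := by
  apply le_antisymm
  · rintro _ ⟨x, hx, rfl⟩
    have : toNaiveTensor k hC j x = ∑ z, C.toNaive hC j (component j z x) ⊗ₜ[A] Pi.single z 1 := by
      apply (TensorProduct.piScalarRight A A (C.Naive j) Z.B).injective
      ext z
      rw [piScalarRight_toNaiveTensor, map_sum, Finset.sum_apply]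
      simp only [TensorProduct.piScalarRight_apply, TensorProduct.piScalarRightHom_tmul,
        Pi.single_apply, ite_smul, one_smul, zero_smul, Finset.sum_ite_eq, Finset.mem_univ, if_true]
    rw [this]
    refine Submodule.sum_mem _ fun z _ => Submodule.subset_span ?_
    refine ⟨g - Z.deg α β z, _, ⟨⟨fun b => component j z x ⟨b.1, b.2.2⟩, ?_⟩, ?_, rfl⟩,
      Pi.single z 1, ?_, rfl⟩
    · rw [LinearMap.mem_ker]
      ext b
      have := hC b.1
      have := b.2.1
      omega
    · rintro b -
      have h1 : x ⟨(b.1, z), (add_zero _).trans b.2.2⟩ ∈ gr.piece (g -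
          (C.toMatFac.tensor (baseChange S Z).toMatFac).deg α β (b.1, z)) :=
        hx ⟨(b.1, z), (add_zero _).trans b.2.2⟩ trivial
      rw [MatFac.tensor_deg, add_comm, ← sub_sub] at h1
      exact h1
    · rintro z' -
      rw [sub_sub_cancel]
      by_cases h : z' = z
      · subst h
        rw [Pi.single_eq_same]
        change (1 : A) ∈ grA.piece (Z.deg α β z' - Z.deg α β z')
        rw [sub_self]
        exact grA.one_mem
      · rw [Pi.single_eq_of_ne h]
        exact Submodule.zero_mem _
  · refine Submodule.span_le.2 ?_
    rintro _ ⟨h, _, ⟨v, hv, rfl⟩, w, hw, rfl⟩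
    let x : (C.tensor (baseChange S Z)).Term j := fun b =>
      if hb : C.mf b.1.1 = 0 then algebraMap A S (w b.1.2) *
        v.1 ⟨b.1.1, hb, (add_zero _).symm.trans b.2⟩ else 0
    refine ⟨x, ?_, ?_⟩
    · rintro ⟨⟨b, z⟩, hb⟩ -
      change (if hb : C.mf b = 0 then _ else _) ∈ gr.piece (g -
        (C.toMatFac.tensor (baseChange S Z).toMatFac).deg α β (b, z))
      split_ifs with h0
      · have h1 := gr.mul_mem (hgr _ _ (hw z trivial))
          (hv ⟨b, h0, (add_zero _).symm.trans hb⟩ trivial)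
        rw [MatFac.tensor_deg]
        refine Eq.mp (congrArg (_ ∈ gr.piece ·) ?_) h1
        change g - h - Z.deg α β z + (h - C.deg α β b) = g - (C.deg α β b + Z.deg α β z)
        abel
      · exact Submodule.zero_mem _
    · apply (TensorProduct.piScalarRight A A (C.Naive j) Z.B).injective
      ext z
      rw [piScalarRight_toNaiveTensor]
      simp only [TensorProduct.piScalarRight_apply, TensorProduct.piScalarRightHom_tmul]
      rw [← algebraMap_smul S (w z)]
      refine congrArg Submodule.Quotient.mk (Subtype.ext ?_)
      ext b
      exact dif_pos b.2.1

/-- The tensor product of a contractible complex `C` with `Z` computes the homology of the tensor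
product of the naive complex of `C` with `Z`. -/
theorem naiveTensor_homologyEquiv {W : Set S} (c : C.Contraction W)
    (hpot : (C.tensor (baseChange S Z)).potential = 0)
    (gr : ∀ γ : GradingDatum p, ScalarGrading k S γ.G)
    (grA : ∀ γ : GradingDatum p, ScalarGrading k A γ.G)
    (hgr : ∀ γ g, ∀ a ∈ (grA γ).piece g, algebraMap A S a ∈ (gr γ).piece g)
    (hC : ∀ γ, C.Homogeneous (gr γ) γ.α γ.β)
    (hZ : ∀ γ, (baseChange S Z).Homogeneous (gr γ) γ.α γ.β) :
    DiffComplex.HomologyEquiv ((C.tensor (baseChange S Z)).toDiffComplex k) (C.naiveTensor k A Z)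
      (fun (i : Σ γ : GradingDatum p, γ.G) j =>
        (C.tensor (baseChange S Z)).termPiece k (gr i.1).piece i.1.α i.1.β j i.2)
      (fun i j => C.naiveTensorPiece k A Z (gr i.1).piece (grA i.1).piece i.1.α i.1.β j i.2) := by
  refine homologyEquiv_of_contraction c hpot (C.naiveTensor k A Z) (toNaiveTensor k c.nonpos)
    ?_ ?_ ?_ ?_ gr hC hZ _ fun i j =>
      map_toNaiveTensor_termPiece c.nonpos (gr i.1) (grA i.1) (hgr i.1) _ _ _ _
  · intro j x
    apply (TensorProduct.piScalarRight A A (C.Naive j) Z.B).injective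
    ext z
    refine Eq.trans ?_ (piScalarRight_lTensor (Z.dp + Z.dm) (toNaiveTensor k c.nonpos j x) z).symm
    rw [piScalarRight_toNaiveTensor, toNaive_component_D]
    refine Finset.sum_congr rfl fun z' _ => ?_
    rw [piScalarRight_toNaiveTensor]
  · intro i j x
    apply (TensorProduct.piScalarRight A A (C.Naive j) Z.B).injective
    ext z
    refine Eq.trans ?_ (piScalarRight_rTensor ((C.naiveMap i j).restrictScalars A)
      (toNaiveTensor k c.nonpos i x) z).symm
    rw [piScalarRight_toNaiveTensor, piScalarRight_toNaiveTensor, component_V, toNaive_V]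
    rfl
  · intro j y
    choose v hv using fun z => toNaive_surjective c.nonpos j
      (TensorProduct.piScalarRight A A (C.Naive j) Z.B y z)
    refine ⟨fun b => v b.1.2 ⟨b.1.1, (add_zero _).symm.trans b.2⟩, ?_⟩
    apply (TensorProduct.piScalarRight A A (C.Naive j) Z.B).injective
    ext z
    rw [piScalarRight_toNaiveTensor]
    exact hv z
  · intro j x
    refine ((TensorProduct.piScalarRight A A (C.Naive j) Z.B).map_eq_zero_iff
      (x := toNaiveTensor k c.nonpos j x)).symm.trans (funext_iff.trans ?_)
    refine forall_congr' fun z => ?_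
    rw [piScalarRight_toNaiveTensor, ← extend_component]
    exact toNaive_eq_zero_iff c.nonpos j _

end NaiveTensor

end MFComplex

/-! ### Elimination of variables by a Koszul resolution -/

namespace MFComplex

section Quotient

variable {k S S' : Type u} [CommRing k] [CommRing S] [CommRing S'] [Algebra k S] [Algebra k S']
  (φ : S →ₐ[k] S') {E : MatFac S} {Y : MFComplex S} (bot : E.B)

/-- The projection of the tensor product of `E` and `Y` onto the base change of `Y` given by the
basis vector `bot` of `E`. -/
def toQuotient (j : ℤ) : ((single E).tensor Y).Term j →ₗ[k] (Y.map φ.toRingHom).Term j where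
  toFun x b := φ (x ⟨(bot, b.1), (zero_add _).trans b.2⟩)
  map_add' x y := by ext b; exact map_add φ _ _
  map_smul' a x := by ext b; exact map_smul φ a _

variable {φ bot}

theorem toQuotient_eq_restrict (j : ℤ) (x : ((single E).tensor Y).Term j) :
    toQuotient φ bot j x =
      (Y.map φ.toRingHom).restrict j (fun b => φ (((single E).tensor Y).extend j x (bot, b))) := by
  ext ⟨b, hb⟩
  have hb' : 0 + Y.coh b = j := (zero_add _).trans hb
  exact congrArg φ (show (if h : 0 + Y.coh b = j then x ⟨(bot, b), h⟩ else 0) = _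
    from dif_pos hb').symm

/-- In the row of `bot` the image of `dp` dies under `φ`, `dm` has no source in degree `1`, and the
sign is `1`; the differential of `Y` is all that is left. -/
theorem toQuotient_D (hE : ∀ b, E.mf b ≤ 0) (hbot : E.mf bot = 0)
    (hker : ∀ u, φ ((E.dp *ᵥ u) bot) = 0) (j : ℤ) (x : ((single E).tensor Y).Term j) :
    toQuotient φ bot j (((single E).tensor Y).D j x) =
      (Y.map φ.toRingHom).D j (toQuotient φ bot j x) := by
  rw [toQuotient_eq_restrict, toQuotient_eq_restrict, D_restrict, extend_D]
  congr 1
  ext b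
  refine (congrArg φ (congrFun (MatFac.tensor_mulVec E Y.toMatFac _) (bot, b))).trans ?_
  change φ ((E.dp *ᵥ fun a => ((single E).tensor Y).extend j x (a, b)) bot +
    (∑ a, E.dm bot a * ((single E).tensor Y).extend j x (a, b) +
      (((E.mf bot).negOnePow : ℤ) : S) *
        ∑ a, (Y.dp + Y.dm) b a * ((single E).tensor Y).extend j x (bot, a))) =
    ∑ a, (Y.dp.map φ + Y.dm.map φ) b a * φ (((single E).tensor Y).extend j x (bot, a))
  rw [map_add, hker, zero_add, Finset.sum_eq_zero, zero_add, hbot, Int.negOnePow_zero,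
    Units.val_one, Int.cast_one, one_mul, map_sum]
  · refine Finset.sum_congr rfl fun a _ => ?_
    rw [map_mul]
    exact congrArg (· * _) (map_add φ (Y.dp b a) (Y.dm b a))
  · intro a _
    rw [E.dm_deg bot a (by have := hE a; omega), zero_mul]

theorem toQuotient_V (i j : ℤ) (x : ((single E).tensor Y).Term i) :
    toQuotient φ bot j (((single E).tensor Y).V i j x) =
      (Y.map φ.toRingHom).V i j (toQuotient φ bot i x) := by
  ext b
  have key : ∑ a : {b : E.B × Y.B // 0 + Y.coh b.2 = i},
      kronSum (fun _ : E.B => 0) 0 Y.dv (bot, b.1) a.1 * x a =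
    ∑ a : {b // Y.coh b = i}, Y.dv b.1 a.1 * x ⟨(bot, a.1), (zero_add _).trans a.2⟩ := by
    refine (Finset.sum_of_injOn (fun a : {b // Y.coh b = i} =>
      (⟨(bot, a.1), (zero_add _).trans a.2⟩ : {b : E.B × Y.B // 0 + Y.coh b.2 = i})) ?_ ?_ ?_
        ?_).symm
    · intro a _ a' _ h
      exact Subtype.ext (congrArg (fun b => b.1.2) h)
    · intro a _
      exact Finset.mem_coe.2 (Finset.mem_univ _)
    · rintro ⟨⟨z, a⟩, ha⟩ _ h
      have : bot ≠ z := by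
        rintro rfl
        exact h ⟨⟨a, (zero_add _).symm.trans ha⟩, by simp, rfl⟩
      refine (congrArg (· * _) (kronSum_apply _ _ _ bot z b.1 a)).trans ?_
      rw [if_neg this, Matrix.zero_apply, ite_self, zero_add, zero_mul]
    · intro a _
      refine (congrArg (· * _) ((kronSum_apply _ _ _ bot bot b.1 a.1).trans ?_)).symm
      rw [if_pos rfl, Matrix.zero_apply, ite_self, zero_add, Int.negOnePow_zero,
        unitSign_one, one_mul]
  refine (congrArg φ key).trans ((map_sum φ _ _).trans ?_)
  refine Finset.sum_congr rfl fun a _ => ?_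
  exact map_mul φ _ _

/-- Elimination of variables: if the positive complex of `E` is a contractible resolution of the
quotient `S'` of `S`, then the tensor product with `E` has the homology of the base change
to `S'`. -/
theorem quotient_homologyEquiv {p : Polynomial k} {W : Set S} (c : E.Contraction W)
    (hpot : ((single E).tensor Y).potential = 0) (hbot : ∀ b, E.mf b = 0 ↔ b = bot)
    (hq : E.q bot = 0) (hker : ∀ s, φ s = 0 ↔ ∃ u, s = (E.dp *ᵥ u) bot)
    (hφ : Function.Surjective φ)
    (gr : ∀ γ : GradingDatum p, ScalarGrading k S γ.G)
    (gr' : ∀ γ : GradingDatum p, ScalarGrading k S' γ.G)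
    (hgr : ∀ γ g, ((gr γ).piece g).map φ.toLinearMap = (gr' γ).piece g)
    (hE : ∀ γ, E.Homogeneous (gr γ) γ.α γ.β)
    (hY : ∀ γ, Y.Homogeneous (gr γ) γ.α γ.β) :
    DiffComplex.HomologyEquiv (((single E).tensor Y).toDiffComplex k)
      ((Y.map φ.toRingHom).toDiffComplex k)
      (fun (i : Σ γ : GradingDatum p, γ.G) j =>
        ((single E).tensor Y).termPiece k (gr i.1).piece i.1.α i.1.β j i.2)
      (fun i j => (Y.map φ.toRingHom).termPiece k (gr' i.1).piece i.1.α i.1.β j i.2) := by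
  have h0 : E.mf bot = 0 := (hbot bot).2 rfl
  refine homologyEquiv_of_contraction (X := single E) c hpot _ (toQuotient φ bot)
    (toQuotient_D c.nonpos h0 fun u => (hker _).2 ⟨u, rfl⟩) toQuotient_V ?_ ?_ gr hE hY _ ?_
  · intro j y
    choose s hs using fun b => hφ (y b)
    refine ⟨fun b => s ⟨b.1.2, (zero_add _).symm.trans b.2⟩, ?_⟩
    exact funext hs
  · intro j x
    have hb (v : E.B → S) : E.IsBoundary v ↔ φ (v bot) = 0 := by
      rw [hker]
      constructor
      · rintro ⟨u, hu⟩
        exact ⟨u, hu _ h0⟩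
      · rintro ⟨u, hu⟩
        exact ⟨u, fun b hb => by rw [(hbot b).1 hb, hu]⟩
    refine Iff.trans ?_ (forall_congr' fun b' => hb (slice x b')).symm
    have hx : toQuotient φ bot j x = 0 ↔
        ∀ b : {b // Y.coh b = j}, φ (((single E).tensor Y).extend j x (bot, b.1)) = 0 := by
      rw [toQuotient_eq_restrict]
      exact funext_iff
    refine hx.trans ⟨?_, fun h b => h b.1⟩
    · intro h b'
      by_cases hb' : Y.coh b' = j
      · exact h ⟨b', hb'⟩
      · refine (congrArg φ ?_).trans (map_zero φ)
        exact dif_neg fun h => hb' ((zero_add _).symm.trans h)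
  · rintro ⟨γ, g⟩ j
    have hd (b : Y.B) : (E.tensor Y.toMatFac).deg γ.α γ.β (bot, b) = Y.deg γ.α γ.β b := by
      rw [MatFac.tensor_deg, MatFac.deg, hq, h0, zero_smul, zero_smul, zero_add, zero_add]
    apply le_antisymm
    · rintro _ ⟨x, hx, rfl⟩ b -
      change φ _ ∈ (gr' γ).piece (g - Y.deg γ.α γ.β b.1)
      rw [← hgr]
      refine Eq.mp (congrArg (fun d => _ ∈ ((gr γ).piece (g - d)).map φ.toLinearMap) (hd b.1)) ?_
      exact ⟨_, hx ⟨(bot, b.1), (zero_add _).trans b.2⟩ trivial, rfl⟩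
    · intro y hy
      -- Coordinates are lifted to homogeneous elements of the same degree, which is possible
      -- because `bot` itself has degree zero.
      have (b : {b // Y.coh b = j}) :
          ∃ s ∈ (gr γ).piece (g - (E.tensor Y.toMatFac).deg γ.α γ.β (bot, b.1)), φ s = y b := by
        rw [hd]
        have := hy b trivial
        simp only at this
        rw [← hgr] at this
        exact this
      choose s hs hsy using this
      classical
      refine ⟨fun b => if b.1.1 = bot then s ⟨b.1.2, (zero_add _).symm.trans b.2⟩ else 0, ?_, ?_⟩
      · rintro ⟨⟨a, b⟩, hb⟩ -
        change (if a = bot then _ else _) ∈ (gr γ).piece (g - (E.tensor Y.toMatFac).deg γ.α γ.β (a, b))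
        split_ifs with ha
        · subst ha
          exact hs ⟨b, (zero_add _).symm.trans hb⟩
        · exact Submodule.zero_mem _
      · exact funext fun b => (congrArg φ (if_pos rfl)).trans (hsy b)

end Quotient

/-! ### Tensor products of lists of factors -/

section Lists

variable {S : Type u} [CommRing S]

theorem mem_tensor_dp {X Y : MFComplex S} (R : Subring S) (hX : ∀ b a, X.dp b a ∈ R)
    (hY : ∀ b a, Y.dp b a ∈ R) (b a : X.B × Y.B) : (X.tensor Y).dp b a ∈ R := by
  obtain ⟨b, b'⟩ := b
  obtain ⟨a, a'⟩ := a
  change kronSum X.mf X.dp Y.dp (b, b') (a, a') ∈ R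
  rw [kronSum_apply]
  refine add_mem ?_ ?_
  · split_ifs
    exacts [hX _ _, zero_mem _]
  · split_ifs
    · exact mul_mem (intCast_mem _ _) (hY _ _)
    · exact zero_mem _

theorem mem_tensorList_dp (R : Subring S) (l : List (MFComplex S))
    (hl : ∀ X ∈ l, ∀ b a, X.dp b a ∈ R) : ∀ b a, (tensorList l).dp b a ∈ R := by
  induction l with
  | nil => exact fun b a => zero_mem R
  | cons X l ih =>
    exact mem_tensor_dp (X := X) (Y := tensorList l) R (hl X List.mem_cons_self)
      (ih fun Y hY => hl Y (List.mem_cons_of_mem _ hY))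

/-- A tensor product of complexes with contractible positive complexes is contractible, if the
later factors are linear over scalars that commute with the contractions of the earlier ones. -/
theorem tensorList_contraction (l : List (MFComplex S × Subring S))
    (hl : ∀ X ∈ l, Nonempty (X.1.Contraction (X.2 : Set S)))
    (hp : l.Pairwise fun X Y => ∀ b a, Y.1.dp b a ∈ X.2) :
    Nonempty ((tensorList (l.map Prod.fst)).Contraction ∅) := by
  induction l with
  | nil => exact ⟨MatFac.Contraction.unit _⟩
  | cons X l ih =>
    rw [List.pairwise_cons] at hp
    obtain ⟨c⟩ := hl X List.mem_cons_self
    obtain ⟨c'⟩ := ih (fun Y hY => hl Y (List.mem_cons_of_mem _ hY)) hp.2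
    refine ⟨(c.tensor c' ?_).mono (by simp)⟩
    refine mem_tensorList_dp X.2 _ fun Y hY => ?_
    obtain ⟨Y', hY', rfl⟩ := List.mem_map.1 hY
    exact hp.1 Y' hY'

theorem tensorList_homogeneous {k : Type u} [CommRing k] [Algebra k S] {G : Type} [AddCommGroup G]
    (gr : ScalarGrading k S G) (α β : G) (l : List (MFComplex S))
    (hl : ∀ X ∈ l, X.Homogeneous gr α β) : (tensorList l).Homogeneous gr α β := by
  induction l with
  | nil => exact MatFac.Homogeneous.unit
  | cons X l ih =>
    exact MatFac.Homogeneous.tensor (hl X List.mem_cons_self)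
      (ih fun Y hY => hl Y (List.mem_cons_of_mem _ hY))

/-- The tensor product of a list of matrix factorizations, as a tensor product of complexes
concentrated in degree `0`. -/
def SignedEquiv.singleList (l : List (MatFac S)) :
    SignedEquiv (single (l.foldr MatFac.tensor MatFac.unit)) (tensorList (l.map single)) :=
  match l with
  | [] => refl _
  | M :: l => (singleTensor M _).trans ((refl _).tensor (singleList l))

end Lists

end MFComplex

namespace MatFac

variable {S : Type u} [CommRing S]

/-- The Koszul matrix factorization of a list of pairs with degrees. -/
def koszulList (l : List (S × S × ℤ)) : MatFac S :=
  (l.map fun x => MatFac.koszul x.1 x.2.1 x.2.2).foldr MatFac.tensor MatFac.unit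

/-- The only basis vector of degree `0` is the product of the generators `1`, and the boundaries in
its coordinate are the combinations of the first entries of the pairs. Thus the zeroth homology of
the positive complex is the quotient by the ideal they generate. -/
theorem exists_koszulList_bot (l : List (S × S × ℤ)) :
    ∃ bot : (koszulList l).B, (∀ b, (koszulList l).mf b = 0 ↔ b = bot) ∧
      (koszulList l).q bot = 0 ∧ (∀ b, (koszulList l).mf b ≤ 0) ∧
      ∀ s, (∃ u, s = ((koszulList l).dp *ᵥ u) bot) ↔ s ∈ Ideal.span {x | x ∈ l.map Prod.fst} := by
  induction l with
  | nil =>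
    refine ⟨(), fun b => ⟨fun _ => rfl, fun _ => rfl⟩, rfl, fun _ => le_rfl, fun s => ?_⟩
    have (u : Unit → S) : ((koszulList []).dp *ᵥ u) () = 0 := by
      change ∑ a : Unit, (0 : S) * u a = 0
      simp
    simp only [List.map_nil, List.not_mem_nil, Set.ofPred_false, Ideal.span_empty, Ideal.mem_bot]
    exact ⟨fun ⟨u, hu⟩ => hu.trans (this u), fun hs => ⟨0, hs.trans (this 0).symm⟩⟩
  | cons x l ih =>
    obtain ⟨bot, h1, h2, h3, h4⟩ := ih
    refine ⟨(false, bot), ?_, ?_, ?_, ?_⟩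
    · rintro ⟨b, b'⟩
      change (bif b then -1 else 0) + (koszulList l).mf b' = 0 ↔ _
      cases b
      · rw [cond_false, zero_add]
        exact (h1 b').trans ⟨fun h => by rw [h], fun h => congrArg Prod.snd h⟩
      · have := h3 b'
        rw [cond_true]
        refine ⟨fun h => by omega, fun h => ?_⟩
        exact absurd (congrArg Prod.fst h) (by simp)
    · change 0 + (koszulList l).q bot = 0
      rw [h2, zero_add]
    · rintro ⟨b, b'⟩
      change (bif b then -1 else 0) + (koszulList l).mf b' ≤ 0
      have := h3 b'
      cases b
      · rw [cond_false]; omega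
      · rw [cond_true]; omega
    · intro s
      have e (u : Bool × (koszulList l).B → S) : ((koszulList (x :: l)).dp *ᵥ u) (false, bot) =
          u (true, bot) * x.1 + ((koszulList l).dp *ᵥ fun a => u (false, a)) bot := by
        refine (congrFun (tensor_dp_mulVec (M := MatFac.koszul x.1 x.2.1 x.2.2)
          (N := koszulList l) u) (false, bot)).trans ?_
        change ∑ a : Bool, (MatFac.koszul x.1 x.2.1 x.2.2).dp false a * u (a, bot) +
          (((0 : ℤ).negOnePow : ℤ) : S) * _ = _
        rw [Fintype.sum_bool, Int.negOnePow_zero, Units.val_one, Int.cast_one, one_mul]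
        change x.1 * u (true, bot) + 0 * u (false, bot) + _ = _
        rw [zero_mul, add_zero, mul_comm]
        rfl
      have hset : {y | y ∈ (x :: l).map Prod.fst} = insert x.1 {y | y ∈ l.map Prod.fst} := by
        ext y; simp
      rw [hset, Ideal.mem_span_insert]
      constructor
      · rintro ⟨u, hu⟩
        exact ⟨u (true, bot), _, (h4 _).1 ⟨fun a => u (false, a), rfl⟩, hu.trans (e u)⟩
      · rintro ⟨a, z, hz, hs⟩
        obtain ⟨u, hu⟩ := (h4 z).2 hz
        -- Only the coordinate `(true, bot)` contributes to the multiple of the new entry, so the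
        -- value `a` at the other vectors with first component `true` is immaterial.
        refine ⟨fun b : Bool × (koszulList l).B => if b.1 then a else u b.2, ?_⟩
        exact Eq.trans (by rw [hs, hu]; rfl) (e _).symm

end MatFac

/-! ### Division by linear polynomials -/

section Division

open MvPolynomial

variable {k : Type u} [CommRing k] {τ : Type}

/-- Multiplication by a polynomial without `v` does not change exponents of `v`, hence commutes with
discarding the terms free of `v` and dividing the rest. It is enough to check this on the algebra
generators. -/
theorem divMonomial_mul_of_mem_supported (v : τ) (b : MvPolynomial τ k)
    (hb : b ∈ supported k ({v}ᶜ : Set τ)) (g : MvPolynomial τ k) :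
    (b * g).divMonomial (Finsupp.single v 1) = b * g.divMonomial (Finsupp.single v 1) := by
  classical
  induction hb using Algebra.adjoin_induction generalizing g with
  | mem x hx =>
    obtain ⟨i, hi, rfl⟩ := hx
    have hi : i ≠ v := hi
    ext m
    rw [coeff_divMonomial, coeff_X_mul', coeff_X_mul', coeff_divMonomial]
    have h1 : i ∈ (Finsupp.single v 1 + m).support ↔ i ∈ m.support := by
      rw [Finsupp.mem_support_iff, Finsupp.mem_support_iff, Finsupp.add_apply,
        Finsupp.single_eq_of_ne hi, zero_add]
    simp only [h1]
    split_ifs with h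
    · congr 1
      ext j
      simp only [Finsupp.tsub_apply, Finsupp.add_apply]
      by_cases hj : j = i
      · subst hj
        rw [Finsupp.single_eq_of_ne hi, zero_add, zero_add]
      · rw [Finsupp.single_eq_of_ne hj, Nat.sub_zero, Nat.sub_zero]
    · rfl
  | algebraMap r =>
    ext m
    rw [algebraMap_eq, coeff_divMonomial, coeff_C_mul, coeff_C_mul, coeff_divMonomial]
  | add x y _ _ hx hy => rw [add_mul, add_divMonomial, hx, hy, add_mul]
  | mul x y _ _ hx hy => rw [mul_assoc, hx, hy, mul_assoc]

/-- Multiplication by `X v - a` has an additive left inverse that is linear over the polynomials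
not involving `v`. -/
theorem exists_leftInverse_X_sub (v : τ) (a : MvPolynomial τ k)
    (ha : a ∈ supported k ({v}ᶜ : Set τ)) :
    ∃ q : MvPolynomial τ k →+ MvPolynomial τ k, (∀ g, q ((X v - a) * g) = g) ∧
      ∀ b ∈ supported k ({v}ᶜ : Set τ), ∀ g, q (b * g) = b * q g := by
  classical
  -- The translation `X v ↦ X v + c` fixes polynomials without `v`. The translation by `a` turns `X
  -- v - a` into `X v`, reducing to division by a variable.
  let θ (c : MvPolynomial τ k) : MvPolynomial τ k →ₐ[k] MvPolynomial τ k :=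
    aeval fun i => if i = v then X v + c else X i
  have hθ (c b : MvPolynomial τ k) (hb : b ∈ supported k ({v}ᶜ : Set τ)) : θ c b = b := by
    have : supported k ({v}ᶜ : Set τ) ≤ AlgHom.equalizer (θ c) (AlgHom.id k _) := by
      refine Algebra.adjoin_le ?_
      rintro _ ⟨i, hi, rfl⟩
      have hi : i ≠ v := hi
      change θ c (X i) = X i
      rw [aeval_X, if_neg hi]
    exact this hb
  have hX (c : MvPolynomial τ k) : θ c (X v) = X v + c := by rw [aeval_X, if_pos rfl]
  have hinv (g : MvPolynomial τ k) : θ (-a) (θ a g) = g := by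
    have : (θ (-a)).comp (θ a) = AlgHom.id k _ := by
      ext1 i
      rw [AlgHom.comp_apply, AlgHom.id_apply]
      by_cases hi : i = v
      · subst hi
        rw [hX, map_add, hX, hθ _ _ ha, neg_add_cancel_right]
      · rw [show θ a (X i) = X i by rw [aeval_X, if_neg hi], aeval_X, if_neg hi]
    exact DFunLike.congr_fun this g
  refine ⟨{ toFun := fun g => θ (-a) ((θ a g).divMonomial (Finsupp.single v 1))
            map_zero' := by rw [map_zero, zero_divMonomial, map_zero]
            map_add' := fun x y => by rw [map_add, add_divMonomial, map_add] }, ?_, ?_⟩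
  · intro g
    change θ (-a) ((θ a ((X v - a) * g)).divMonomial (Finsupp.single v 1)) = g
    rw [map_mul, map_sub, hX, hθ _ _ ha, add_sub_cancel_right, X_mul_divMonomial, hinv]
  · intro b hb g
    change θ (-a) ((θ a (b * g)).divMonomial (Finsupp.single v 1)) = b * θ (-a) _
    rw [map_mul, hθ _ _ hb, divMonomial_mul_of_mem_supported v b hb, map_mul, hθ _ _ hb]

/-- The subring of polynomials not involving the variables in `W`. -/
def avoiding (k : Type u) [CommRing k] (W : Set τ) : Subring (MvPolynomial τ k) :=
  (supported k Wᶜ).toSubring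

theorem X_mem_avoiding {W : Set τ} {i : τ} (h : i ∉ W) :
    (X i : MvPolynomial τ k) ∈ avoiding k W :=
  Algebra.subset_adjoin ⟨i, h, rfl⟩

theorem avoiding_anti {W W' : Set τ} (h : W ⊆ W') : avoiding k W' ≤ avoiding k W :=
  supported_mono (Set.compl_subset_compl.2 h)

theorem koszul_contraction (v : τ) (a y : MvPolynomial τ k) (n : ℤ)
    (ha : a ∈ avoiding k ({v} : Set τ)) :
    Nonempty ((MatFac.koszul (X v - a) y n).Contraction (avoiding k ({v} : Set τ))) := by
  obtain ⟨q, hq, hA⟩ := exists_leftInverse_X_sub v a ha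
  exact ⟨MatFac.Contraction.koszul _ _ _ _ q hq hA⟩

/-- Left inverses of the two linear factors compose, and both are linear over the polynomials
without `v`. -/
theorem koszul_mul_contraction (v : τ) (a a' y : MvPolynomial τ k) (n : ℤ)
    (ha : a ∈ avoiding k ({v} : Set τ)) (ha' : a' ∈ avoiding k ({v} : Set τ)) :
    Nonempty ((MatFac.koszul ((X v - a) * (X v - a')) y n).Contraction
      (avoiding k ({v} : Set τ))) := by
  obtain ⟨q, hq, hA⟩ := exists_leftInverse_X_sub v a ha
  obtain ⟨q', hq', hA'⟩ := exists_leftInverse_X_sub v a' ha'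
  refine ⟨MatFac.Contraction.koszul _ _ _ _ (q'.comp q) (fun g => ?_) fun b hb g => ?_⟩
  · rw [mul_assoc, AddMonoidHom.comp_apply, hq, hq']
  · rw [AddMonoidHom.comp_apply, hA b hb, hA' b hb]; rfl

theorem koszul_dp_mem {S : Type u} [CommRing S] (R : Subring S) {x y : S} {n : ℤ} (hx : x ∈ R) :
    ∀ b a, (MatFac.koszul x y n).dp b a ∈ R := by
  rintro (_ | _) (_ | _)
  exacts [zero_mem _, hx, zero_mem _, zero_mem _]

end Division

/-! ### Crossings -/

section Crossing

open MvPolynomial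

variable {k : Type u} [CommRing k] {τ : Type} {i j l m : τ}

/-- The change of basis between the sequences `(x, x')` and `(x, t * x - x')`. -/
def basisChange {S : Type u} [CommRing S] (t : S) : Matrix (Bool × Bool) (Bool × Bool) S :=
  Matrix.of fun b a => match b, a with
    | (false, false), (false, false) => 1
    | (true, false), (true, false) => 1
    | (true, false), (false, true) => t
    | (false, true), (false, true) => -1
    | (true, true), (true, true) => -1
    | _, _ => 0

theorem basisChange_mul_self {S : Type u} [CommRing S] (t : S) :
    basisChange t * basisChange t = 1 := by
  ext ⟨_ | _, _ | _⟩ ⟨_ | _, _ | _⟩ <;>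
    (rw [mul_apply_bool]; dsimp only [basisChange, Matrix.of_apply]; simp)

theorem basisChange_koszulPlus {S : Type u} [CommRing S] (t x x' : S) :
    basisChange t * koszulPlus x (t * x - x') = koszulPlus x x' * basisChange t := by
  ext ⟨_ | _, _ | _⟩ ⟨_ | _, _ | _⟩ <;>
    (rw [mul_apply_bool, mul_apply_bool]
     dsimp only [basisChange, koszulPlus, Matrix.of_apply]
     ring)

theorem koszulPlus_basisChange {S : Type u} [CommRing S] (t x x' : S) :
    basisChange t * koszulPlus x x' = koszulPlus x (t * x - x') * basisChange t := by
  ext ⟨_ | _, _ | _⟩ ⟨_ | _, _ | _⟩ <;>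
    (rw [mul_apply_bool, mul_apply_bool]
     dsimp only [basisChange, koszulPlus, Matrix.of_apply]
     ring)

/-- With `x`, `x'` the two Koszul entries, `t_i x - x' = (t_i - t_k) (t_i - t_l)`. In the sequence
`(x, t_i x - x')` the first entry is linear in `t_j`, and the second is free of `t_j` and a product
of linear factors in `t_i`, so both outgoing variables can be eliminated by division. -/
theorem wideEdge_contraction (p : Polynomial k) (hij : i ≠ j) (hki : m ≠ i) (hkj : m ≠ j)
    (hli : l ≠ i) (hlj : l ≠ j) :
    Nonempty ((wideEdge p (X i : MvPolynomial τ k) (X j) (X m) (X l)).Contraction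
      (avoiding k {i, j})) := by
  have hXi {n : τ} (h : n ≠ i) : (X n : MvPolynomial τ k) ∈ avoiding k {i} := X_mem_avoiding h
  have hXj {n : τ} (h : n ≠ j) : (X n : MvPolynomial τ k) ∈ avoiding k {j} := X_mem_avoiding h
  -- The auxiliary factorizations may have zero negative part: a contraction and its transport
  -- involve only `dp`.
  obtain ⟨c⟩ := koszul_contraction j (X m + X l - X i) (0 : MvPolynomial τ k) 2
    (sub_mem (add_mem (hXj hkj) (hXj hlj)) (hXj hij))
  obtain ⟨c'⟩ := koszul_mul_contraction i (X m) (X l) (0 : MvPolynomial τ k) 4 (hXi hki) (hXi hli)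
  have c'' := (c.tensor c' (koszul_dp_mem _ (mul_mem (sub_mem (hXj hij) (hXj hkj))
    (sub_mem (hXj hij) (hXj hlj))))).mono (A' := avoiding k {i, j}) (fun a ha =>
      ⟨avoiding_anti (by simp) ha, avoiding_anti (by simp) ha⟩)
  have e1 : ((MatFac.koszul (X j - (X m + X l - X i)) (0 : MvPolynomial τ k) 2).tensor
      (MatFac.koszul ((X i - X m) * (X i - X l)) 0 4)).dp =
      koszulPlus (X i + X j - X m - X l)
        (X i * (X i + X j - X m - X l) - (X i * X j - X m * X l)) := by
    rw [koszul_tensor_dp]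
    congr 1 <;> ring
  have e2 : (wideEdge p (X i : MvPolynomial τ k) (X j) (X m) (X l)).dp =
    koszulPlus (X i + X j - X m - X l) (X i * X j - X m * X l) := koszul_tensor_dp ..
  have deg : ∀ b a : Bool × Bool,
      (wideEdge p (X i : MvPolynomial τ k) (X j) (X m) (X l)).mf b ≠
        (wideEdge p (X i : MvPolynomial τ k) (X j) (X m) (X l)).mf a →
      basisChange (X i : MvPolynomial τ k) b a = 0 := by
    rintro ⟨_ | _, _ | _⟩ ⟨_ | _, _ | _⟩ h <;> first | rfl | exact absurd rfl h
  refine ⟨c''.conj (basisChange (X i)) (basisChange (X i)) (basisChange_mul_self _) ?_ deg deg ?_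
    ?_⟩
  · refine (congrArg (fun A : Matrix (Bool × Bool) (Bool × Bool) (MvPolynomial τ k) =>
      basisChange (X i) * A) e1).trans ?_
    refine (basisChange_koszulPlus _ _ _).trans ?_
    exact congrArg (fun A : Matrix (Bool × Bool) (Bool × Bool) (MvPolynomial τ k) =>
      A * basisChange (X i)) e2.symm
  · refine (congrArg (fun A : Matrix (Bool × Bool) (Bool × Bool) (MvPolynomial τ k) =>
      basisChange (X i) * A) e2).trans ?_
    refine (koszulPlus_basisChange _ _ _).trans ?_
    exact congrArg (fun A : Matrix (Bool × Bool) (Bool × Bool) (MvPolynomial τ k) =>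
      A * basisChange (X i)) e1.symm
  · exact c''.nonpos

/-- The first entry eliminates `t_i`, which is absent from the second entry; the second eliminates
`t_j`. -/
theorem orientedSmoothing_contraction (p : Polynomial k) (hij : i ≠ j) (hki : m ≠ i)
    (hkj : m ≠ j) (hli : l ≠ i) :
    Nonempty ((orientedSmoothing p (X i : MvPolynomial τ k) (X j) (X m) (X l)).Contraction
      (avoiding k {i, j})) := by
  obtain ⟨c⟩ := koszul_contraction i (X l) (crossingY₁ p (X i : MvPolynomial τ k) (X j) (X m) (X l) +
    X m * crossingY₂ p (X i) (X j) (X m) (X l)) 2 (X_mem_avoiding (by simpa using hli))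
  obtain ⟨c'⟩ := koszul_contraction j (X m) (crossingY₁ p (X i : MvPolynomial τ k) (X j) (X m) (X l) +
    X i * crossingY₂ p (X i) (X j) (X m) (X l)) 2 (X_mem_avoiding (by simpa using hkj))
  exact ⟨(c.tensor c' (koszul_dp_mem _ (sub_mem (X_mem_avoiding (by simpa using hij.symm))
    (X_mem_avoiding (by simpa using hki))))).mono (fun a ha =>
      ⟨avoiding_anti (by simp) ha, avoiding_anti (by simp) ha⟩)⟩

theorem positiveCrossing_contraction (p : Polynomial k) (hij : i ≠ j) (hki : m ≠ i) (hkj : m ≠ j)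
    (hli : l ≠ i) (hlj : l ≠ j) :
    Nonempty ((positiveCrossing p (X i : MvPolynomial τ k) (X j) (X m) (X l)).Contraction
      (avoiding k {i, j})) := by
  obtain ⟨c⟩ := wideEdge_contraction p hij hki hkj hli hlj
  obtain ⟨c'⟩ := orientedSmoothing_contraction p hij hki hkj hli
  exact ⟨c.twoTerm c' _ _ _ _ _ _ _⟩

theorem negativeCrossing_contraction (p : Polynomial k) (hij : i ≠ j) (hki : m ≠ i) (hkj : m ≠ j)
    (hli : l ≠ i) (hlj : l ≠ j) :
    Nonempty ((negativeCrossing p (X i : MvPolynomial τ k) (X j) (X m) (X l)).Contraction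
      (avoiding k {i, j})) := by
  obtain ⟨c⟩ := wideEdge_contraction p hij hki hkj hli hlj
  obtain ⟨c'⟩ := orientedSmoothing_contraction p hij hki hkj hli
  exact ⟨c'.twoTerm c _ _ _ _ _ _ _⟩

end Crossing

section CrossingMem

variable {k S : Type u} [CommRing k] [CommRing S] [Algebra k S] (R : Subring S)

theorem koszulPlus_mem {x x' : S} (hx : x ∈ R) (hx' : x' ∈ R) :
    ∀ b a, koszulPlus x x' b a ∈ R := by
  rintro ⟨_ | _, _ | _⟩ ⟨_ | _, _ | _⟩ <;>
    first | exact zero_mem _ | exact hx | exact hx' | exact neg_mem hx'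

/-- The positive part of a crossing depends on its four variables only; this decides which earlier
contractions commute with it. -/
theorem crossing_dp_mem (p : Polynomial k) {ti tj tk tl : S} (hi : ti ∈ R) (hj : tj ∈ R)
    (hk : tk ∈ R) (hl : tl ∈ R) :
    (∀ b a, (positiveCrossing p ti tj tk tl).dp b a ∈ R) ∧
      ∀ b a, (negativeCrossing p ti tj tk tl).dp b a ∈ R := by
  have h1 : ∀ b a, (wideEdge p ti tj tk tl).dp b a ∈ R := by
    have e : (wideEdge p ti tj tk tl).dp = koszulPlus _ _ := koszul_tensor_dp ..
    rw [e]
    exact koszulPlus_mem R (sub_mem (sub_mem (add_mem hi hj) hk) hl)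
      (sub_mem (mul_mem hi hj) (mul_mem hk hl))
  have h2 : ∀ b a, (orientedSmoothing p ti tj tk tl).dp b a ∈ R := by
    have e : (orientedSmoothing p ti tj tk tl).dp = koszulPlus _ _ := koszul_tensor_dp ..
    rw [e]
    exact koszulPlus_mem R (sub_mem hi hl) (sub_mem hj hk)
  constructor
  · rintro (b | b) (a | a)
    exacts [h1 b a, zero_mem _, zero_mem _, h2 b a]
  · rintro (b | b) (a | a)
    exacts [h2 b a, zero_mem _, zero_mem _, h1 b a]

end CrossingMem

/-! ### Homogeneity -/

section Homogeneity

variable {k S : Type u} [CommRing k] [CommRing S] [Algebra k S] {G : Type} [AddCommGroup G]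
  (gr : ScalarGrading k S G)

theorem ScalarGrading.mul_mem' {g h d : G} {a b : S} (ha : a ∈ gr.piece g) (hb : b ∈ gr.piece h)
    (hd : d = g + h) : a * b ∈ gr.piece d := hd ▸ gr.mul_mem ha hb

theorem ScalarGrading.pow_mem {g : G} {a : S} (ha : a ∈ gr.piece g) (n : ℕ) :
    a ^ n ∈ gr.piece (n • g) := by
  induction n with
  | zero => rw [pow_zero, zero_smul]; exact gr.one_mem
  | succ n ih => rw [pow_succ, succ_nsmul]; exact gr.mul_mem ih ha

variable {α : G}

theorem powerSum_mem {s q : S} (hs : s ∈ gr.piece (2 • α)) (hq : q ∈ gr.piece (4 • α)) (m : ℕ) :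
    powerSum s q m ∈ gr.piece ((2 * m) • α) := by
  induction m using Nat.twoStepInduction with
  | zero =>
    rw [Nat.mul_zero, zero_smul, powerSum, ← one_add_one_eq_two]
    exact add_mem gr.one_mem gr.one_mem
  | one => exact hs
  | more m h0 h1 =>
    exact sub_mem (gr.mul_mem' hs h1 (by module)) (gr.mul_mem' hq h0 (by module))

theorem powerSumDiffLeft_mem {s s' q : S} (hs : s ∈ gr.piece (2 • α)) (hs' : s' ∈ gr.piece (2 • α))
    (hq : q ∈ gr.piece (4 • α)) (m : ℕ) :
    powerSumDiffLeft s s' q (m + 1) ∈ gr.piece ((2 * m) • α) := by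
  induction m using Nat.twoStepInduction with
  | zero =>
    rw [Nat.mul_zero, zero_smul]
    exact gr.one_mem
  | one =>
    change s + s' * 1 - q * 0 ∈ _
    rw [mul_one s', mul_zero, sub_zero]
    exact add_mem hs hs'
  | more m h0 h1 =>
    rw [powerSumDiffLeft]
    exact sub_mem (add_mem (powerSum_mem gr hs hq _) (gr.mul_mem' hs' h1 (by module)))
      (gr.mul_mem' hq h0 (by module))

/-- The index is shifted by two because division by `q - q'` costs the degree `4 • α` of two
variables. -/
theorem powerSumDiffRight_mem {s' q q' : S} (hs' : s' ∈ gr.piece (2 • α))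
    (hq : q ∈ gr.piece (4 • α)) (hq' : q' ∈ gr.piece (4 • α)) (m : ℕ) :
    powerSumDiffRight s' q q' (m + 2) ∈ gr.piece ((2 * m) • α) := by
  have h0 := powerSum_mem gr hs' hq
  induction m using Nat.twoStepInduction with
  | zero =>
    change s' * 0 - powerSum s' q 0 - q' * 0 ∈ _
    rw [mul_zero s', mul_zero q', sub_zero, Nat.mul_zero, zero_smul]
    exact sub_mem (zero_mem _) (by simpa using h0 0)
  | one =>
    change s' * (s' * 0 - powerSum s' q 0 - q' * 0) - powerSum s' q 1 - q' * 0 ∈ _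
    rw [mul_zero, mul_zero, sub_zero, sub_zero]
    exact sub_mem (gr.mul_mem' hs' (sub_mem (zero_mem _) (h0 0)) (by module)) (h0 1)
  | more m h1 h2 =>
    rw [powerSumDiffRight]
    exact sub_mem (sub_mem (gr.mul_mem' hs' h2 (by module)) (h0 (m + 2)))
      (gr.mul_mem' hq' h1 (by module))

variable {p : Polynomial k} (γ : GradingDatum p) (gr : ScalarGrading k S γ.G)

/-- A monomial of exponent `m + 1` in `p` contributes in degree `(2 * m) • α`, which the grading
datum equates with `2 • α + 2 • β`; a constant term contributes nothing. -/
theorem divDiff_mem {a b : S} (ha : a ∈ gr.piece (2 • γ.α)) (hb : b ∈ gr.piece (2 • γ.α)) :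
    divDiff p a b ∈ gr.piece (2 • γ.α + 2 • γ.β) := by
  refine Submodule.sum_mem _ fun m hm => Submodule.smul_mem _ _ (Submodule.sum_mem _ fun r hr => ?_)
  rw [Finset.mem_range] at hr
  obtain ⟨m, rfl⟩ : ∃ n, m = n + 1 := ⟨m - 1, by omega⟩
  rw [← γ.cond m (Polynomial.mem_support_iff.1 hm)]
  refine gr.mul_mem' (gr.pow_mem ha r) (gr.pow_mem hb _) ?_
  rw [← add_smul, ← mul_smul]
  congr 1
  omega

theorem arcFactor_homogeneous {a b : S} (ha : a ∈ gr.piece (2 • γ.α))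
    (hb : b ∈ gr.piece (2 • γ.α)) : (arcFactor p a b).Homogeneous gr γ.α γ.β := by
  refine MatFac.Homogeneous.koszul ?_ ?_
  · simpa [two_zsmul, two_nsmul] using sub_mem ha hb
  · rw [sub_self, zero_smul, add_zero]
    exact divDiff_mem γ gr ha hb

variable {ti tj tk tl : S} (hi : ti ∈ gr.piece (2 • γ.α)) (hj : tj ∈ gr.piece (2 • γ.α))
  (hk : tk ∈ gr.piece (2 • γ.α)) (hl : tl ∈ gr.piece (2 • γ.α))

include hi hj hk hl

theorem crossingY₁_mem : crossingY₁ p ti tj tk tl ∈ gr.piece (2 • γ.α + 2 • γ.β) := by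
  refine Submodule.sum_mem _ fun m hm => Submodule.smul_mem _ _ ?_
  cases m with
  | zero => exact zero_mem _
  | succ m =>
    rw [← γ.cond m (Polynomial.mem_support_iff.1 hm)]
    exact powerSumDiffLeft_mem gr (add_mem hi hj) (add_mem hk hl) (gr.mul_mem' hi hj (by module)) m

theorem crossingY₂_mem : crossingY₂ p ti tj tk tl ∈ gr.piece (2 • γ.β) := by
  refine Submodule.sum_mem _ fun m hm => Submodule.smul_mem _ _ ?_
  match m with
  | 0 => exact zero_mem _
  | 1 => exact zero_mem _
  | m + 2 =>
    have h := γ.cond (m + 1) (Polynomial.mem_support_iff.1 hm)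
    have h' : (2 * m) • γ.α = 2 • γ.β := by
      rw [Nat.mul_add, add_smul, add_comm] at h
      exact add_left_cancel h
    rw [← h']
    exact powerSumDiffRight_mem gr (add_mem hk hl) (gr.mul_mem' hi hj (by module))
      (gr.mul_mem' hk hl (by module)) m

theorem wideEdge_homogeneous : (wideEdge p ti tj tk tl).Homogeneous gr γ.α γ.β := by
  refine MatFac.Homogeneous.tensor (MatFac.Homogeneous.koszul ?_ ?_)
    (MatFac.Homogeneous.koszul ?_ ?_)
  · have := sub_mem (sub_mem (add_mem hi hj) hk) hl
    simpa [two_zsmul, two_nsmul] using this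
  · rw [sub_self, zero_smul, add_zero]
    exact crossingY₁_mem γ gr hi hj hk hl
  · exact sub_mem (gr.mul_mem' hi hj (by module)) (gr.mul_mem' hk hl (by module))
  · have := crossingY₂_mem γ gr hi hj hk hl
    convert this using 2
    module

theorem orientedSmoothing_homogeneous :
    (orientedSmoothing p ti tj tk tl).Homogeneous gr γ.α γ.β := by
  have h1 := crossingY₁_mem γ gr hi hj hk hl
  have h2 := crossingY₂_mem γ gr hi hj hk hl
  refine MatFac.Homogeneous.tensor (MatFac.Homogeneous.koszul ?_ ?_)
    (MatFac.Homogeneous.koszul ?_ ?_)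
  · simpa [two_zsmul, two_nsmul] using sub_mem hi hl
  · rw [sub_self, zero_smul, add_zero]
    exact add_mem h1 (gr.mul_mem hk h2)
  · simpa [two_zsmul, two_nsmul] using sub_mem hj hk
  · rw [sub_self, zero_smul, add_zero]
    exact add_mem h1 (gr.mul_mem hi h2)

omit hi hj hk hl in
theorem twoTerm_homogeneous {α β : G} {gr : ScalarGrading k S G} {M N : MatFac S}
    (hM : M.Homogeneous gr α β) (hN : N.Homogeneous gr α β) (c s : ℤ) (f : Matrix N.B M.B S)
    (hpot : M.potential = N.potential) (hdeg : ∀ b a, N.mf b ≠ M.mf a → f b a = 0)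
    (hp : f * M.dp = N.dp * f) (hm : f * M.dm = N.dm * f) :
    (MFComplex.twoTerm M N c s f hpot hdeg hp hm).Homogeneous gr α β := by
  have e (b a : N.B) : 2 • α + β + ((N.q a + s) • α + N.mf a • β) - ((N.q b + s) • α + N.mf b • β) =
      2 • α + β + N.deg α β a - N.deg α β b := by
    simp only [MatFac.deg]
    module
  rintro (b | b) (a | a)
  · exact hM b a
  · exact ⟨zero_mem _, zero_mem _⟩
  · exact ⟨zero_mem _, zero_mem _⟩
  · exact ⟨Eq.mp (congrArg (_ ∈ gr.piece ·) (e b a).symm) (hN b a).1,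
      Eq.mp (congrArg (_ ∈ gr.piece ·) (e b a).symm) (hN b a).2⟩

theorem positiveCrossing_homogeneous :
    (positiveCrossing p ti tj tk tl).Homogeneous gr γ.α γ.β :=
  twoTerm_homogeneous (wideEdge_homogeneous γ gr hi hj hk hl)
    (orientedSmoothing_homogeneous γ gr hi hj hk hl) _ _ _ _ _ _ _

theorem negativeCrossing_homogeneous :
    (negativeCrossing p ti tj tk tl).Homogeneous gr γ.α γ.β :=
  twoTerm_homogeneous (orientedSmoothing_homogeneous γ gr hi hj hk hl)
    (wideEdge_homogeneous γ gr hi hj hk hl) _ _ _ _ _ _ _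

end Homogeneity

/-! ### Base change of the local factors -/

section BaseChange

variable {k S S' : Type u} [CommRing k] [CommRing S] [CommRing S'] [Algebra k S] [Algebra k S']
  (φ : S →ₐ[k] S') (p : Polynomial k)

theorem map_divDiff (a b : S) : φ (divDiff p a b) = divDiff p (φ a) (φ b) := by
  simp only [divDiff, Polynomial.sum_def, map_sum, map_smul, map_mul, map_pow]

theorem map_powerSum (s q : S) (m : ℕ) : φ (powerSum s q m) = powerSum (φ s) (φ q) m := by
  induction m using Nat.twoStepInduction with
  | zero => exact map_ofNat φ 2
  | one => rfl
  | more m h0 h1 => rw [powerSum, powerSum, map_sub, map_mul, map_mul, h0, h1]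

theorem map_powerSumDiffLeft (s s' q : S) (m : ℕ) :
    φ (powerSumDiffLeft s s' q m) = powerSumDiffLeft (φ s) (φ s') (φ q) m := by
  induction m using Nat.twoStepInduction with
  | zero => exact map_zero φ
  | one => exact map_one φ
  | more m h0 h1 =>
    rw [powerSumDiffLeft, powerSumDiffLeft, map_sub, map_add, map_mul, map_mul, h0, h1,
      map_powerSum]

theorem map_powerSumDiffRight (s' q q' : S) (m : ℕ) :
    φ (powerSumDiffRight s' q q' m) = powerSumDiffRight (φ s') (φ q) (φ q') m := by
  induction m using Nat.twoStepInduction with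
  | zero => exact map_zero φ
  | one => exact map_zero φ
  | more m h0 h1 =>
    rw [powerSumDiffRight, powerSumDiffRight, map_sub, map_sub, map_mul, map_mul, h0, h1,
      map_powerSum]

theorem map_crossingY₁ (ti tj tk tl : S) :
    φ (crossingY₁ p ti tj tk tl) = crossingY₁ p (φ ti) (φ tj) (φ tk) (φ tl) := by
  simp only [crossingY₁, Polynomial.sum_def, map_sum, map_smul, map_powerSumDiffLeft, map_add,
    map_mul]

theorem map_crossingY₂ (ti tj tk tl : S) :
    φ (crossingY₂ p ti tj tk tl) = crossingY₂ p (φ ti) (φ tj) (φ tk) (φ tl) := by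
  simp only [crossingY₂, Polynomial.sum_def, map_sum, map_smul, map_powerSumDiffRight, map_add,
    map_mul]

theorem map_koszulPlus (x x' : S) :
    (koszulPlus x x').map φ = koszulPlus (φ x) (φ x') := by
  ext ⟨_ | _, _ | _⟩ ⟨_ | _, _ | _⟩ <;> simp [koszulPlus]

theorem map_koszulMinus (x x' : S) :
    (koszulMinus x x').map φ = koszulMinus (φ x) (φ x') := by
  ext ⟨_ | _, _ | _⟩ ⟨_ | _, _ | _⟩ <;> simp [koszulMinus]

theorem map_rhoPlus (x x' : S) : (rhoPlus x x').map φ = rhoPlus (φ x) (φ x') := by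
  ext ⟨_ | _, _ | _⟩ ⟨_ | _, _ | _⟩ <;> simp [rhoPlus]

theorem map_rhoMinus (x x' : S) : (rhoMinus x x').map φ = rhoMinus (φ x) (φ x') := by
  ext ⟨_ | _, _ | _⟩ ⟨_ | _, _ | _⟩ <;> simp [rhoMinus]

theorem map_wideEdge (ti tj tk tl : S) :
    (wideEdge p ti tj tk tl).dp.map φ = (wideEdge p (φ ti) (φ tj) (φ tk) (φ tl)).dp ∧
      (wideEdge p ti tj tk tl).dm.map φ = (wideEdge p (φ ti) (φ tj) (φ tk) (φ tl)).dm := by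
  constructor
  · refine (congrArg (fun A : Matrix (Bool × Bool) (Bool × Bool) S => A.map φ)
      (koszul_tensor_dp ..)).trans ((map_koszulPlus φ _ _).trans (Eq.trans ?_
        (koszul_tensor_dp ..).symm))
    simp only [map_sub, map_add, map_mul]
  · refine (congrArg (fun A : Matrix (Bool × Bool) (Bool × Bool) S => A.map φ)
      (koszul_tensor_dm ..)).trans ((map_koszulMinus φ _ _).trans (Eq.trans ?_
        (koszul_tensor_dm ..).symm))
    simp only [map_crossingY₁, map_crossingY₂]

theorem map_orientedSmoothing (ti tj tk tl : S) :
    (orientedSmoothing p ti tj tk tl).dp.map φ =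
        (orientedSmoothing p (φ ti) (φ tj) (φ tk) (φ tl)).dp ∧
      (orientedSmoothing p ti tj tk tl).dm.map φ =
        (orientedSmoothing p (φ ti) (φ tj) (φ tk) (φ tl)).dm := by
  constructor
  · refine (congrArg (fun A : Matrix (Bool × Bool) (Bool × Bool) S => A.map φ)
      (koszul_tensor_dp ..)).trans ((map_koszulPlus φ _ _).trans (Eq.trans ?_
        (koszul_tensor_dp ..).symm))
    simp only [map_sub]
  · refine (congrArg (fun A : Matrix (Bool × Bool) (Bool × Bool) S => A.map φ)
      (koszul_tensor_dm ..)).trans ((map_koszulMinus φ _ _).trans (Eq.trans ?_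
        (koszul_tensor_dm ..).symm))
    simp only [map_crossingY₁, map_crossingY₂, map_add, map_mul]

namespace MFComplex.SignedEquiv

/-- An isomorphism between complexes with the same index set and equal matrices. -/
def ofEq {S : Type u} [CommRing S] {X Y : MFComplex S} (e : X.B ≃ Y.B)
    (mf : ∀ b, Y.mf (e b) = X.mf b) (q : ∀ b, Y.q (e b) = X.q b)
    (coh : ∀ b, Y.coh (e b) = X.coh b) (potential : Y.potential = X.potential)
    (dp : ∀ b a, X.dp b a = Y.dp (e b) (e a)) (dm : ∀ b a, X.dm b a = Y.dm (e b) (e a))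
    (dv : ∀ b a, X.dv b a = Y.dv (e b) (e a)) : SignedEquiv X Y where
  e := e
  s := 1
  mf := mf
  q := q
  coh := coh
  potential := potential
  dp b a := by simp [unitSign_one, dp]
  dm b a := by simp [unitSign_one, dm]
  dv b a := by simp [unitSign_one, dv]

/-- Base change of the factorization of an arc. -/
def mapArc (a b : S) :
    SignedEquiv ((single (arcFactor p a b)).map φ.toRingHom) (single (arcFactor p (φ a) (φ b))) :=
  ofEq (Equiv.refl _) (fun _ => rfl) (fun _ => rfl) (fun _ => rfl)
    ((congrArg₂ (· * ·) (map_sub φ a b) (map_divDiff φ p a b)).symm.trans (map_mul φ _ _).symm)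
    (by
      rintro (_ | _) (_ | _)
      exacts [map_zero φ, map_sub φ a b, map_zero φ, map_zero φ])
    (by
      rintro (_ | _) (_ | _)
      exacts [map_zero φ, map_zero φ, map_divDiff φ p a b, map_zero φ])
    (fun _ _ => map_zero φ)

theorem map_wideEdge_potential (ti tj tk tl : S) :
    (wideEdge p (φ ti) (φ tj) (φ tk) (φ tl)).potential = φ (wideEdge p ti tj tk tl).potential := by
  simp only [wideEdge_potential, map_sub, map_add, Polynomial.aeval_algHom_apply]

/-- Base change of a positive crossing. -/
def mapPositiveCrossing (ti tj tk tl : S) :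
    SignedEquiv ((positiveCrossing p ti tj tk tl).map φ.toRingHom)
      (positiveCrossing p (φ ti) (φ tj) (φ tk) (φ tl)) :=
  ofEq (Equiv.refl _) (fun _ => rfl) (fun _ => rfl) (fun _ => rfl)
    (map_wideEdge_potential φ p ti tj tk tl)
    (by
      rintro (b | b) (a | a)
      exacts [congrFun (congrFun (map_wideEdge φ p ti tj tk tl).1 b) a, map_zero φ, map_zero φ,
        congrFun (congrFun (map_orientedSmoothing φ p ti tj tk tl).1 b) a])
    (by
      rintro (b | b) (a | a)
      exacts [congrFun (congrFun (map_wideEdge φ p ti tj tk tl).2 b) a, map_zero φ, map_zero φ,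
        congrFun (congrFun (map_orientedSmoothing φ p ti tj tk tl).2 b) a])
    (by
      rintro (b | b) (a | a)
      exacts [map_zero φ, map_zero φ, congrFun (congrFun (map_rhoPlus φ ti tk) b) a, map_zero φ])

/-- Base change of a negative crossing. -/
def mapNegativeCrossing (ti tj tk tl : S) :
    SignedEquiv ((negativeCrossing p ti tj tk tl).map φ.toRingHom)
      (negativeCrossing p (φ ti) (φ tj) (φ tk) (φ tl)) :=
  ofEq (Equiv.refl _) (fun _ => rfl) (fun _ => rfl) (fun _ => rfl)
    ((orientedSmoothing_potential p _ _ _ _).symm.trans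
      ((map_wideEdge_potential φ p ti tj tk tl).trans
        (congrArg φ (orientedSmoothing_potential p ti tj tk tl))))
    (by
      rintro (b | b) (a | a)
      exacts [congrFun (congrFun (map_orientedSmoothing φ p ti tj tk tl).1 b) a, map_zero φ,
        map_zero φ, congrFun (congrFun (map_wideEdge φ p ti tj tk tl).1 b) a])
    (by
      rintro (b | b) (a | a)
      exacts [congrFun (congrFun (map_orientedSmoothing φ p ti tj tk tl).2 b) a, map_zero φ,
        map_zero φ, congrFun (congrFun (map_wideEdge φ p ti tj tk tl).2 b) a])
    (by
      rintro (b | b) (a | a)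
      exacts [map_zero φ, map_zero φ, congrFun (congrFun (map_rhoMinus φ ti tk) b) a, map_zero φ])

end MFComplex.SignedEquiv

end BaseChange

/-! ### Polynomial rings with a constant weight -/

section Weights

open MvPolynomial

variable (k : Type u) [CommRing k] {τ τ' : Type} {G : Type} [AddCommGroup G]

/-- The grading of a polynomial ring in which all variables have degree `v`. -/
def weightGrading (τ : Type) (v : G) : ScalarGrading k (MvPolynomial τ k) G where
  piece g := weightedHomogeneousSubmodule k (fun _ => v) g
  proj g := weightedHomogeneousComponent (fun _ => v) g
  proj_mem g x := weightedHomogeneousComponent_isWeightedHomogeneous g x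
  proj_eq g x hx := by
    classical
    rw [weightedHomogeneousComponent_of_mem hx, if_pos rfl]
  one_mem := isWeightedHomogeneous_one k _
  proj_mul g h a x ha := by
    classical
    induction x using MvPolynomial.induction_on' with
    | monomial m r =>
      have hm : monomial m r ∈ weightedHomogeneousSubmodule k (fun _ : τ => v)
          (Finsupp.weight (fun _ : τ => v) m) := isWeightedHomogeneous_monomial _ _ _ rfl
      have ha' : a * monomial m r ∈ weightedHomogeneousSubmodule k (fun _ : τ => v)
          (g + Finsupp.weight (fun _ : τ => v) m) :=
        IsWeightedHomogeneous.mul ha hm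
      rw [weightedHomogeneousComponent_of_mem ha', weightedHomogeneousComponent_of_mem hm]
      have : h = g + Finsupp.weight (fun _ : τ => v) m ↔
          h - g = Finsupp.weight (fun _ : τ => v) m := by
        rw [sub_eq_iff_eq_add, add_comm g]
      simp only [this]
      split_ifs
      · rfl
      · rw [mul_zero]
    | add x y hx hy => rw [mul_add, map_add, map_add, hx, hy, mul_add]

variable {k}

theorem X_mem_weightGrading (v : G) (i : τ) : (X i : MvPolynomial τ k) ∈ (weightGrading k τ v).piece v :=
  isWeightedHomogeneous_X k _ i

theorem rename_mem_weightGrading (r : τ → τ') (v g : G) {x : MvPolynomial τ k}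
    (hx : x ∈ (weightGrading k τ v).piece g) :
    rename r x ∈ (weightGrading k τ' v).piece g := by
  classical
  intro m hm
  obtain ⟨m, rfl, hm'⟩ := coeff_rename_ne_zero r x m hm
  rw [← hx hm', Finsupp.weight_apply, Finsupp.weight_apply]
  exact Finsupp.sum_mapDomain_index (fun _ => zero_smul _ _) fun _ _ _ => add_smul _ _ _

/-- A section of the map of variables lifts homogeneous polynomials to homogeneous polynomials of
the same degree. -/
theorem map_rename_weightGrading {r : τ → τ'} {s : τ' → τ} (h : Function.LeftInverse r s) (v g : G) :
    ((weightGrading k τ v).piece g).map (rename r : MvPolynomial τ k →ₐ[k] _).toLinearMap =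
      (weightGrading k τ' v).piece g := by
  apply le_antisymm
  · rintro _ ⟨x, hx, rfl⟩
    exact rename_mem_weightGrading r v g hx
  · intro x hx
    refine ⟨rename s x, rename_mem_weightGrading s v g hx, ?_⟩
    change rename r (rename s x) = x
    rw [rename_rename, h.comp_eq_id, rename_id]
    rfl

/-- The kernel of the identification of variables. -/
theorem rename_eq_zero_iff {r : τ → τ'} {s : τ' → τ} (I : Ideal (MvPolynomial τ k))
    (h : ∀ i, X i - X (s (r i)) ∈ I) (h' : ∀ x ∈ I, rename r x = 0) (x : MvPolynomial τ k) :
    rename r x = 0 ↔ x ∈ I := by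
  refine ⟨fun hx => ?_, h' x⟩
  -- Modulo `I` every variable equals the chosen representative of its class, so the quotient map
  -- factors through `rename r`.
  have key : Ideal.Quotient.mkₐ k I =
      ((Ideal.Quotient.mkₐ k I).comp (rename s)).comp (rename r) := by
    ext1 i
    rw [AlgHom.comp_apply, AlgHom.comp_apply, rename_X, rename_X]
    exact Ideal.Quotient.eq.2 (h i)
  rw [← Ideal.Quotient.eq_zero_iff_mem]
  refine (DFunLike.congr_fun key x).trans ?_
  rw [AlgHom.comp_apply, AlgHom.comp_apply, hx, map_zero, map_zero]

end Weights

/-! ### The factors attached to a diagram -/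

namespace Diagram

open MFComplex

variable {k : Type u} [CommRing k] (T : Diagram) (p : Polynomial k)

/-- The grading of the ring of flags. -/
def scalarGrading (k : Type u) [CommRing k] {G : Type} [AddCommGroup G] (v : G) :
    ScalarGrading k (T.FlagRing k) G :=
  weightGrading k T.Flag v

/-- The grading of the ring of end points. -/
def endScalarGrading (k : Type u) [CommRing k] {G : Type} [AddCommGroup G] (v : G) :
    ScalarGrading k (T.EndRing k) G :=
  weightGrading k T.End v

theorem algebraMap_mem {G : Type} [AddCommGroup G] (v g : G) (a : T.EndRing k)
    (ha : a ∈ (T.endScalarGrading k v).piece g) :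
    algebraMap (T.EndRing k) (T.FlagRing k) a ∈ (T.scalarGrading k v).piece g :=
  rename_mem_weightGrading T.endFlag _ g ha

theorem flagVar_mem (γ : GradingDatum p) (f : T.Flag) :
    T.flagVar k f ∈ (T.scalarGrading k (2 • γ.α)).piece (2 • γ.α) :=
  X_mem_weightGrading _ f

theorem edgeComplex_homogeneous (γ : GradingDatum p) (e : T.Flag × T.Flag) :
    (T.edgeComplex p e).Homogeneous (T.scalarGrading k (2 • γ.α)) γ.α γ.β :=
  arcFactor_homogeneous γ _ (T.flagVar_mem p γ _) (T.flagVar_mem p γ _)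

theorem crossingComplex_homogeneous (γ : GradingDatum p) (x : Crossing T.Flag) :
    (T.crossingComplex p x).Homogeneous (T.scalarGrading k (2 • γ.α)) γ.α γ.β := by
  rw [crossingComplex]
  split_ifs
  · exact positiveCrossing_homogeneous γ _ (T.flagVar_mem p γ _) (T.flagVar_mem p γ _)
      (T.flagVar_mem p γ _) (T.flagVar_mem p γ _)
  · exact negativeCrossing_homogeneous γ _ (T.flagVar_mem p γ _) (T.flagVar_mem p γ _)
      (T.flagVar_mem p γ _) (T.flagVar_mem p γ _)

theorem factors_homogeneous (γ : GradingDatum p) (l : List (T.Flag × T.Flag))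
    (l' : List (Crossing T.Flag)) :
    (tensorList (l.map (T.edgeComplex p) ++ l'.map (T.crossingComplex p))).Homogeneous
      (T.scalarGrading k (2 • γ.α)) γ.α γ.β := by
  refine tensorList_homogeneous _ _ _ _ fun X hX => ?_
  rcases List.mem_append.1 hX with hX | hX
  · obtain ⟨e, -, rfl⟩ := List.mem_map.1 hX
    exact T.edgeComplex_homogeneous p γ e
  · obtain ⟨x, -, rfl⟩ := List.mem_map.1 hX
    exact T.crossingComplex_homogeneous p γ x

theorem arcFactorization_homogeneous (γ : GradingDatum p) (arcs : List (T.End × T.End)) :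
    (T.arcFactorization p arcs).Homogeneous (T.endScalarGrading k (2 • γ.α)) γ.α γ.β := by
  induction arcs with
  | nil => exact MatFac.Homogeneous.unit
  | cons a l ih =>
    exact MatFac.Homogeneous.tensor (arcFactor_homogeneous γ (T.endScalarGrading k (2 • γ.α))
      (X_mem_weightGrading _ _) (X_mem_weightGrading _ _)) ih

/-- The polynomials not involving the flags in `W`. -/
def avoiding (k : Type u) [CommRing k] (W : Set T.Flag) : Subring (T.FlagRing k) :=
  KhovanovRozansky.avoiding (τ := T.Flag) k W

variable {T}

theorem flagVar_mem_avoiding {W : Set T.Flag} {f : T.Flag} (h : f ∉ W) :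
    T.flagVar k f ∈ T.avoiding k W :=
  X_mem_avoiding (τ := T.Flag) h

/-- The edge eliminates the variable at its head. For a loop the Koszul entry would be zero, hence
the hypothesis. -/
theorem edgeComplex_contraction {e : T.Flag × T.Flag} (h : e.1 ≠ e.2) :
    Nonempty ((T.edgeComplex p e).Contraction (T.avoiding k {e.2} : Set (T.FlagRing k))) :=
  koszul_contraction (τ := T.Flag) e.2 _ _ _ (X_mem_avoiding (τ := T.Flag) h)

theorem edgeComplex_dp_mem {W : Set T.Flag} {e : T.Flag × T.Flag} (h1 : e.1 ∉ W) (h2 : e.2 ∉ W) :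
    ∀ b a, (T.edgeComplex p e).dp b a ∈ T.avoiding k W :=
  koszul_dp_mem _ (sub_mem (flagVar_mem_avoiding h2) (flagVar_mem_avoiding h1))

theorem crossingComplex_contraction {x : Crossing T.Flag} (hij : x.i ≠ x.j) (hki : x.k ≠ x.i)
    (hkj : x.k ≠ x.j) (hli : x.l ≠ x.i) (hlj : x.l ≠ x.j) :
    Nonempty ((T.crossingComplex p x).Contraction
      (T.avoiding k {x.i, x.j} : Set (T.FlagRing k))) := by
  rw [crossingComplex]
  split_ifs
  · exact positiveCrossing_contraction (τ := T.Flag) p hij hki hkj hli hlj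
  · exact negativeCrossing_contraction (τ := T.Flag) p hij hki hkj hli hlj

theorem crossingComplex_dp_mem {W : Set T.Flag} {x : Crossing T.Flag} (hi : x.i ∉ W) (hj : x.j ∉ W)
    (hk : x.k ∉ W) (hl : x.l ∉ W) : ∀ b a, (T.crossingComplex p x).dp b a ∈ T.avoiding k W := by
  have := crossing_dp_mem (T.avoiding k W) p (flagVar_mem_avoiding hi) (flagVar_mem_avoiding hj)
    (flagVar_mem_avoiding hk) (flagVar_mem_avoiding hl)
  have e : T.crossingComplex p x = _ ∨ T.crossingComplex p x = _ := ite_eq_or_eq ..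
  rcases e with e | e
  · rw [e]; exact this.1
  · rw [e]; exact this.2

section Map

variable {T' : Diagram} (r : T.Flag → T'.Flag)

/-- The map of rings of flags given by a map of flags. -/
def mapFlags (k : Type u) [CommRing k] : T.FlagRing k →ₐ[k] T'.FlagRing k :=
  (MvPolynomial.rename (R := k) r : MvPolynomial T.Flag k →ₐ[k] MvPolynomial T'.Flag k)

theorem mapFlags_flagVar (f : T.Flag) : mapFlags r k (T.flagVar k f) = T'.flagVar k (r f) :=
  MvPolynomial.rename_X r f

/-- The image of a crossing under a map of flags. -/
def _root_.KhovanovRozansky.Crossing.map {F F' : Type} (r : F → F') (x : Crossing F) : Crossing F' :=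
  ⟨x.positive, r x.i, r x.j, r x.k, r x.l⟩

theorem map_edgeComplex (e : T.Flag × T.Flag) :
    Nonempty (SignedEquiv ((T.edgeComplex p e).map (mapFlags r k).toRingHom)
      (T'.edgeComplex p (Prod.map r r e))) := by
  have := SignedEquiv.mapArc (mapFlags r k) p (T.flagVar k e.2) (T.flagVar k e.1)
  rw [mapFlags_flagVar, mapFlags_flagVar] at this
  exact ⟨this⟩

theorem map_crossingComplex (x : Crossing T.Flag) :
    Nonempty (SignedEquiv ((T.crossingComplex p x).map (mapFlags r k).toRingHom)
      (T'.crossingComplex p (x.map r))) := by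
  have h1 := SignedEquiv.mapPositiveCrossing (mapFlags r k) p (T.flagVar k x.i) (T.flagVar k x.j)
    (T.flagVar k x.k) (T.flagVar k x.l)
  have h2 := SignedEquiv.mapNegativeCrossing (mapFlags r k) p (T.flagVar k x.i) (T.flagVar k x.j)
    (T.flagVar k x.k) (T.flagVar k x.l)
  simp only [mapFlags_flagVar] at h1 h2
  rw [crossingComplex, crossingComplex]
  change Nonempty (SignedEquiv _ (if x.positive = true then _ else _))
  split_ifs
  exacts [⟨h1⟩, ⟨h2⟩]

theorem map_factors (l : List (T.Flag × T.Flag)) (l' : List (Crossing T.Flag)) :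
    Nonempty (SignedEquiv
      ((tensorList (l.map (T.edgeComplex p) ++ l'.map (T.crossingComplex p))).map
        (mapFlags r k).toRingHom)
      (tensorList ((l.map (Prod.map r r)).map (T'.edgeComplex p) ++
        (l'.map (Crossing.map r)).map (T'.crossingComplex p)))) := by
  refine SignedEquiv.map_tensorList _ (List.rel_append ?_ ?_)
  · rw [List.map_map, List.forall₂_map_left_iff, List.forall₂_map_right_iff, List.forall₂_same]
    exact fun e _ => map_edgeComplex p r e
  · rw [List.map_map, List.forall₂_map_left_iff, List.forall₂_map_right_iff, List.forall₂_same]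
    exact fun x _ => map_crossingComplex p r x

end Map

/-- Base change of the factorization of a system of arcs to the ring of flags. -/
theorem baseChange_arcFactorization (arcs : List (T.End × T.End)) :
    Nonempty (SignedEquiv (baseChange (T.FlagRing k) (T.arcFactorization p arcs))
      (tensorList ((arcs.map (Prod.map T.endFlag T.endFlag)).map (T.edgeComplex p)))) := by
  have h1 := (SignedEquiv.singleList (arcs.map fun a =>
    arcFactor p (T.endVar k a.2) (T.endVar k a.1))).map (algebraMap (T.EndRing k) (T.FlagRing k))
  have h2 : Nonempty (SignedEquiv ((tensorList ((arcs.map fun a =>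
      arcFactor p (T.endVar k a.2) (T.endVar k a.1)).map single)).map
        (algebraMap (T.EndRing k) (T.FlagRing k)))
      (tensorList ((arcs.map (Prod.map T.endFlag T.endFlag)).map (T.edgeComplex p)))) := by
    refine SignedEquiv.map_tensorList _ ?_
    rw [List.map_map, List.map_map, List.forall₂_map_left_iff, List.forall₂_map_right_iff,
      List.forall₂_same]
    intro a _
    let φ : T.EndRing k →ₐ[k] T.FlagRing k :=
      (MvPolynomial.rename (R := k) T.endFlag : MvPolynomial T.End k →ₐ[k] MvPolynomial T.Flag k)
    have hφ (x : T.End) : φ (T.endVar k x) = T.flagVar k (T.endFlag x) :=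
      MvPolynomial.rename_X _ _
    have := SignedEquiv.mapArc φ p (T.endVar k a.2) (T.endVar k a.1)
    rw [hφ, hφ] at this
    exact ⟨this⟩
  exact h2.map fun h2 => h1.trans h2

variable (T) in
theorem edgeComplex_potential (e : T.Flag × T.Flag) : (T.edgeComplex p e).potential =
    Polynomial.aeval (T.flagVar k e.2) p - Polynomial.aeval (T.flagVar k e.1) p :=
  divDiff_mul p _ _

variable (T) in
theorem crossingComplex_potential (x : Crossing T.Flag) : (T.crossingComplex p x).potential =
    Polynomial.aeval (T.flagVar k x.i) p + Polynomial.aeval (T.flagVar k x.j) p -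
      Polynomial.aeval (T.flagVar k x.k) p - Polynomial.aeval (T.flagVar k x.l) p := by
  rw [crossingComplex]
  split_ifs
  · exact wideEdge_potential p _ _ _ _
  · exact (orientedSmoothing_potential p _ _ _ _).symm.trans (wideEdge_potential p _ _ _ _)

end Diagram

theorem MFComplex.tensorList_potential {S : Type u} [CommRing S] (l : List (MFComplex S)) :
    (tensorList l).potential = (l.map fun X => X.potential).sum := by
  induction l with
  | nil => rfl
  | cons X l ih => exact congrArg (X.potential + ·) ih

/-! ### Sorted lists -/

section Sorted

variable {n : ℕ}

theorem filter_lt_append_filter_gt {l : List (Fin n)} (hl : l.Pairwise (· < ·)) {x : Fin n}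
    (hx : x ∈ l) :
    l = l.filter (fun y => decide (y < x)) ++ x :: l.filter (fun y => decide (x < y)) := by
  induction l with
  | nil => exact absurd hx List.not_mem_nil
  | cons a l ih =>
    rw [List.pairwise_cons] at hl
    rcases List.mem_cons.1 hx with rfl | hx
    · rw [List.filter_cons_of_neg (by simp), List.filter_cons_of_neg (by simp),
        List.filter_eq_nil_iff.2 fun y hy => by simpa using (hl.1 y hy).le,
        List.filter_eq_self.2 fun y hy => by simpa using hl.1 y hy, List.nil_append]
    · have h := hl.1 x hx
      rw [List.filter_cons_of_pos (by simpa using h), List.filter_cons_of_neg (by simpa using h.le),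
        List.cons_append, ← ih hl.2 hx]

/-- A telescoping sum along a strand: `g x` is the value just after passing `x`, and `f` of the part
below `x` is the value just before. -/
theorem sum_filter_lt {M : Type u} [AddCommGroup M] {l : List (Fin n)} (hl : l.Pairwise (· < ·))
    (f : List (Fin n) → M) (g : Fin n → M) (hfg : ∀ l x, f (l ++ [x]) = g x) :
    (l.map fun x => g x - f (l.filter fun y => decide (y < x))).sum = f l - f [] := by
  induction l using List.reverseRecOn with
  | nil => simp
  | append_singleton l x ih =>
    rw [List.pairwise_append] at hl
    obtain ⟨h1, -, h2⟩ := hl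
    have h2 : ∀ y ∈ l, y < x := fun y hy => h2 y hy x List.mem_cons_self
    have e1 : (l ++ [x]).filter (fun y => decide (y < x)) = l := by
      rw [List.filter_append, List.filter_eq_self.2 fun y hy => by simpa using h2 y hy]
      simp
    have e2 : l.map (fun z => g z - f ((l ++ [x]).filter fun y => decide (y < z))) =
        l.map (fun z => g z - f (l.filter fun y => decide (y < z))) := by
      refine List.map_congr_left fun z hz => ?_
      rw [List.filter_append, List.filter_cons_of_neg (by simpa using (h2 z hz).le),
        List.filter_nil, List.append_nil]
    rw [List.map_append, List.sum_append, e2, ih h1, List.map_singleton, List.sum_singleton, e1,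
      hfg]
    abel

theorem flatMap_cons_perm {A B : Type*} (l : List A) (a : A → B) (f : A → List B) :
    (l.flatMap fun x => a x :: f x).Perm (l.flatMap f ++ l.map a) := by
  induction l with
  | nil => exact List.Perm.refl _
  | cons x l ih =>
    rw [List.flatMap_cons, List.flatMap_cons, List.map_cons, List.append_assoc, List.cons_append]
    exact ((ih.append_left _).cons _).trans
      (by rw [← List.append_assoc, ← List.append_assoc]; exact List.perm_middle.symm)

theorem sum_map_filter {A : Type*} {M : Type*} [AddCommMonoid M] (q : A → Bool) (f : A → M)
    (l : List A) : ((l.filter q).map f).sum = (l.map fun x => if q x then f x else 0).sum := by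
  induction l with
  | nil => rfl
  | cons x l ih =>
    rw [List.filter_cons, List.map_cons, List.sum_cons, ← ih]
    split_ifs
    · rw [List.map_cons, List.sum_cons]
    · rw [zero_add]

end Sorted

/-! ### Flags and edges of a braid diagram -/

namespace Braid

variable {d : ℕ} (w : List (BraidLetter d))

theorem crossingsAt_sorted (c : Fin d) : (crossingsAt w c).Pairwise (· < ·) :=
  (List.pairwise_lt_finRange _).filter _

variable {w}

theorem mem_crossingsAt {c : Fin d} {x : Fin w.length} :
    x ∈ crossingsAt w c ↔ (w.get x).left = c ∨ (w.get x).right = c := by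
  simp [crossingsAt, BraidLetter.touches]

theorem left_ne_right (a : BraidLetter d) : a.left ≠ a.right := by
  intro h
  have := congrArg Fin.val h
  simp [BraidLetter.left, BraidLetter.right] at this

theorem outFlag_left (x : Fin w.length) :
    outFlag w x (w.get x).left = (x, Corner.upperLeft) := by
  rw [outFlag, if_pos rfl]

theorem outFlag_right (x : Fin w.length) :
    outFlag w x (w.get x).right = (x, Corner.upperRight) := by
  rw [outFlag, if_neg (left_ne_right _)]

theorem corner_ne {x y : Fin w.length} {u v : Corner} (h : u ≠ v) :
    (Sum.inl (x, u) : BraidFlag w) ≠ Sum.inl (y, v) :=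
  fun e => h (congrArg Prod.snd (Sum.inl.inj e))

theorem strandTail_append_singleton (l : List (Fin w.length)) (x : Fin w.length) (c : Fin d) :
    strandTail w (l ++ [x]) c = Sum.inl (outFlag w x c) := by
  rw [strandTail, List.getLast?_concat]

theorem strandTail_cases (l : List (Fin w.length)) (c : Fin d) :
    strandTail w l c = Sum.inr (Sum.inl c) ∨
      ∃ y ∈ l, strandTail w l c = Sum.inl (outFlag w y c) := by
  rcases List.eq_nil_or_concat' l with rfl | ⟨l, x, rfl⟩
  · exact Or.inl rfl
  · exact Or.inr ⟨x, by simp, strandTail_append_singleton l x c⟩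

theorem strandTail_ne_lower (l : List (Fin w.length)) (c : Fin d) (x : Fin w.length) :
    strandTail w l c ≠ Sum.inl (x, Corner.lowerLeft) ∧
      strandTail w l c ≠ Sum.inl (x, Corner.lowerRight) := by
  rcases strandTail_cases l c with h | ⟨y, -, h⟩ <;> rw [h]
  · exact ⟨nofun, nofun⟩
  · rw [outFlag]
    split_ifs <;> simp

theorem strandTail_ne_top (l : List (Fin w.length)) (c c' : Fin d) :
    strandTail w l c ≠ Sum.inr (Sum.inr c') := by
  rcases strandTail_cases l c with h | ⟨y, -, h⟩ <;> rw [h] <;> nofun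

/-- A strand entering the crossing `y` comes from strictly below `y`. This acyclicity of open braids
is what allows the variables to be eliminated from top to bottom. -/
theorem strandTail_below_ne {x y : Fin w.length} (h : y ≤ x) (c : Fin d) (u : Corner) :
    strandTail w (crossingsBelow w y c) c ≠ Sum.inl (x, u) := by
  rcases strandTail_cases (crossingsBelow w y c) c with h' | ⟨z, hz, h'⟩ <;> rw [h']
  · nofun
  · have hz : z < y := by simpa using (List.mem_filter.1 hz).2
    intro e
    have e : outFlag w z c = (x, u) := Sum.inl.inj e
    have : z = x := congrArg Prod.fst e
    omega

variable (w)

/-- The crossing number `x` of the braid diagram. -/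
def crossing (x : Fin w.length) : Crossing (diagram w).Flag where
  positive := (w.get x).positive
  i := Sum.inl (x, Corner.upperLeft)
  j := Sum.inl (x, Corner.upperRight)
  k := Sum.inl (x, Corner.lowerRight)
  l := Sum.inl (x, Corner.lowerLeft)

/-- The edge of the braid diagram that enters the crossing number `x` from the lower left. -/
def leftEdge (x : Fin w.length) : (diagram w).Flag × (diagram w).Flag :=
  (strandTail w (crossingsBelow w x (w.get x).left) (w.get x).left, Sum.inl (x, Corner.lowerLeft))

/-- The edge of the braid diagram that enters the crossing number `x` from the lower right. -/
def rightEdge (x : Fin w.length) : (diagram w).Flag × (diagram w).Flag :=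
  (strandTail w (crossingsBelow w x (w.get x).right) (w.get x).right,
    Sum.inl (x, Corner.lowerRight))

/-- The edge of the braid diagram that ends at the top end point in position `c`. -/
def topEdge (c : Fin d) : (diagram w).Flag × (diagram w).Flag :=
  (strandTail w (crossingsAt w c) c, Sum.inr (Sum.inr c))

/-- The arc of the braid closure in position `c`. -/
def closureArc (c : Fin d) : (diagram w).Flag × (diagram w).Flag :=
  (Sum.inr (Sum.inr c), Sum.inr (Sum.inl c))

/-- The edges of the braid diagram that enter a crossing. -/
def lowerEdges : List ((diagram w).Flag × (diagram w).Flag) :=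
  (List.finRange w.length).flatMap fun x => [leftEdge w x, rightEdge w x]

theorem diagram_edges : (diagram w).edges = lowerEdges w ++ (List.finRange d).map (topEdge w) := rfl

theorem diagram_crossings : (diagram w).crossings = (List.finRange w.length).map (crossing w) := rfl

open MFComplex Diagram

variable {k : Type u} [CommRing k] (p : Polynomial k)

/-! ### The complex of a braid is contractible in negative degrees -/

/-- The factors of the complex of a braid at the crossing number `x`, with scalars for which they
are contractible. -/
def crossingFactors (x : Fin w.length) :
    List (MFComplex ((diagram w).FlagRing k) × Subring ((diagram w).FlagRing k)) :=
  [((diagram w).crossingComplex p (crossing w x),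
      (diagram w).avoiding k {(crossing w x).i, (crossing w x).j}),
    ((diagram w).edgeComplex p (leftEdge w x), (diagram w).avoiding k {(leftEdge w x).2}),
    ((diagram w).edgeComplex p (rightEdge w x), (diagram w).avoiding k {(rightEdge w x).2})]

/-- The factors of the complex of a braid, from top to bottom, with scalars for which they are
contractible. -/
def orderedFactors :
    List (MFComplex ((diagram w).FlagRing k) × Subring ((diagram w).FlagRing k)) :=
  ((List.finRange d).map fun c => ((diagram w).edgeComplex p (topEdge w c),
    (diagram w).avoiding k {(topEdge w c).2})) ++
  (List.finRange w.length).reverse.flatMap (crossingFactors w p)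

theorem orderedFactors_perm : ((orderedFactors w p).map Prod.fst).Perm
    ((diagram w).edges.map ((diagram w).edgeComplex p) ++
      (diagram w).crossings.map ((diagram w).crossingComplex p)) := by
  rw [orderedFactors, diagram_edges, diagram_crossings, lowerEdges]
  simp only [List.map_append, List.map_map, List.map_flatMap]
  refine List.perm_append_comm.trans ?_
  refine ((((List.reverse_perm _).flatMap_right _).trans (flatMap_cons_perm _
    (fun x => (diagram w).crossingComplex p (crossing w x))
    (fun x => [(diagram w).edgeComplex p (leftEdge w x),
      (diagram w).edgeComplex p (rightEdge w x)]))).append_right _).trans ?_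
  rw [List.append_assoc, List.append_assoc]
  exact List.perm_append_comm.append_left _

theorem orderedFactors_contraction : ∀ X ∈ orderedFactors w p,
    Nonempty (X.1.Contraction (X.2 : Set ((diagram w).FlagRing k))) := by
  intro X hX
  rcases List.mem_append.1 hX with hX | hX
  · obtain ⟨c, -, rfl⟩ := List.mem_map.1 hX
    exact edgeComplex_contraction p (strandTail_ne_top _ _ _)
  · obtain ⟨x, -, hX⟩ := List.mem_flatMap.1 hX
    simp only [crossingFactors, List.mem_cons, List.not_mem_nil, or_false] at hX
    rcases hX with rfl | rfl | rfl
    · refine crossingComplex_contraction p ?_ ?_ ?_ ?_ ?_ <;> exact corner_ne nofun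
    · exact edgeComplex_contraction p (strandTail_ne_lower _ _ _).1
    · exact edgeComplex_contraction p (strandTail_ne_lower _ _ _).2

theorem crossingFactors_dp_mem {W : Set (diagram w).Flag} {x : Fin w.length}
    (hW : ∀ u, Sum.inl (x, u) ∉ W) (hl : (leftEdge w x).1 ∉ W) (hr : (rightEdge w x).1 ∉ W)
    {Y} (hY : Y ∈ crossingFactors w p x) :
    ∀ b a, Y.1.dp b a ∈ (diagram w).avoiding k W := by
  simp only [crossingFactors, List.mem_cons, List.not_mem_nil, or_false] at hY
  rcases hY with rfl | rfl | rfl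
  · exact crossingComplex_dp_mem p (hW _) (hW _) (hW _) (hW _)
  · exact edgeComplex_dp_mem p hl (hW _)
  · exact edgeComplex_dp_mem p hr (hW _)

/-- The crossing eliminates its two upper flags, which do not occur on the two edges entering it;
the left edge eliminates the lower left flag, which does not occur on the right edge. -/
theorem crossingFactors_pairwise (x : Fin w.length) :
    (crossingFactors w p x).Pairwise fun X Y => ∀ b a, Y.1.dp b a ∈ X.2 := by
  have hl := strandTail_below_ne (le_refl x) (w.get x).left
  have hr := strandTail_below_ne (le_refl x) (w.get x).right
  rw [crossingFactors, List.pairwise_cons, List.pairwise_cons]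
  refine ⟨?_, ?_, List.pairwise_singleton _ _⟩
  · intro Y hY
    simp only [List.mem_cons, List.not_mem_nil, or_false] at hY
    rcases hY with rfl | rfl
    · refine edgeComplex_dp_mem p ?_ ?_
      · rintro (h | h)
        exacts [hl _ h, hl _ h]
      · rintro (h | h)
        exacts [corner_ne (u := Corner.lowerLeft) (v := Corner.upperLeft) nofun h,
          corner_ne (u := Corner.lowerLeft) (v := Corner.upperRight) nofun h]
    · refine edgeComplex_dp_mem p ?_ ?_
      · rintro (h | h)
        exacts [hr _ h, hr _ h]
      · rintro (h | h)
        exacts [corner_ne (u := Corner.lowerRight) (v := Corner.upperLeft) nofun h,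
          corner_ne (u := Corner.lowerRight) (v := Corner.upperRight) nofun h]
  · intro Y hY
    rw [List.mem_singleton] at hY
    subst hY
    exact edgeComplex_dp_mem p (hr _) (corner_ne nofun)

/-- Each factor eliminates the flags at the heads of edges, or the upper flags of a crossing, and
everything later in the list lies below these flags or beside them. -/
theorem orderedFactors_pairwise :
    (orderedFactors w p).Pairwise fun X Y => ∀ b a, Y.1.dp b a ∈ X.2 := by
  rw [orderedFactors, List.pairwise_append]
  refine ⟨?_, ?_, ?_⟩
  · rw [List.pairwise_map]
    refine (List.nodup_finRange d).imp fun {c c'} hc => ?_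
    refine edgeComplex_dp_mem p (strandTail_ne_top _ _ _) fun h => ?_
    exact hc (Sum.inr.inj (Sum.inr.inj (Set.mem_singleton_iff.1 h))).symm
  · rw [List.pairwise_flatMap]
    refine ⟨fun x _ => crossingFactors_pairwise w p x, ?_⟩
    rw [List.pairwise_reverse]
    refine (List.pairwise_lt_finRange _).imp fun {y x} hyx X hX Y hY => ?_
    -- The factors at a crossing `y < x` involve flags at `y` and tails from below `y`, hence no
    -- flag at `x`.
    have key (u : Corner) : ∀ b a, Y.1.dp b a ∈ (diagram w).avoiding k {Sum.inl (x, u)} := by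
      refine crossingFactors_dp_mem w p ?_ (strandTail_below_ne hyx.le _ _)
        (strandTail_below_ne hyx.le _ _) hY
      intro v h
      have : y = x := congrArg Prod.fst (Sum.inl.inj (Set.mem_singleton_iff.1 h))
      omega
    have key' : ∀ b a, Y.1.dp b a ∈
        (diagram w).avoiding k {(crossing w x).i, (crossing w x).j} := by
      refine crossingFactors_dp_mem w p ?_ ?_ ?_ hY
      · rintro v (h | h)
        all_goals
          have : y = x := congrArg Prod.fst (Sum.inl.inj h)
          omega
      · rintro (h | h)
        exacts [strandTail_below_ne hyx.le _ _ h, strandTail_below_ne hyx.le _ _ h]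
      · rintro (h | h)
        exacts [strandTail_below_ne hyx.le _ _ h, strandTail_below_ne hyx.le _ _ h]
    simp only [crossingFactors, List.mem_cons, List.not_mem_nil, or_false] at hX
    rcases hX with rfl | rfl | rfl
    exacts [key', key _, key _]
  · intro X hX Y hY
    obtain ⟨c, -, rfl⟩ := List.mem_map.1 hX
    obtain ⟨x, -, hY⟩ := List.mem_flatMap.1 hY
    exact crossingFactors_dp_mem w p (fun _ => Sum.inl_ne_inr) (strandTail_ne_top _ _ _)
      (strandTail_ne_top _ _ _) hY

/-- The positive complex of the whole braid is a resolution of the naive complex in each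
cohomological degree. No linearity of the homotopy is retained, as none is needed to apply the
comparison principle. -/
theorem KR_contraction : Nonempty (((diagram w).KR p).Contraction ∅) := by
  obtain ⟨c⟩ := tensorList_contraction _ (orderedFactors_contraction w p)
    (orderedFactors_pairwise w p)
  exact (SignedEquiv.tensorList_perm (orderedFactors_perm w p)).map fun h => h.contraction c

/-! ### The potential -/

variable {w} in
-- The contributions of pairs of a crossing and a position through which it passes are summed in
-- both orders: by positions they telescope, and by crossings each crossing contributes its two
-- strands.
theorem sum_strand {M : Type u} [AddCommGroup M] (P : BraidFlag w → M) :
    ((List.finRange w.length).map fun x =>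
      (P (Sum.inl (x, Corner.upperLeft)) - P (leftEdge w x).1) +
        (P (Sum.inl (x, Corner.upperRight)) - P (rightEdge w x).1)).sum =
    ((List.finRange d).map fun c => P (topEdge w c).1 - P (Sum.inr (Sum.inl c))).sum := by
  have h1 (c : Fin d) : P (topEdge w c).1 - P (Sum.inr (Sum.inl c)) =
      ∑ x, if (w.get x).touches c then
        P (Sum.inl (outFlag w x c)) - P (strandTail w (crossingsBelow w x c) c) else 0 := by
    have := sum_filter_lt (crossingsAt_sorted w c) (fun l => P (strandTail w l c))
      (fun x => P (Sum.inl (outFlag w x c))) fun l x => by rw [strandTail_append_singleton]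
    refine this.symm.trans ((sum_map_filter _ _ _).trans (Fin.sum_univ_def _).symm)
  have h2 (x : Fin w.length) : (P (Sum.inl (x, Corner.upperLeft)) - P (leftEdge w x).1) +
        (P (Sum.inl (x, Corner.upperRight)) - P (rightEdge w x).1) =
      ∑ c, if (w.get x).touches c then
        P (Sum.inl (outFlag w x c)) - P (strandTail w (crossingsBelow w x c) c) else 0 := by
    -- The left and right positions are distinct, so the sum over touched positions has exactly two
    -- terms.
    have h (c : Fin d) : (if (w.get x).touches c then
        P (Sum.inl (outFlag w x c)) - P (strandTail w (crossingsBelow w x c) c) else 0) =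
        (if (w.get x).left = c then
          P (Sum.inl (outFlag w x c)) - P (strandTail w (crossingsBelow w x c) c) else 0) +
        if (w.get x).right = c then
          P (Sum.inl (outFlag w x c)) - P (strandTail w (crossingsBelow w x c) c) else 0 := by
      have := left_ne_right (w.get x)
      by_cases hl : (w.get x).left = c
      · have hr : (w.get x).right ≠ c := fun hr => this (hl.trans hr.symm)
        rw [if_pos hl, if_neg hr, add_zero, if_pos (by simp only [BraidLetter.touches, hl, true_or, decide_true])]
      · rw [if_neg hl, zero_add]
        simp only [BraidLetter.touches, hl, false_or, decide_eq_true_eq]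
    simp only [h]
    rw [Finset.sum_add_distrib, Finset.sum_ite_eq, Finset.sum_ite_eq, if_pos (Finset.mem_univ _),
      if_pos (Finset.mem_univ _), outFlag_left, outFlag_right]
    rfl
  simp only [h1, h2]
  rw [← Fin.sum_univ_def, ← Fin.sum_univ_def, Finset.sum_comm]

/-- The potentials of a closed braid cancel. -/
theorem potential_eq_zero : (tensorList (((diagram w).edges.map ((diagram w).edgeComplex p) ++
    (diagram w).crossings.map ((diagram w).crossingComplex p)) ++
    ((List.finRange d).map (closureArc w)).map ((diagram w).edgeComplex p))).potential = 0 := by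
  set P : BraidFlag w → (diagram w).FlagRing k := fun f =>
    Polynomial.aeval ((diagram w).flagVar k f) p with hP
  have h := sum_strand P
  have h1 (l : List ((diagram w).Flag × (diagram w).Flag)) :
      ((l.map ((diagram w).edgeComplex p)).map fun X => X.potential).sum =
        (l.map fun e => P e.2 - P e.1).sum := by
    rw [List.map_map]
    exact congrArg List.sum (List.map_congr_left fun e _ => edgeComplex_potential _ p e)
  have h2 : ((((List.finRange w.length).map (crossing w)).map ((diagram w).crossingComplex p)).map
      fun X => X.potential).sum = ((List.finRange w.length).map fun x =>
        P (Sum.inl (x, Corner.upperLeft)) + P (Sum.inl (x, Corner.upperRight)) -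
          P (Sum.inl (x, Corner.lowerRight)) - P (Sum.inl (x, Corner.lowerLeft))).sum := by
    rw [List.map_map, List.map_map]
    exact congrArg List.sum (List.map_congr_left fun x _ => crossingComplex_potential _ p _)
  have h3 : ((lowerEdges w).map fun e => P e.2 - P e.1).sum =
      ((List.finRange w.length).map fun x => (P (leftEdge w x).2 - P (leftEdge w x).1) +
        (P (rightEdge w x).2 - P (rightEdge w x).1)).sum := by
    rw [lowerEdges]
    induction List.finRange w.length with
    | nil => rfl
    | cons x l ih =>
      rw [List.flatMap_cons, List.map_append, List.sum_append, ih, List.map_cons, List.map_cons,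
        List.sum_cons, List.sum_cons, List.map_cons, List.sum_cons, List.map_nil, List.sum_nil,
        add_zero]
  rw [tensorList_potential, List.map_append, List.map_append, List.sum_append, List.sum_append,
    h1, h1, diagram_crossings, h2, diagram_edges, List.map_append, List.sum_append, h3,
    List.map_map, List.map_map]
  simp only [← Fin.sum_univ_def, Function.comp_apply] at h ⊢
  -- Abstracting the values of `p` at the flags to arbitrary families leaves a linear identity: the
  -- lower corners and the top points cancel, and the rest is the telescoping identity `h`.
  have key (ul ur ll lr tl tr : Fin w.length → (diagram w).FlagRing k)
      (t t' b : Fin d → (diagram w).FlagRing k)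
      (h : ∑ x, (ul x - tl x + (ur x - tr x)) = ∑ c, (t c - b c)) :
      ∑ x, (ll x - tl x + (lr x - tr x)) + ∑ c, (t' c - t c) +
        ∑ x, (ul x + ur x - lr x - ll x) + ∑ c, (b c - t' c) = 0 := by
    simp only [Finset.sum_add_distrib, Finset.sum_sub_distrib] at h ⊢
    linear_combination h
  exact key _ _ (fun x => P (leftEdge w x).2) (fun x => P (rightEdge w x).2) _ _ _
    (fun c => P (topEdge w c).2) _ h

end Braid

namespace Braid

open MFComplex Diagram

variable {d : ℕ} (w : List (BraidLetter d))

/-! ### Identification of the flags of a braid that are joined in the closure -/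

/-- The flag of the closed diagram at which the strand of the closure in position `c` starts. -/
def closureStart (c : Fin d) : ClosureFlag w :=
  if h : crossingsAt w c = [] then Sum.inr ⟨c, h⟩
  else Sum.inl (outFlag w ((crossingsAt w c).getLast h) c)

/-- The flag of the closed diagram that replaces a flag of the braid diagram. -/
def closeFlag : (diagram w).Flag → (closure w).Flag :=
  Sum.elim Sum.inl (Sum.elim (closureStart w) (closureStart w))

/-- The flags of the closed diagram as flags of the braid diagram. -/
def openFlag : (closure w).Flag → (diagram w).Flag :=
  Sum.elim Sum.inl fun c => Sum.inr (Sum.inr c.1)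

theorem closeFlag_openFlag : Function.LeftInverse (closeFlag w) (openFlag w) := by
  rintro (f | ⟨c, hc⟩)
  · rfl
  · exact dif_pos hc

/-- The positions of the strands that pass through a crossing. -/
def crossedPositions : List (Fin d) := (List.finRange d).filter fun c => crossingsAt w c ≠ []

/-- The positions of the strands without crossings. -/
def freePositions : List (Fin d) := (List.finRange d).filter fun c => ¬ crossingsAt w c ≠ []

/-- The edges and arcs whose two flags are identified in the closed diagram. -/
def eliminatedEdges : List ((diagram w).Flag × (diagram w).Flag) :=
  (List.finRange d).map (closureArc w) ++ (crossedPositions w).map (topEdge w)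

/-- The edges of the braid diagram that remain in the closed diagram. -/
def remainingEdges : List ((diagram w).Flag × (diagram w).Flag) :=
  lowerEdges w ++ (freePositions w).map (topEdge w)

variable {w}

theorem endFlag_closureArcs :
    (closureArcs w).map (Prod.map (diagram w).endFlag (diagram w).endFlag) =
      (List.finRange d).map (closureArc w) := by
  rw [closureArcs, List.map_map]
  rfl

theorem strandTail_crossingsAt {c : Fin d} (h : crossingsAt w c ≠ []) :
    strandTail w (crossingsAt w c) c = Sum.inl (outFlag w ((crossingsAt w c).getLast h) c) := by
  conv_lhs => rw [← List.dropLast_append_getLast h]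
  exact strandTail_append_singleton _ _ _

theorem closureStart_of_ne_nil {c : Fin d} (h : crossingsAt w c ≠ []) :
    closureStart w c = Sum.inl (outFlag w ((crossingsAt w c).getLast h) c) := dif_neg h

theorem closeFlag_topEdge (c : Fin d) : closeFlag w (topEdge w c).1 = closureStart w c := by
  by_cases h : crossingsAt w c = []
  · change closeFlag w (strandTail w (crossingsAt w c) c) = _
    rw [h]
    rfl
  · rw [closureStart_of_ne_nil h]
    exact congrArg (closeFlag w) (strandTail_crossingsAt h)

theorem closeFlag_eliminated {e} (he : e ∈ eliminatedEdges w) :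
    closeFlag w e.2 = closeFlag w e.1 := by
  rcases List.mem_append.1 he with he | he
  · obtain ⟨c, -, rfl⟩ := List.mem_map.1 he
    rfl
  · obtain ⟨c, -, rfl⟩ := List.mem_map.1 he
    exact (closeFlag_topEdge c).symm

/-- If there is a crossing below `x` in position `c`, the last such crossing is also its cyclic
predecessor. Otherwise the strand starts at the bottom end point, which the closure identifies with
the exit of the topmost crossing of that position. -/
theorem closeFlag_strandTail_below {x : Fin w.length} {c : Fin d}
    (h : x ∈ crossingsAt w c) :
    closeFlag w (strandTail w (crossingsBelow w x c) c) =
      Sum.inl (outFlag w (cyclicPrevious w x c) c) := by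
  have hs := filter_lt_append_filter_gt (crossingsAt_sorted w c) h
  change crossingsAt w c = crossingsBelow w x c ++ x :: crossingsAbove w x c at hs
  rw [cyclicPrevious]
  -- In the first case the list at `c` is `x` followed by the crossings above it, and its last entry
  -- is `x` itself when nothing lies above; this is the default value in `cyclicPrevious`.
  rcases List.eq_nil_or_concat' (crossingsBelow w x c) with hb | ⟨l, y, hb⟩
  · rw [hb, List.nil_append] at hs
    rw [hb, List.append_nil]
    have hne : crossingsAt w c ≠ [] := by rw [hs]; exact List.cons_ne_nil _ _
    refine (closureStart_of_ne_nil hne).trans ?_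
    congr 2
    exact (List.getLast_congr hne (List.cons_ne_nil _ _) hs).trans (List.getLast_eq_getLastD ..)
  · rw [hb, strandTail_append_singleton, ← List.append_assoc, List.getLastD_concat]
    rfl

/-- A strand without crossings keeps its edge from bottom to top, and the identification of its end
points turns this edge into the loop at the marked point. -/
theorem closeFlag_remainingEdges : (remainingEdges w).map (Prod.map (closeFlag w) (closeFlag w)) =
    (closure w).edges := by
  rw [remainingEdges, List.map_append]
  refine congrArg₂ (· ++ ·) ?_ ?_
  · rw [lowerEdges, List.map_flatMap]
    refine List.flatMap_congr fun x _ => ?_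
    refine congrArg₂ (fun a b => [a, b]) ?_ ?_
    · exact Prod.ext (closeFlag_strandTail_below (mem_crossingsAt.2 (Or.inl rfl))) rfl
    · exact Prod.ext (closeFlag_strandTail_below (mem_crossingsAt.2 (Or.inr rfl))) rfl
  · rw [freePositions, List.map_map]
    induction List.finRange d with
    | nil => rfl
    | cons c l ih =>
      rw [List.filterMap_cons, List.filter_cons]
      by_cases h : crossingsAt w c = []
      · rw [if_pos (by simpa using h), dif_pos h, List.map_cons, ih]
        refine congrArg (· :: _) (Prod.ext ?_ ?_)
        · exact (closeFlag_topEdge c).trans (dif_pos h)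
        · exact dif_pos h
      · rw [if_neg (by simpa using h), dif_neg h, ih]

theorem closeFlag_crossings : (diagram w).crossings.map (Crossing.map (closeFlag w)) =
    (closure w).crossings := by
  rw [diagram_crossings, List.map_map]
  rfl

variable (w) {k : Type u} [CommRing k] (p : Polynomial k)

/-- The Koszul factorization of the eliminated edges and arcs. -/
def elimination : MatFac ((diagram w).FlagRing k) :=
  MatFac.koszulList ((eliminatedEdges w).map fun e =>
    ((diagram w).flagVar k e.2 - (diagram w).flagVar k e.1,
      divDiff p ((diagram w).flagVar k e.2) ((diagram w).flagVar k e.1), 2))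

/-- The tensor product of the factors that remain in the closed diagram. -/
def remaining : MFComplex ((diagram w).FlagRing k) :=
  tensorList ((remainingEdges w).map ((diagram w).edgeComplex p) ++
    (diagram w).crossings.map ((diagram w).crossingComplex p))

theorem single_elimination : Nonempty (SignedEquiv (single (elimination w p))
    (tensorList ((eliminatedEdges w).map ((diagram w).edgeComplex p)))) := by
  have h : ((eliminatedEdges w).map fun e =>
      arcFactor p ((diagram w).flagVar k e.2) ((diagram w).flagVar k e.1)).foldr
        MatFac.tensor MatFac.unit = elimination w p := by
    rw [elimination, MatFac.koszulList, List.map_map]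
    rfl
  have := SignedEquiv.singleList ((eliminatedEdges w).map fun e =>
    arcFactor p ((diagram w).flagVar k e.2) ((diagram w).flagVar k e.1))
  rw [h, List.map_map] at this
  exact ⟨this⟩

/-- The arcs eliminate the bottom points, then the final edges eliminate the top points. The latter
edges belong to strands with crossings, so their tails are corners and they involve no bottom point.
-/
theorem eliminatedEdges_contraction :
    Nonempty ((tensorList ((eliminatedEdges w).map ((diagram w).edgeComplex p))).Contraction ∅) := by
  have := tensorList_contraction ((eliminatedEdges w).map fun e =>
    ((diagram w).edgeComplex p e, (diagram w).avoiding k {e.2})) ?_ ?_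
  · rw [List.map_map] at this
    exact this
  · intro X hX
    obtain ⟨e, he, rfl⟩ := List.mem_map.1 hX
    refine edgeComplex_contraction p ?_
    rcases List.mem_append.1 he with he | he
    · obtain ⟨c, -, rfl⟩ := List.mem_map.1 he
      exact fun h => Sum.inr_ne_inl (Sum.inr.inj h)
    · obtain ⟨c, -, rfl⟩ := List.mem_map.1 he
      exact strandTail_ne_top _ _ _
  · rw [List.pairwise_map, eliminatedEdges, List.pairwise_append, List.pairwise_map,
      List.pairwise_map]
    refine ⟨(List.nodup_finRange d).imp fun {c c'} hc => ?_,
      ((List.nodup_finRange d).filter _).imp fun {c c'} hc => ?_, ?_⟩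
    · refine edgeComplex_dp_mem p ?_ ?_
      · exact fun h => Sum.inr_ne_inl (Sum.inr.inj (Set.mem_singleton_iff.1 h))
      · exact fun h => hc (Sum.inl.inj (Sum.inr.inj (Set.mem_singleton_iff.1 h))).symm
    · refine edgeComplex_dp_mem p (strandTail_ne_top _ _ _) fun h => ?_
      exact hc (Sum.inr.inj (Sum.inr.inj (Set.mem_singleton_iff.1 h))).symm
    · intro e he e' he'
      obtain ⟨c, -, rfl⟩ := List.mem_map.1 he
      obtain ⟨c', hc', rfl⟩ := List.mem_map.1 he'
      have hc' : crossingsAt w c' ≠ [] := by simpa using (List.mem_filter.1 hc').2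
      refine edgeComplex_dp_mem p ?_ ?_
      · intro h
        exact Sum.inl_ne_inr ((strandTail_crossingsAt hc').symm.trans (Set.mem_singleton_iff.1 h))
      · exact fun h => Sum.inr_ne_inl (Sum.inr.inj (Set.mem_singleton_iff.1 h))

theorem elimination_homogeneous (γ : GradingDatum p) :
    (elimination w p).Homogeneous ((diagram w).scalarGrading k (2 • γ.α)) γ.α γ.β := by
  rw [elimination, MatFac.koszulList, List.map_map]
  induction eliminatedEdges w with
  | nil => exact MatFac.Homogeneous.unit
  | cons e l ih =>
    exact MatFac.Homogeneous.tensor ((diagram w).edgeComplex_homogeneous p γ e) ih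

/-- The variables identified in the closed diagram generate the kernel of the quotient map. -/
theorem mapFlags_closeFlag_eq_zero_iff (s : (diagram w).FlagRing k) :
    mapFlags (closeFlag w) k s = 0 ↔ s ∈ Ideal.span {x | x ∈ (eliminatedEdges w).map fun e =>
      (diagram w).flagVar k e.2 - (diagram w).flagVar k e.1} := by
  set I := Ideal.span {x | x ∈ (eliminatedEdges w).map fun e =>
      (diagram w).flagVar k e.2 - (diagram w).flagVar k e.1} with hI
  have mem {e} (he : e ∈ eliminatedEdges w) :
      (diagram w).flagVar k e.2 - (diagram w).flagVar k e.1 ∈ I :=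
    Ideal.subset_span (List.mem_map.2 ⟨e, he, rfl⟩)
  -- Without crossings the top point is itself the chosen representative; otherwise its final edge
  -- identifies it with the exit of the last crossing.
  have top (c : Fin d) : (diagram w).flagVar k (Sum.inr (Sum.inr c)) -
      (diagram w).flagVar k (openFlag w (closureStart w c)) ∈ I := by
    by_cases h : crossingsAt w c = []
    · rw [closureStart, dif_pos h]
      exact (sub_self ((diagram w).flagVar k (Sum.inr (Sum.inr c)))).symm ▸ zero_mem I
    · have := mem (List.mem_append_right _ (List.mem_map_of_mem (f := topEdge w)
        (List.mem_filter.2 ⟨List.mem_finRange c, by simpa using h⟩)))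
      rw [closureStart_of_ne_nil h]
      refine Eq.mp (congrArg (fun f => (diagram w).flagVar k (Sum.inr (Sum.inr c)) -
        (diagram w).flagVar k f ∈ I) (strandTail_crossingsAt h)) this
  refine rename_eq_zero_iff (r := closeFlag w) (s := openFlag w) I ?_ ?_ s
  · rintro (f | c | c)
    · exact (sub_self ((diagram w).flagVar k (Sum.inl f))).symm ▸ zero_mem I
    · have := add_mem (mem (List.mem_append_left _ (List.mem_map_of_mem (f := closureArc w)
        (List.mem_finRange c)))) (top c)
      rwa [closureArc, sub_add_sub_cancel] at this
    · exact top c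
  · intro x hx
    have : I ≤ RingHom.ker (mapFlags (closeFlag w) k) := by
      rw [hI, Ideal.span_le]
      intro y hy
      obtain ⟨e, he, rfl⟩ := List.mem_map.1 hy
      change mapFlags (closeFlag w) k _ = 0
      rw [map_sub, mapFlags_flagVar, mapFlags_flagVar, closeFlag_eliminated he, sub_self]
    exact this hx

/-- Both sides are tensor products of the same edges, arcs and crossings: the final edges split into
those of strands with crossings, which are eliminated, and those of free strands, which remain. -/
theorem elimination_equiv : Nonempty (SignedEquiv
    (((diagram w).KR p).tensor (baseChange ((diagram w).FlagRing k)
      ((diagram w).arcFactorization p (closureArcs w))))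
    ((single (elimination w p)).tensor (remaining w p))) := by
  obtain ⟨h1⟩ := baseChange_arcFactorization (T := diagram w) p (closureArcs w)
  obtain ⟨h2⟩ := single_elimination w p
  have h3 := SignedEquiv.tensorListAppend
    ((diagram w).edges.map ((diagram w).edgeComplex p) ++
      (diagram w).crossings.map ((diagram w).crossingComplex p))
    (((closureArcs w).map (Prod.map (diagram w).endFlag (diagram w).endFlag)).map
      ((diagram w).edgeComplex p))
  have h4 := SignedEquiv.tensorListAppend ((eliminatedEdges w).map ((diagram w).edgeComplex p))
    ((remainingEdges w).map ((diagram w).edgeComplex p) ++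
      (diagram w).crossings.map ((diagram w).crossingComplex p))
  obtain ⟨h5⟩ := SignedEquiv.tensorList_perm (show List.Perm
    ((diagram w).edges.map ((diagram w).edgeComplex p) ++
      (diagram w).crossings.map ((diagram w).crossingComplex p) ++
      ((closureArcs w).map (Prod.map (diagram w).endFlag (diagram w).endFlag)).map
        ((diagram w).edgeComplex p))
    ((eliminatedEdges w).map ((diagram w).edgeComplex p) ++
      ((remainingEdges w).map ((diagram w).edgeComplex p) ++
        (diagram w).crossings.map ((diagram w).crossingComplex p))) by
    rw [endFlag_closureArcs, eliminatedEdges, remainingEdges, diagram_edges]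
    simp only [List.map_append, List.append_assoc]
    have hc : ((List.finRange d).map (topEdge w)).Perm
        ((crossedPositions w).map (topEdge w) ++ (freePositions w).map (topEdge w)) := by
      rw [← List.map_append]
      refine List.Perm.map _ ?_
      have := List.filter_append_perm (fun c => decide (crossingsAt w c ≠ [])) (List.finRange d)
      simpa [crossedPositions, freePositions] using this.symm
    -- In the commutative monoid of multisets the rearrangement is a purely additive identity.
    have hc' := Multiset.coe_eq_coe.2 (hc.map ((diagram w).edgeComplex (k := k) p))
    rw [List.map_append, ← Multiset.coe_add] at hc'
    rw [← Multiset.coe_eq_coe]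
    simp only [← Multiset.coe_add]
    rw [hc']
    abel)
  exact ⟨((SignedEquiv.refl _).tensor h1).trans (h3.symm.trans (h5.trans (h4.trans
    (h2.symm.tensor (SignedEquiv.refl _)))))⟩

theorem closure_equiv : Nonempty (SignedEquiv
    ((remaining w p).map (mapFlags (closeFlag w) k).toRingHom) ((closure w).KR p)) := by
  have := map_factors p (closeFlag w) (remainingEdges w) (diagram w).crossings
  rw [closeFlag_remainingEdges, closeFlag_crossings] at this
  exact this

theorem naiveArcs_homologyEquiv :
    DiffComplex.HomologyEquiv ((diagram w).naiveArcs p (closureArcs w))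
      (((closure w).KR p).toDiffComplex k)
      (fun (i : Σ γ : GradingDatum p, γ.G) j => ((diagram w).KR p).naiveTensorPiece k
        ((diagram w).EndRing k) ((diagram w).arcFactorization p (closureArcs w))
        ((diagram w).flagGrading k (2 • i.1.α)) ((diagram w).endGrading k (2 • i.1.α))
        i.1.α i.1.β j i.2)
      (fun i j => ((closure w).KR p).termPiece k ((closure w).flagGrading k (2 • i.1.α))
        i.1.α i.1.β j i.2) := by
  obtain ⟨c⟩ := KR_contraction w p
  obtain ⟨h⟩ := elimination_equiv w p
  obtain ⟨c'⟩ := eliminatedEdges_contraction w p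
  obtain ⟨h'⟩ := single_elimination w p
  obtain ⟨h''⟩ := closure_equiv w p
  have hpot : (((diagram w).KR p).tensor (baseChange ((diagram w).FlagRing k)
      ((diagram w).arcFactorization p (closureArcs w)))).potential = 0 := by
    obtain ⟨h1⟩ := baseChange_arcFactorization (T := diagram w) p (closureArcs w)
    have h3 := SignedEquiv.tensorListAppend
      ((diagram w).edges.map ((diagram w).edgeComplex p) ++
        (diagram w).crossings.map ((diagram w).crossingComplex p))
      (((closureArcs w).map (Prod.map (diagram w).endFlag (diagram w).endFlag)).map
        ((diagram w).edgeComplex p))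
    have h4 := (((SignedEquiv.refl ((diagram w).KR p)).tensor h1).trans h3.symm).potential
    rw [endFlag_closureArcs] at h4
    exact h4.symm.trans (potential_eq_zero w p)
  have e1 := naiveTensor_homologyEquiv (k := k) (p := p) c hpot
    (fun γ => (diagram w).scalarGrading k (2 • γ.α))
    (fun γ => (diagram w).endScalarGrading k (2 • γ.α))
    (fun γ => (diagram w).algebraMap_mem _)
    (fun γ => (diagram w).factors_homogeneous p γ _ _)
    (fun γ b a => by
      have := (diagram w).arcFactorization_homogeneous p γ (closureArcs w) b a
      exact ⟨(diagram w).algebraMap_mem _ _ _ this.1, (diagram w).algebraMap_mem _ _ _ this.2⟩)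
  have e2 := h.homologyEquiv k (I := Σ γ : GradingDatum p, γ.G)
    (fun i => (diagram w).flagGrading k (2 • i.1.α)) (fun i => i.1.α) (fun i => i.1.β)
    (fun i => i.2)
  obtain ⟨bot, hb1, hb2, hb3, hb4⟩ := MatFac.exists_koszulList_bot
    ((eliminatedEdges w).map fun e =>
      ((diagram w).flagVar k e.2 - (diagram w).flagVar k e.1,
        divDiff p ((diagram w).flagVar k e.2) ((diagram w).flagVar k e.1), 2))
  have hsurj : Function.Surjective (mapFlags (closeFlag w) k) :=
    MvPolynomial.rename_surjective _ (closeFlag_openFlag w).surjective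
  have e3 := quotient_homologyEquiv (φ := mapFlags (closeFlag w) k) (E := elimination w p)
    (Y := remaining w p) (bot := bot) (p := p) (h'.symm.contraction c')
    (h.potential.trans hpot) hb1 hb2 (fun s => by
      rw [mapFlags_closeFlag_eq_zero_iff]
      have := hb4 s
      rw [List.map_map] at this
      exact this.symm) hsurj
    (fun γ => (diagram w).scalarGrading k (2 • γ.α))
    (fun γ => (closure w).scalarGrading k (2 • γ.α))
    (fun γ g => map_rename_weightGrading (closeFlag_openFlag w) _ g)
    (elimination_homogeneous w p) (fun γ => (diagram w).factors_homogeneous p γ _ _)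
  have e4 := h''.homologyEquiv k (I := Σ γ : GradingDatum p, γ.G)
    (fun i => (closure w).flagGrading k (2 • i.1.α)) (fun i => i.1.α) (fun i => i.1.β)
    (fun i => i.2)
  -- From the naive side back to the full tensor product, then a reordering of factors, the
  -- elimination of variables, and the identification with the complex of the closed diagram.
  exact e1.symm.trans (e2.trans (e3.trans e4))

end Braid

end KhovanovRozansky

end

open KhovanovRozansky in
theorem theorem2p7 {k : Type u} [Field k] (p : Polynomial k) (hp : p.eval 0 = 0) {d : ℕ}
    (w : List (BraidLetter d)) :
    ∃ e : (Braid.diagram w).naiveArcsHomology p (Braid.closureArcs w) ≅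
        (Braid.closure w).KRHomology p,
      (∀ (j : ℤ) (ε : ZMod 2),
        ((Braid.diagram w).naiveArcsHomologyPiece p (Braid.closureArcs w) 0 1 j ε).map
            (e.hom.f j).hom =
          (Braid.closure w).KRHomologyPiece p 0 1 j ε) ∧
      (∀ N : ℕ, p = Polynomial.X ^ (N + 1) → ∀ j g : ℤ,
        ((Braid.diagram w).naiveArcsHomologyPiece p (Braid.closureArcs w) 1 ((N : ℤ) - 1) j g).map
            (e.hom.f j).hom =
          (Braid.closure w).KRHomologyPiece p 1 ((N : ℤ) - 1) j g) := by
  obtain ⟨e, he⟩ := Braid.naiveArcs_homologyEquiv w p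
  refine ⟨e, fun j ε => ?_, fun N hN j g => ?_⟩
  · exact he ⟨⟨ZMod 2, 0, 1, fun m _ => by rw [smul_zero, smul_zero, zero_add]; rfl⟩, ε⟩ j
  · refine he ⟨⟨ℤ, 1, (N : ℤ) - 1, fun m hm => ?_⟩, g⟩ j
    -- Only the coefficient of exponent `N + 1` is nonzero, so the condition on the grading reads `2
    -- N = 2 + 2 (N - 1)`.
    have : m = N := by
      by_contra h
      rw [hN, Polynomial.coeff_X_pow, if_neg (by omega)] at hm
      exact hm rfl
    subst this
    simp
    ring
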